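/- **Setting.** Let $T$ be a totally ordered set of times and $(S,\otimes,\mathbf 1)$ a monoid (not necessarily commutative, and without inverses). A *window* is a finite sequence $t_1{:}v_1,\dots,t_n{:}v_n$ with $t_i\in T$, $v_i\in S$, $t_i<t_{i+1}$. Abstractly, $\mathrm{insert}(t,v)$ replaces $t_i{:}v_i$ by $t_i{:}(v_i\otimes v)$ if $t=t_i$, and otherwise puts $t{:}v$ at its place in time order; $\mathrm{evict}(t)$ removes $t_i{:}v_i$ if $t=t_i$, and otherwise does nothing; $\mathrm{query}()$ returns $v_1\otimes\dots\otimes v_n$, which is $\mathbf 1$ if $n=0$. **Finger B-trees with aggregates.** Fix $\mu\ge2$ (the minimum arity; the maximum arity is $2\mu$). Every node $y$ of arity $a$ holds $a-1$ timed values $t_0{:}v_0,\dots,t_{a-2}{:}v_{a-2}$, a stored aggregate $y.\mathrm{agg}\in S$ and, if it is not a leaf, children $z_0,\dots,z_{a-1}$. The left (right) finger is the left-most (right-most) leaf. A node is on the left (right) spine if it is the left (right) finger or an ancestor of it; thus the root is on both spines. Put (for a leaf, omit the factors coming from children) $$\Pi_\uparrow(y)=\Pi_\uparrow(z_0)\otimes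 v_0\otimes\Pi_\uparrow(z_1)\otimes\dots\otimes v_{a-2}\otimes\Pi_\uparrow(z_{a-1}),$$ $$\Pi_{\mathrm{inner}}(y)=v_0\otimes\Pi_\uparrow(z_1)\otimes v_1\otimes\dots\otimes\Pi_\uparrow(z_{a-2})\otimes v_{a-2},$$ and, for a node $y$ with parent $x$, $$\Pi_{\mathrm{left}}(y)=v_0\otimes\Pi_\uparrow(z_1)\otimes\dots\otimes v_{a-2}\otimes\Pi_\uparrow(z_{a-1})\otimes L,\qquad \Pi_{\mathrm{right}}(y)=R\otimes\Pi_\uparrow(z_0)\otimes v_0\otimes\dots\otimes\Pi_\uparrow(z_{a-2})\otimes v_{a-2},$$ where $L=R=\mathbf 1$ if $x$ is the root, and $L=\Pi_{\mathrm{left}}(x)$, $R=\Pi_{\mathrm{right}}(x)$ otherwise. The tree is a *finger B-tree with aggregates* if - (size) every node has arity at most $2\mu$, every non-root node has arity at least $\mu$, every non-leaf node has as many children as its arity, and the root has arity at least $2$, except that the empty window is stored as a single leaf of arity $1$; all leaves have the same depth; - (order) the in-order traversal of the tree is strictly increasing in time; this sequence is the window that the tree *contains*; - (aggregation) the root stores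 $\Pi_{\mathrm{inner}}$, each non-root node on the left spine stores $\Pi_{\mathrm{left}}$, each non-root node on the right spine stores $\Pi_{\mathrm{right}}$, and every other node stores $\Pi_\uparrow$. **Operations.** Locally repairing a node means recomputing its stored aggregate, of the kind belonging to its position, from its own values and the aggregates stored at its children and its parent. *Up-repairing* a node means locally repairing it if it lies on neither spine, and nothing otherwise. - $\mathrm{query}()$ returns $\mathrm{root.agg}$ if the root is a leaf, and $\mathrm{leftFinger.agg}\otimes\mathrm{root.agg}\otimes\mathrm{rightFinger.agg}$ otherwise. - Search for $t$: walk up from the fingers until the subtree where $t$ belongs is reached, then down to the node that contains $t$ or else to the leaf where $t$ belongs. - $\mathrm{insert}(t,v)$: search for $t$; insert $t{:}v$ into the node found (combining values if $t$ is present) and up-repair that node. While the current node has arity greater than $2\mu$: if it is the root, put a new root of arity $1$ above it; split it into nodes of arities $\mu+1$ and $\mu$, passing the timed value between them to the parent; up-repair both parts and the parent, and continue with the parent. Finally do the *final repair*. - $\mathrm{evict}(t)$: search for $t$; if $t$ is absent, do nothing. If $t$ is at a leaf, remove its entry there, up-repair the leaf, rebalance starting from it, and do the final repair. If $t$ is entry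 number $i$ of an inner node $y$, replace that entry by the first entry of the left-most leaf below $z_{i+1}$ if $z_{i+1}$ has arity greater than $\mu$, and by the last entry of the right-most leaf below $z_i$ otherwise; remove the substitute from its leaf and up-repair the leaf; rebalance starting from the leaf, also up-repairing $y$ when $y$ is reached; if rebalancing stopped below $y$, walk up to $y$, up-repairing each node reached; then do the final repair. - Rebalancing after an eviction: while the current node is not the root and has arity less than $\mu$, take an adjacent sibling (by an arbitrary rule if there are two). If the sibling has arity at most $\mu$, merge the two nodes with the parent's timed value between them; if the parent is the root and now has arity $1$, delete it, so that the merged node becomes the root. Otherwise move the nearest timed value and nearest child of the sibling to the node, rotating the timed value through the parent. Up-repair the changed nodes and continue with the parent (or with the new root). - Final repair, starting from the node $\mathrm{top}$ where the previous phase stopped: if $\mathrm{top}$ is on neither spine, go up, locally repairing each node reached, until a node on a spine is reached, which becomes $\mathrm{top}$; otherwise locally repair $\mathrm{top}$. Then, if $\mathrm{top}$ is on the left (right) spine, walk down from it to the left (right) finger, locally repairing each node reached. **Theorem.** For every $\mu\ge2$ and every rule for choosing siblings: 1. In every finger B-tree with aggregates that contains $t_1{:}v_1,\dots,t_n{:}v_n$,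 $\mathrm{query}()$ returns $v_1\otimes\dots\otimes v_n$. 2. The tree consisting of one leaf without entries is a finger B-tree with aggregates and contains the empty window. If a finger B-tree with aggregates contains the window $w$, then after $\mathrm{insert}(t,v)$, and likewise after $\mathrm{evict}(t)$, it is again a finger B-tree with aggregates, and it contains the window obtained from $w$ by the abstract operation. 3. Consequently, after any sequence of $\mathrm{insert}$ and $\mathrm{evict}$ operations on an initially empty tree, $\mathrm{query}()$ returns the aggregate, in time order, of the window obtained by the same sequence of abstract operations. -/

import Mathlib

/-! Out-of-order sliding-window aggregation with a finger B-tree whose nodes store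
position-aware partial aggregates.  `T` is the totally ordered type of times, `S` the monoid of
values; `*` is the aggregation operator and `1` its identity.  -/

namespace FiBA

/-! ## The abstract data type: a time-ordered window -/

/-- The abstract `insert`: if `t` occurs, its value `w` becomes `w * v`; otherwise the pair `(t, v)`
is put at its place in time order. -/
def insertEntry {T : Type*} {S : Type*} [LinearOrder T] [Monoid S] (t : T) (v : S) :
    List (T × S) → List (T × S)
  | [] => [(t, v)]
  | (s, w) :: r =>
    if t < s then (t, v) :: (s, w) :: r
    else if t = s then (s, w * v) :: r
    else (s, w) :: insertEntry t v r

/-- The abstract `evict`: remove the pair with time `t`, if there is one. -/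
def evictEntry {T : Type*} {S : Type*} [LinearOrder T] (t : T) (w : List (T × S)) :
    List (T × S) :=
  w.filter (fun e => e.1 ≠ t)

/-- The abstract `query`: `v₁ * ⋯ * vₙ` in time order (and `1` for the empty window). -/
def aggregate {T : Type*} {S : Type*} [Monoid S] (w : List (T × S)) : S :=
  (w.map Prod.snd).prod

/-- The update operations. -/
inductive Op (T : Type*) (S : Type*)
  | insert (t : T) (v : S)
  | evict (t : T)

/-- Effect of one update on the abstract window. -/
def Op.onWindow {T : Type*} {S : Type*} [LinearOrder T] [Monoid S]
    (w : List (T × S)) : Op T S → List (T × S)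
  | .insert t v => insertEntry t v w
  | .evict t => evictEntry t w

/-! ## Trees -/

/-- A tree node (together with the tree below it): the stored aggregate, the timed values
`t₀:v₀, …, t_{a-2}:v_{a-2}`, and the children `z₀, …, z_{a-1}` (none for a leaf). -/
structure Node (T : Type*) (S : Type*) where
  agg : S
  entries : List (T × S)
  children : List (Node T S)

/-- A pointer to a node: the child indices on the walk from the node up to the root.  Thus `[]` is
the root and `i :: q` is the `i`-th child of `q`; the parent pointer of `i :: q` is `q`. -/
abbrev Addr := List ℕ

/-- `x₀, y₀, x₁, y₁, …`; when one list is used up, the rest of the other one is appended. -/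
def alternate {α : Type*} : List α → List α → List α
  | [], ys => ys
  | xs, [] => xs
  | x :: xs, y :: ys => x :: y :: alternate xs ys

namespace Node

section Structural

variable {T : Type*} {S : Type*}

/-- The arity `a`; a node has `a - 1` timed values. -/
def arity (x : Node T S) : ℕ := x.entries.length + 1

def isLeaf (x : Node T S) : Bool := x.children.isEmpty

def values (x : Node T S) : List S := x.entries.map Prod.snd

mutual
/-- Number of edges on a longest downward path (it only bounds the number of iterations of
downward loops). -/
def height : Node T S → ℕ
  | ⟨_, _, cs⟩ => heights cs
/-- Auxiliary to `height`. -/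
def heights : List (Node T S) → ℕ
  | [] => 0
  | c :: cs => max (height c + 1) (heights cs)
end

mutual
/-- The timed values contained in the tree, in in-order: those of `z₀`, then `t₀:v₀`, then those
of `z₁`, and so on. -/
def window : Node T S → List (T × S)
  | ⟨_, es, cs⟩ => (alternate (windows cs) (es.map fun e => [e])).flatten
/-- Auxiliary to `window`. -/
def windows : List (Node T S) → List (List (T × S))
  | [] => []
  | c :: cs => window c :: windows cs
end

end Structural

variable {T : Type*} {S : Type*} [LinearOrder T] [Monoid S]

/-- The empty tree: a leaf without timed values. -/
def empty : Node T S := ⟨1, [], []⟩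

/-- The node that a pointer refers to (`empty` for a dangling pointer). -/
def nodeAt (B : Node T S) : Addr → Node T S
  | [] => B
  | i :: q => (nodeAt B q).children.getD i empty

/-- `p` is a pointer to a node of `B`. -/
def IsAddr (B : Node T S) : Addr → Prop
  | [] => True
  | i :: q => IsAddr B q ∧ i < (B.nodeAt q).children.length

/-- Change the node (and the tree below it) that `p` refers to. -/
def modifyAt (B : Node T S) : Addr → (Node T S → Node T S) → Node T S
  | [], f => f B
  | i :: q, f => modifyAt B q fun x => { x with children := x.children.modify i f }

/-- The node is the left finger or an ancestor of it. -/
def leftSpine (p : Addr) : Bool := p.all fun i => i == 0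

/-- The node is the right finger or an ancestor of it. -/
def rightSpine (B : Node T S) : Addr → Bool
  | [] => true
  | i :: q => (i + 1 == (B.nodeAt q).arity) && rightSpine B q

/-- The nodes that store the up-aggregate: those on neither spine, the root being on both. -/
def hasAggUp (B : Node T S) (p : Addr) : Bool := !leftSpine p && !rightSpine B p

/-- Pointer to the left-most leaf of the tree below `p`. -/
def leftmostLeaf (B : Node T S) (p : Addr) : Addr := go B.height p
where
  go : ℕ → Addr → Addr
    | 0, p => p
    | n + 1, p => if (B.nodeAt p).isLeaf then p else go n (0 :: p)

/-- Pointer to the right-most leaf of the tree below `p`. -/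
def rightmostLeaf (B : Node T S) (p : Addr) : Addr := go B.height p
where
  go : ℕ → Addr → Addr
    | 0, p => p
    | n + 1, p =>
      if (B.nodeAt p).isLeaf then p else go n (((B.nodeAt p).arity - 1) :: p)

def leftFinger (B : Node T S) : Addr := B.leftmostLeaf []

def rightFinger (B : Node T S) : Addr := B.rightmostLeaf []

/-! ## Partial aggregates and invariants -/

mutual
/-- Up-aggregate: `Π↑(y) = Π↑(z₀) v₀ Π↑(z₁) ⋯ v_{a-2} Π↑(z_{a-1})`. -/
def piUp : Node T S → S
  | ⟨_, es, cs⟩ => (alternate (piUps cs) (es.map Prod.snd)).prod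
/-- The up-aggregates of a list of nodes. -/
def piUps : List (Node T S) → List S
  | [] => []
  | c :: cs => piUp c :: piUps cs
end

/-- Inner aggregate: `v₀ Π↑(z₁) v₁ ⋯ Π↑(z_{a-2}) v_{a-2}`, without `z₀` and `z_{a-1}`. -/
def piInner (y : Node T S) : S :=
  (alternate y.values (piUps y.children).tail.dropLast).prod

/-- Left aggregate of the node at `p`: `v₀ Π↑(z₁) ⋯ v_{a-2} Π↑(z_{a-1})`, without `z₀`, followed by
the left aggregate of the parent, which is replaced by `1` if the parent is the root. -/
def piLeft (B : Node T S) : Addr → S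
  | [] => 1
  | i :: q =>
    (alternate (B.nodeAt (i :: q)).values (piUps (B.nodeAt (i :: q)).children).tail).prod
      * piLeft B q

/-- Right aggregate of the node at `p`: the right aggregate of the parent, which is replaced by `1`
if the parent is the root, followed by `Π↑(z₀) v₀ ⋯ Π↑(z_{a-2}) v_{a-2}`, without `z_{a-1}`. -/
def piRight (B : Node T S) : Addr → S
  | [] => 1
  | i :: q =>
    piRight B q *
      (alternate (piUps (B.nodeAt (i :: q)).children).dropLast (B.nodeAt (i :: q)).values).prod

/-- The size invariants with `MIN_ARITY = μ` and `MAX_ARITY = 2 * μ`.  The root has arity at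
least 2, except that the empty window is stored as a root leaf of arity 1. -/
structure SizeInv (μ : ℕ) (B : Node T S) : Prop where
  min_arity : ∀ p, B.IsAddr p → p ≠ [] → μ ≤ (B.nodeAt p).arity
  max_arity : ∀ p, B.IsAddr p → (B.nodeAt p).arity ≤ 2 * μ
  root_arity : 2 ≤ B.arity ∨ (B.entries = [] ∧ B.children = [])
  children_length : ∀ p, B.IsAddr p → (B.nodeAt p).isLeaf = false →
    (B.nodeAt p).children.length = (B.nodeAt p).arity

/-- All leaves are at the same depth. -/
def Balanced (B : Node T S) : Prop :=
  ∃ h : ℕ, ∀ p, B.IsAddr p → (B.nodeAt p).isLeaf = true → p.length = h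

/-- The timed values are in time order, within nodes and across nodes. -/
def Ordered (B : Node T S) : Prop := B.window.Pairwise fun e e' => e.1 < e'.1

/-- The aggregation invariants: which partial aggregate each node stores. -/
structure AggInv (B : Node T S) : Prop where
  root : B.agg = piInner B
  left : ∀ p, B.IsAddr p → p ≠ [] → leftSpine p = true → (B.nodeAt p).agg = B.piLeft p
  right : ∀ p, B.IsAddr p → p ≠ [] → B.rightSpine p = true → (B.nodeAt p).agg = B.piRight p
  up : ∀ p, B.IsAddr p → leftSpine p = false → B.rightSpine p = false →
    (B.nodeAt p).agg = piUp (B.nodeAt p)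

/-- `B` is a finger B-tree with aggregates. -/
structure IsFingerBTree (μ : ℕ) (B : Node T S) : Prop where
  size : B.SizeInv μ
  balanced : B.Balanced
  ordered : B.Ordered
  aggs : B.AggInv

/-! ## Query -/

def query (B : Node T S) : S :=
  if B.isLeaf then B.agg
  else (B.nodeAt B.leftFinger).agg * B.agg * (B.nodeAt B.rightFinger).agg

/-! ## Local repair of stored aggregates -/

/-- The partial aggregate that the node at `p` should store, computed in constant time from its
values and from the aggregates stored at its children and its parent. -/
def localAgg (B : Node T S) (p : Addr) : S :=
  let vs := (B.nodeAt p).values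
  let zs := (B.nodeAt p).children.map Node.agg
  match p with
  | [] => (alternate vs zs.tail.dropLast).prod
  | i :: q =>
    let parentAgg : S := if q = [] then 1 else (B.nodeAt q).agg
    if leftSpine (i :: q) then (alternate vs zs.tail).prod * parentAgg
    else if B.rightSpine (i :: q) then parentAgg * (alternate zs.dropLast vs).prod
    else (alternate zs vs).prod

def localRepairAgg (B : Node T S) (p : Addr) : Node T S :=
  B.modifyAt p fun x => { x with agg := B.localAgg p }

def localRepairAggIfUp (B : Node T S) (p : Addr) : Node T S :=
  if B.hasAggUp p then B.localRepairAgg p else B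

/-! ## Search -/

/-- The node has a timed value with time `t`. -/
def hasTime (x : Node T S) (t : T) : Bool := x.entries.any fun e => decide (e.1 = t)

/-- Walk down from `p` to the node that contains `t`, or else to the leaf where `t` belongs. -/
def searchDown (B : Node T S) (t : T) (p : Addr) : Addr := go B.height p
where
  go : ℕ → Addr → Addr
    | 0, p => p
    | n + 1, p =>
      let x := B.nodeAt p
      if x.isLeaf || x.hasTime t then p
      else go n ((x.entries.takeWhile fun e => decide (e.1 < t)).length :: p)

/-- Walk up from the two fingers in lockstep until the subtree where `t` belongs is reached, then
walk down.  Below the left-spine node `i :: p` are exactly the times less than the first time of its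
parent `p`; symmetrically for the right spine. -/
def searchUp (B : Node T S) (t : T) : Addr → Addr → Addr
  | i :: p, j :: q =>
    if (B.nodeAt p).entries.head?.any fun e => decide (t < e.1) then B.searchDown t (i :: p)
    else if (B.nodeAt q).entries.getLast?.any fun e => decide (e.1 < t) then
      B.searchDown t (j :: q)
    else searchUp B t p q
  | _, _ => B.searchDown t []

def searchNode (B : Node T S) (t : T) : Addr := B.searchUp t B.leftFinger B.rightFinger

/-! ## Local updates.  Repair of up-aggregates is piggybacked onto them. -/

def localInsertTimeAndValue (B : Node T S) (p : Addr) (t : T) (v : S) : Node T S :=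
  (B.modifyAt p fun x => { x with entries := insertEntry t v x.entries }).localRepairAggIfUp p

def localEvictTimeAndValue (B : Node T S) (p : Addr) (t : T) : Node T S :=
  (B.modifyAt p fun x => { x with entries := evictEntry t x.entries }).localRepairAggIfUp p

def setTimeAndValue (B : Node T S) (p : Addr) (idx : ℕ) (e : T × S) : Node T S :=
  B.modifyAt p fun x => { x with entries := x.entries.set idx e }

/-! ## Structural changes.  Repair of up-aggregates is piggybacked onto them. -/

/-- A new root whose only child is the old root. -/
def heightIncrease (B : Node T S) : Node T S := ⟨1, [], [B]⟩

/-- The only child of the root becomes the root. -/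
def heightDecrease (B : Node T S) : Node T S := B.nodeAt [0]

/-- Split the `i`-th child of `q`, of arity `2 * μ + 1`, into a left part of arity `μ + 1` and a
right part of arity `μ`; the timed value between them goes to `q`. -/
def split (μ : ℕ) (B : Node T S) (q : Addr) (i : ℕ) : Node T S :=
  let x := B.nodeAt (i :: q)
  let l : Node T S := ⟨x.agg, x.entries.take μ, x.children.take (μ + 1)⟩
  let r : Node T S := ⟨1, x.entries.drop (μ + 1), x.children.drop (μ + 1)⟩
  let B := B.modifyAt q fun y =>
    { y with
      entries := y.entries.take i ++ x.entries[μ]?.toList ++ y.entries.drop i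
      children := y.children.take i ++ [l, r] ++ y.children.drop (i + 1) }
  ((B.localRepairAggIfUp (i :: q)).localRepairAggIfUp ((i + 1) :: q)).localRepairAggIfUp q

/-- Merge the adjacent children `nodeIdx` and `siblingIdx` of `q` and the timed value of `q`
between them into one node. -/
def merge (B : Node T S) (q : Addr) (nodeIdx siblingIdx : ℕ) : Node T S :=
  let k := min nodeIdx siblingIdx
  let y := B.nodeAt q
  let l := B.nodeAt (k :: q)
  let r := B.nodeAt ((k + 1) :: q)
  let m : Node T S :=
    ⟨l.agg, l.entries ++ y.entries[k]?.toList ++ r.entries, l.children ++ r.children⟩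
  let B := B.modifyAt q fun y =>
    { y with
      entries := y.entries.eraseIdx k
      children := y.children.take k ++ [m] ++ y.children.drop (k + 2) }
  (B.localRepairAggIfUp (k :: q)).localRepairAggIfUp q

/-- Move the nearest timed value and the nearest child (if any) from the adjacent sibling
`siblingIdx` to `nodeIdx`, rotating the timed value through the parent `q`. -/
def move (B : Node T S) (q : Addr) (nodeIdx siblingIdx : ℕ) : Node T S :=
  let y := B.nodeAt q
  let x := B.nodeAt (nodeIdx :: q)
  let s := B.nodeAt (siblingIdx :: q)
  let B :=
    if nodeIdx < siblingIdx then
      let x' : Node T S :=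
        ⟨x.agg, x.entries ++ y.entries[nodeIdx]?.toList, x.children ++ s.children.take 1⟩
      let s' : Node T S := ⟨s.agg, s.entries.drop 1, s.children.drop 1⟩
      B.modifyAt q fun y =>
        { y with
          entries := y.entries.take nodeIdx ++ s.entries.take 1 ++ y.entries.drop (nodeIdx + 1)
          children := (y.children.set nodeIdx x').set siblingIdx s' }
    else
      let x' : Node T S :=
        ⟨x.agg, y.entries[siblingIdx]?.toList ++ x.entries,
          s.children.getLast?.toList ++ x.children⟩
      let s' : Node T S := ⟨s.agg, s.entries.dropLast, s.children.dropLast⟩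
      B.modifyAt q fun y =>
        { y with
          entries := y.entries.take siblingIdx ++ s.entries.getLast?.toList
            ++ y.entries.drop (siblingIdx + 1)
          children := (y.children.set nodeIdx x').set siblingIdx s' }
  ((B.localRepairAggIfUp (nodeIdx :: q)).localRepairAggIfUp (siblingIdx :: q)).localRepairAggIfUp q

/-! ## Rebalancing.  The results are the new tree, the node where rebalancing topped out, and
whether the left and the right spine were hit. -/

/-- The loop of `rebalanceForInsert`. -/
def insertLoop (μ : ℕ) (B : Node T S) : Addr → Bool → Bool → Node T S × Addr × Bool × Bool
  | [], hitL, hitR =>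
    if 2 * μ < B.arity then
      -- The new root has arity 2, so the loop ends after this iteration.
      (split μ B.heightIncrease [] 0, [], true, true)
    else (B, [], hitL, hitR)
  | i :: q, hitL, hitR =>
    if 2 * μ < (B.nodeAt (i :: q)).arity then
      let B := split μ B q i
      insertLoop μ B q (hitL || leftSpine q) (hitR || B.rightSpine q)
    else (B, i :: q, hitL, hitR)

def rebalanceForInsert (μ : ℕ) (B : Node T S) (p : Addr) : Node T S × Addr × Bool × Bool :=
  insertLoop μ B p (leftSpine p) (B.rightSpine p)

/-- The sibling with which the `i`-th child of `q` is rebalanced: an adjacent one.  If there are two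
of them, the rule `pick` decides (`true` means the right one). -/
def pickEvictionSibling (pick : Node T S → Addr → Bool) (B : Node T S) (q : Addr) (i : ℕ) : ℕ :=
  if i = 0 then 1
  else if i + 1 = (B.nodeAt q).arity then i - 1
  else if pick B (i :: q) then i + 1
  else i - 1

/-- The loop of `rebalanceForEvict`; it ends at the root.  After `heightDecrease` the current node is
the new root, whose pointer `[]` is the same as that of the old one. -/
def evictLoop (μ : ℕ) (pick : Node T S → Addr → Bool) (toRepair : Option Addr) (B : Node T S) :
    Addr → Bool → Bool → Node T S × Addr × Bool × Bool
  | [], hitL, hitR => (B, [], hitL, hitR)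
  | i :: q, hitL, hitR =>
    if (B.nodeAt (i :: q)).arity < μ then
      let j := pickEvictionSibling pick B q i
      let hitR := hitR || B.rightSpine (j :: q)
      let B :=
        if (B.nodeAt (j :: q)).arity ≤ μ then
          let B := B.merge q i j
          if q = [] ∧ B.arity = 1 then B.heightDecrease else B
        else B.move q i j
      let B := if toRepair = some q then B.localRepairAggIfUp q else B
      evictLoop μ pick toRepair B q (hitL || leftSpine q) (hitR || B.rightSpine q)
    else (B, i :: q, hitL, hitR)

def rebalanceForEvict (μ : ℕ) (pick : Node T S → Addr → Bool) (B : Node T S) (p : Addr)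
    (toRepair : Option Addr) : Node T S × Addr × Bool × Bool :=
  let hitL := leftSpine p
  let hitR := B.rightSpine p
  let B := if toRepair = some p then B.localRepairAggIfUp p else B
  evictLoop μ pick toRepair B p hitL hitR

/-! ## Repair of the remaining aggregates -/

/-- `while top.hasAggUp() { top ← top.parent; top.localRepairAgg() }` -/
def repairUp (B : Node T S) : Addr → Node T S × Addr
  | [] => (B, [])
  | i :: q => if B.hasAggUp (i :: q) then repairUp (B.localRepairAgg q) q else (B, i :: q)

/-- Walk down from `p` to the left-most leaf, repairing each node that is reached. -/
def repairLeft (B : Node T S) (p : Addr) : Node T S := go B.height B p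
where
  go : ℕ → Node T S → Addr → Node T S
    | 0, B, _ => B
    | n + 1, B, p =>
      if (B.nodeAt p).isLeaf then B else go n (B.localRepairAgg (0 :: p)) (0 :: p)

/-- Walk down from `p` to the right-most leaf, repairing each node that is reached. -/
def repairRight (B : Node T S) (p : Addr) : Node T S := go B.height B p
where
  go : ℕ → Node T S → Addr → Node T S
    | 0, B, _ => B
    | n + 1, B, p =>
      if (B.nodeAt p).isLeaf then B
      else
        let c := ((B.nodeAt p).arity - 1) :: p
        go n (B.localRepairAgg c) c

def repairAggs : Node T S × Addr × Bool × Bool → Node T S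
  | (B, top, hitL, hitR) =>
    let (B, top) := if B.hasAggUp top then B.repairUp top else (B.localRepairAgg top, top)
    let B := if leftSpine top || (top.isEmpty && hitL) then B.repairLeft top else B
    if B.rightSpine top || (top.isEmpty && hitR) then B.repairRight top else B

/-! ## Insert and evict -/

def insert (μ : ℕ) (B : Node T S) (t : T) (v : S) : Node T S :=
  let p := B.searchNode t
  let B := B.localInsertTimeAndValue p t v
  repairAggs (B.rebalanceForInsert μ p)

/-- `while top ≠ node { top ← top.parent; … }` in `evictInner`. -/
def evictInnerLoop (node : Addr) (B : Node T S) :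
    Addr → Bool → Bool → Node T S × Addr × Bool × Bool
  | [], hitL, hitR => (B, [], hitL, hitR)
  | i :: q, hitL, hitR =>
    if i :: q = node then (B, i :: q, hitL, hitR)
    else evictInnerLoop node (B.localRepairAggIfUp q) q
      (hitL || leftSpine q) (hitR || B.rightSpine q)

/-- Evict the timed value number `idx` of the inner node `node`: a neighbouring timed value is evicted
from a leaf instead and written over the evicted slot. -/
def evictInner (μ : ℕ) (pick : Node T S → Addr → Bool) (B : Node T S) (node : Addr) (idx : ℕ) :
    Node T S × Addr × Bool × Bool :=
  let right := (idx + 1) :: node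
  let left := idx :: node
  let leaf := if μ < (B.nodeAt right).arity then B.leftmostLeaf right else B.rightmostLeaf left
  let substitute :=
    if μ < (B.nodeAt right).arity then (B.nodeAt leaf).entries.head?
    else (B.nodeAt leaf).entries.getLast?
  match substitute with
  | none => (B, node, false, false) -- never happens, because no leaf other than the root is empty
  | some e =>
    let B := B.localEvictTimeAndValue leaf e.1
    let B := B.setTimeAndValue node idx e
    match B.rebalanceForEvict μ pick leaf (some node) with
    | (B, top, hitL, hitR) =>
      -- `node <:+ top` says that `top` is `node` or a descendant of it
      if node <:+ top then evictInnerLoop node B top hitL hitR else (B, top, hitL, hitR)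

def evict (μ : ℕ) (pick : Node T S → Addr → Bool) (B : Node T S) (t : T) : Node T S :=
  let p := B.searchNode t
  let x := B.nodeAt p
  match x.entries.findIdx? fun e => decide (e.1 = t) with
  | none => B
  | some idx =>
    if x.isLeaf then
      repairAggs ((B.localEvictTimeAndValue p t).rebalanceForEvict μ pick p none)
    else repairAggs (B.evictInner μ pick p idx)

/-- Effect of one update on the tree. -/
def update (μ : ℕ) (pick : Node T S → Addr → Bool) (B : Node T S) : Op T S → Node T S
  | .insert t v => B.insert μ t v
  | .evict t => B.evict μ pick t

end Node

end FiBA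

/-!
Everything rests on the in-order traversal. The window of a node is the alternation `weave` of the
windows of its children with its entries, and `weave_join` cuts it at an entry; hence splitting,
merging and moving leave the window alone. Since `*` is associative, `piUp` of a subtree is the
aggregate of its window (`piUp_eq_aggregate`). Going down a spine, `piLeft` (or `piRight`) of a
node lacks only what lies below its first (last) child (`piUp_left`, `piUp_right`), and at a
finger nothing is lacking. So the aggregates stored at the two fingers are `piUp` of the first and
of the last child of the root, and with the inner aggregate of the root between them they give
`piUp` of the root: this is `query_eq`.

An update has two phases. Up to the final repair, the aggregates stored on the spines are of no
concern. The invariants without them are kept in recursive form: `Kids` and `Good` for a subtree,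
with two flags telling whether its root is on the left and on the right spine, and `CtxOK` for
what surrounds the node at an address. A loop that has climbed to `p` has the invariant `StateOK`:
the surroundings of `p` and the subtree at `p` are fine, the up-aggregates of the proper ancestors
of `p` are unknown, and the arity at `p` may be off by one. A step from `i :: q` to `q` only
replaces the subtree at `q` by another one that satisfies `Good` and has the same window
(`split_spec`, `merge_spec`, `move_from_right_spec`, `move_from_left_spec`); only a growing or
shrinking of the tree at the root is a case of its own. This gives `insertLoop_spec`,
`evictLoop_spec` and `evictInnerLoop_spec`, with the extra information (`Within`) that the result
differs from the original tree only in the subtree at the address where the loop stopped.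

The final repair climbs to the first node `m` on a spine; from there on all nodes that are on
neither spine are right (`repairUp_spec`, `CtxOK.exists_kids`). As all changes are in the subtree
at `m`, and as the aggregate of a spine node does not look at its child on the same spine, the
aggregates on the spine of `m` above `m`, at the root (if `m` is not the root) and on the other
spine are still right (`unaffected_left`, `unaffected_right`). Local repairs at `m` and downwards
from `m` to the finger do the rest, since each finds its parent and its children right
(`repairLeft_go_spec`, `repairRight_go_spec`, `repairAggs_spec`). The flags `hitL` and `hitR` play
no role: they are consulted only at the root, which is on both spines. Repairs do not change what
is left when the stored aggregates are forgotten (`strip`), so all other notions are unaffected by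
them.

The search keeps the property `Fits` that everything left of the current subtree is before `t` and
everything right of it after `t` (`searchNode_spec`), so an abstract operation on the whole window
amounts to the same operation on the node found. Evicting from an inner node exchanges the entry
with its neighbour in the traversal, which lies in a leaf (`evictInner_prepare`,
`evictInner_spec`).
-/

namespace FiBA

/-! ### Alternating lists -/

section Lists

variable {α β : Type*}

@[simp] theorem alternate_nil_left (ys : List α) : alternate [] ys = ys := by
  cases ys <;> rfl

@[simp] theorem alternate_nil_right (xs : List α) : alternate xs [] = xs := by
  cases xs <;> rfl

theorem alternate_cons (x : α) (xs ys : List α) :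
    alternate (x :: xs) ys = x :: alternate ys xs := by
  induction ys generalizing x xs with
  | nil => simp
  | cons y ys ih => cases xs with
    | nil => simp [alternate]
    | cons z zs => rw [alternate, ih]; rw [alternate]

theorem alternate_append {xs ys : List α} (h : xs.length = ys.length) (xs' ys' : List α) :
    alternate (xs ++ xs') (ys ++ ys') = alternate xs ys ++ alternate xs' ys' := by
  induction xs generalizing ys with
  | nil => cases ys <;> simp_all
  | cons x xs ih => cases ys with
    | nil => simp at h
    | cons y ys => simp [alternate, ih (by simpa using h)]

theorem map_alternate (f : α → β) (xs ys : List α) :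
    (alternate xs ys).map f = alternate (xs.map f) (ys.map f) := by
  induction xs generalizing ys with
  | nil => simp
  | cons x xs ih => cases ys <;> simp [alternate, ih]

/-- `P l r` holds along a list of siblings, where the first one inherits the flag `l` of the parent,
the last one inherits its flag `r`, and all other flags are `false`. -/
def ForallPos (P : Bool → Bool → α → Prop) : Bool → Bool → List α → Prop
  | _, _, [] => True
  | l, r, c :: cs => P l (r && cs.isEmpty) c ∧ ForallPos P false r cs

variable {P : Bool → Bool → α → Prop} {l r : Bool}

@[simp] theorem forallPos_nil : ForallPos P l r [] := trivial

@[simp] theorem forallPos_cons {c : α} {cs : List α} :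
    ForallPos P l r (c :: cs) ↔ P l (r && cs.isEmpty) c ∧ ForallPos P false r cs := Iff.rfl

theorem forallPos_append {a b : List α} :
    ForallPos P l r (a ++ b) ↔
      ForallPos P l (r && b.isEmpty) a ∧ ForallPos P (l && a.isEmpty) r b := by
  induction a generalizing l with
  | nil => simp
  | cons c a ih =>
    simp only [List.cons_append, forallPos_cons, ih]
    cases a <;> cases b <;> simp [and_assoc]

theorem ForallPos.forall_mem {p : α → Prop} (h : ∀ l r c, P l r c → p c)
    {cs : List α} (hp : ForallPos P l r cs) : ∀ c ∈ cs, p c := by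
  induction cs generalizing l with
  | nil => simp
  | cons c cs ih =>
    intro d hd
    rcases List.mem_cons.1 hd with rfl | hd
    · exact h _ _ _ hp.1
    · exact ih hp.2 d hd

theorem forallPos_of_get {cs : List α}
    (h : ∀ a c b, cs = a ++ c :: b → P (l && a.isEmpty) (r && b.isEmpty) c) :
    ForallPos P l r cs := by
  induction cs generalizing l with
  | nil => trivial
  | cons c cs ih =>
    refine ⟨by simpa using h [] c cs rfl, ih fun a d b e => ?_⟩
    simpa using h (c :: a) d b (by simp [e])

/-- Siblings all of whose flags are `false`.  The next three lemmas drop the first or the last sibling,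
whose flags may be `true`. -/
theorem ForallPos.map_eq {f g : α → β} (h : ∀ c, P false false c → f c = g c) {cs : List α}
    (hp : ForallPos P false false cs) : cs.map f = cs.map g := by
  induction cs with
  | nil => rfl
  | cons c cs ih =>
    have h1 := hp.1
    rw [Bool.false_and] at h1
    simp [h c h1, ih hp.2]

theorem ForallPos.map_tail_eq {f g : α → β} (h : ∀ c, P false false c → f c = g c) {cs : List α}
    (hp : ForallPos P l false cs) : (cs.map f).tail = (cs.map g).tail := by
  cases cs with
  | nil => rfl
  | cons c cs => exact hp.2.map_eq h

theorem ForallPos.map_dropLast_eq {f g : α → β} (h : ∀ c, P false false c → f c = g c)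
    {cs : List α} (hp : ForallPos P false r cs) :
    (cs.map f).dropLast = (cs.map g).dropLast := by
  rcases List.eq_nil_or_concat cs with rfl | ⟨a, c, rfl⟩
  · rfl
  · rw [List.concat_eq_append, forallPos_append] at hp
    have h1 := hp.1
    simp only [List.isEmpty_cons, Bool.and_false] at h1
    simp [h1.map_eq h]

theorem ForallPos.map_tail_dropLast_eq {f g : α → β} (h : ∀ c, P false false c → f c = g c)
    {cs : List α} (hp : ForallPos P l r cs) :
    (cs.map f).tail.dropLast = (cs.map g).tail.dropLast := by
  cases cs with
  | nil => rfl
  | cons c cs => exact hp.2.map_dropLast_eq h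

theorem isEmpty_eq_length_beq (a : List α) : a.isEmpty = (a.length == 0) := by
  cases a <;> simp

theorem isEmpty_eq_false {a : List α} (h : 0 < a.length) : a.isEmpty = false := by
  cases a <;> simp_all

theorem exists_eq_append_cons {cs : List α} {i : ℕ} (h : i < cs.length) :
    ∃ a c b, cs = a ++ c :: b ∧ a.length = i :=
  ⟨cs.take i, cs[i], cs.drop (i + 1), by simp, by simp; omega⟩

theorem exists_eq_append {cs : List α} {i : ℕ} (h : i ≤ cs.length) :
    ∃ a b, cs = a ++ b ∧ a.length = i :=
  ⟨cs.take i, cs.drop i, by simp, by simp; omega⟩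

theorem modify_append_cons (f : α → α) (a : List α) (c : α) (b : List α) :
    (a ++ c :: b).modify a.length f = a ++ f c :: b := by
  induction a with
  | nil => simp
  | cons x a ih => simp [ih]

theorem modify_append_cons_cons (f : α → α) (a : List α) (c d : α) (b : List α) :
    (a ++ c :: d :: b).modify (a.length + 1) f = a ++ c :: f d :: b := by
  induction a with
  | nil => simp
  | cons x a ih => simp [ih]

end Lists

/-! ### Windows of alternating lists of subtrees and entries -/

namespace Node

section Weave

variable {T S : Type*}

theorem height_eq (x : Node T S) : x.height = heights x.children := by cases x; rfl

theorem windows_eq_map (cs : List (Node T S)) : windows cs = cs.map window := by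
  induction cs with
  | nil => rfl
  | cons c cs ih => simp [windows, ih]

theorem flatten_map_singleton (E : List (T × S)) : (E.map fun e => [e]).flatten = E := by
  induction E <;> simp_all

/-- The window of the subtrees `C` and the entries `E` in alternation, starting with a subtree. -/
def weave (C : List (Node T S)) (E : List (T × S)) : List (T × S) :=
  (alternate (C.map window) (E.map fun e => [e])).flatten

/-- The window of the entries `E` and the subtrees `C` in alternation, starting with an entry. -/
def weave' (E : List (T × S)) (C : List (Node T S)) : List (T × S) :=
  (alternate (E.map fun e => [e]) (C.map window)).flatten

theorem window_eq_weave (x : Node T S) : x.window = weave x.children x.entries := by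
  cases x; simp [window, weave, windows_eq_map]

@[simp] theorem weave_nil_left (E : List (T × S)) : weave [] E = E := by
  simp [weave, flatten_map_singleton]

@[simp] theorem weave'_nil_right (E : List (T × S)) : weave' E [] = E := by
  simp [weave', flatten_map_singleton]

@[simp] theorem weave_cons (c : Node T S) (C : List (Node T S)) (E : List (T × S)) :
    weave (c :: C) E = c.window ++ weave' E C := by
  simp [weave, weave', alternate_cons]

@[simp] theorem weave'_cons (e : T × S) (E : List (T × S)) (C : List (Node T S)) :
    weave' (e :: E) C = e :: weave C E := by
  simp [weave, weave', alternate_cons]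

theorem weave_append {C : List (Node T S)} {E : List (T × S)} (h : C.length = E.length)
    (C' : List (Node T S)) (E' : List (T × S)) :
    weave (C ++ C') (E ++ E') = weave C E ++ weave C' E' := by
  simp [weave, alternate_append (xs := C.map window) (ys := E.map fun e => [e]) (by simpa using h)]

/-- A node with an entry `e` reads as the part left of `e`, `e`, and the part right of `e`.  This
one identity shows that splitting, merging and moving do not change the window. -/
theorem weave_join {D₁ D₂ : List (Node T S)} {F₁ F₂ : List (T × S)} (e : T × S)
    (h : D₁.length = F₁.length + 1 ∨ D₁ = [] ∧ D₂ = []) :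
    weave (D₁ ++ D₂) (F₁ ++ e :: F₂) = weave D₁ F₁ ++ e :: weave D₂ F₂ := by
  rcases h with h | ⟨rfl, rfl⟩
  · rcases List.eq_nil_or_concat D₁ with rfl | ⟨D, d, rfl⟩
    · simp at h
    · have hl : D.length = F₁.length := by simpa using h
      have h1 : weave (D ++ [d]) F₁ = weave D F₁ ++ d.window := by
        simpa using weave_append hl [d] []
      simp [List.append_assoc, h1, weave_append hl]
  · simp

theorem window_replace {s : S} {es : List (T × S)} {cs ds : List (Node T S)}
    (hd : ds.map window = cs.map window) (t : S) : window ⟨t, es, ds⟩ = window ⟨s, es, cs⟩ := by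
  simp [window_eq_weave, weave, hd]

/-- The position of an entry in the window of its node. -/
theorem exists_weave_entry (C : List (Node T S)) (E F : List (T × S)) :
    ∃ P Q, ∀ e, weave C (E ++ e :: F) = P ++ e :: Q := by
  induction E generalizing C with
  | nil => cases C with
    | nil => exact ⟨[], F, by simp⟩
    | cons c C => exact ⟨c.window, weave C F, by simp⟩
  | cons f E ih => cases C with
    | nil => exact ⟨f :: E, F, by simp⟩
    | cons c C =>
      obtain ⟨P, Q, h⟩ := ih C
      exact ⟨c.window ++ f :: P, Q, by simp [h]⟩

/-- The flags of the child between the siblings `a` and `b`. -/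
theorem flags_eq {l r : Bool} {y : Node T S} {a b : List (Node T S)} {c : Node T S}
    (hy : y.children.length = y.arity) (e : y.children = a ++ c :: b) :
    (l && a.isEmpty) = (a.length == 0 && l) ∧
      (r && b.isEmpty) = (a.length + 1 == y.arity && r) := by
  have h1 : a.isEmpty = (a.length == 0) := isEmpty_eq_length_beq a
  have h2 : b.isEmpty = (a.length + 1 == y.arity) := by
    rw [isEmpty_eq_length_beq, ← hy, e, Bool.eq_iff_iff]
    simp
  rw [h1, h2]
  exact ⟨Bool.and_comm _ _, Bool.and_comm _ _⟩

end Weave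

section PiUp

variable {T S : Type*} [Monoid S]

theorem piUps_eq_map (cs : List (Node T S)) : piUps cs = cs.map piUp := by
  induction cs with
  | nil => rfl
  | cons c cs ih => simp [piUps, ih]

theorem piUp_eq (x : Node T S) :
    x.piUp = (alternate (x.children.map piUp) x.values).prod := by
  cases x; simp [piUp, piUps_eq_map, values]

end PiUp

/-! ### Addresses and changes at an address -/

section Addresses

variable {T S : Type*}

theorem modifyAt_append (B : Node T S) (b a : Addr) (f : Node T S → Node T S) :
    modifyAt B (b ++ a) f = modifyAt B a fun x => modifyAt x b f := by
  induction b generalizing f with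
  | nil => rfl
  | cons i b ih => exact ih _

theorem modifyAt_modifyAt (B : Node T S) (p : Addr) (f g : Node T S → Node T S) :
    modifyAt (modifyAt B p f) p g = modifyAt B p fun x => g (f x) := by
  induction p generalizing f g with
  | nil => rfl
  | cons i q ih => simp [modifyAt, ih, List.modify_modify_eq]; rfl

theorem modifyAt_id (B : Node T S) (p : Addr) : modifyAt B p (fun x => x) = B := by
  induction p with
  | nil => rfl
  | cons i q ih =>
    have h : (fun x : Node T S => { x with children := x.children.modify i fun x => x }) =
        fun x => x := by
      funext x; cases x; simp [show (fun x : Node T S => x) = id from rfl]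
    rw [modifyAt, h, ih]

/-- Below a proper ancestor, a change only affects one of the children. -/
theorem modifyAt_concat (x : Node T S) (b : Addr) (i : ℕ) (f : Node T S → Node T S) :
    modifyAt x (b ++ [i]) f =
      { x with children := x.children.modify i fun c => modifyAt c b f } := by
  rw [modifyAt_append]; rfl

theorem modifyAt_entries (x : Node T S) {b : Addr} (hb : b ≠ []) (f : Node T S → Node T S) :
    (modifyAt x b f).entries = x.entries := by
  obtain ⟨b, i, rfl⟩ := List.eq_nil_or_concat b |>.resolve_left hb
  rw [List.concat_eq_append, modifyAt_concat]

theorem modifyAt_agg (x : Node T S) {b : Addr} (hb : b ≠ []) (f : Node T S → Node T S) :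
    (modifyAt x b f).agg = x.agg := by
  obtain ⟨b, i, rfl⟩ := List.eq_nil_or_concat b |>.resolve_left hb
  rw [List.concat_eq_append, modifyAt_concat]

/-- `B'` arises from `B` by a change below (or at) `p`. -/
def Within (B B' : Node T S) (p : Addr) : Prop := ∃ f, B' = modifyAt B p f

theorem Within.refl (B : Node T S) (p : Addr) : Within B B p := ⟨_, (modifyAt_id B p).symm⟩

theorem Within.trans {B B' B'' : Node T S} {p : Addr} (h : Within B B' p) (h' : Within B' B'' p) :
    Within B B'' p := by
  obtain ⟨f, rfl⟩ := h
  obtain ⟨g, rfl⟩ := h'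
  exact ⟨_, modifyAt_modifyAt B p f g⟩

theorem Within.mono {B B' : Node T S} {p q : Addr} (h : Within B B' p) (hq : q <:+ p) :
    Within B B' q := by
  obtain ⟨b, rfl⟩ := hq
  obtain ⟨f, rfl⟩ := h
  exact ⟨_, modifyAt_append B b q f⟩

theorem within_nil (B B' : Node T S) : Within B B' [] := ⟨fun _ => B', rfl⟩

theorem within_modifyAt (B : Node T S) (p : Addr) (f : Node T S → Node T S) :
    Within B (modifyAt B p f) p := ⟨f, rfl⟩

variable [Monoid S]

theorem nodeAt_append (B : Node T S) (b a : Addr) : nodeAt B (b ++ a) = nodeAt (nodeAt B a) b := by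
  induction b with
  | nil => rfl
  | cons i b ih => simp [nodeAt, ih]

theorem isAddr_append {B : Node T S} {b a : Addr} :
    IsAddr B (b ++ a) ↔ IsAddr B a ∧ IsAddr (nodeAt B a) b := by
  induction b with
  | nil => simp [IsAddr]
  | cons i b ih => simp [IsAddr, ih, nodeAt_append, and_assoc]

theorem IsAddr.suffix {B : Node T S} {p q : Addr} (h : IsAddr B p) (hq : q <:+ p) : IsAddr B q := by
  obtain ⟨b, rfl⟩ := hq
  exact (isAddr_append.1 h).1

theorem nodeAt_cons {B : Node T S} {q : Addr} {a b : List (Node T S)} {c : Node T S}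
    (h : (nodeAt B q).children = a ++ c :: b) : nodeAt B (a.length :: q) = c := by
  simp [nodeAt, h]

/-- A change at `p` depends only on what is done to the node at `p`; so `fun _ => y` with a concrete
node `y` can take the place of any change. -/
theorem modifyAt_congr {B : Node T S} {p : Addr} {f g : Node T S → Node T S}
    (h : f (nodeAt B p) = g (nodeAt B p)) : modifyAt B p f = modifyAt B p g := by
  induction p generalizing f g with
  | nil => exact h
  | cons i q ih =>
    refine ih ?_
    rw [nodeAt] at h
    generalize (nodeAt B q) = y at h
    by_cases hi : i < y.children.length
    · obtain ⟨a, c, b, e, rfl⟩ := exists_eq_append_cons hi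
      rw [e] at h ⊢
      simp only [modify_append_cons]
      simp at h
      rw [h]
    · have hi : y.children.length ≤ i := by omega
      simp [List.modify_eq_self, hi]

theorem nodeAt_modifyAt_and {B : Node T S} {p : Addr} (hp : IsAddr B p)
    (f : Node T S → Node T S) :
    nodeAt (modifyAt B p f) p = f (nodeAt B p) ∧ IsAddr (modifyAt B p f) p := by
  induction p generalizing f with
  | nil => exact ⟨rfl, trivial⟩
  | cons i q ih =>
    obtain ⟨h1, h2⟩ := ih hp.1 fun x => { x with children := x.children.modify i f }
    obtain ⟨a, c, b, e, rfl⟩ := exists_eq_append_cons hp.2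
    refine ⟨?_, h2, ?_⟩
    · rw [modifyAt, nodeAt, h1, nodeAt]
      simp [e, modify_append_cons]
    · rw [modifyAt, h1]
      simp [e]

theorem nodeAt_modifyAt {B : Node T S} {p : Addr} (hp : IsAddr B p)
    (f : Node T S → Node T S) : nodeAt (modifyAt B p f) p = f (nodeAt B p) :=
  (nodeAt_modifyAt_and hp f).1

theorem IsAddr.modifyAt {B : Node T S} {p : Addr} (hp : IsAddr B p)
    (f : Node T S → Node T S) : IsAddr (modifyAt B p f) p :=
  (nodeAt_modifyAt_and hp f).2

/-- Seen from an ancestor `q`, a change at `b ++ q` is the change at `b`. -/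
theorem nodeAt_modifyAt_append {B : Node T S} {q : Addr} (hq : IsAddr B q) (b : Addr)
    (f : Node T S → Node T S) :
    nodeAt (modifyAt B (b ++ q) f) q = modifyAt (nodeAt B q) b f := by
  rw [modifyAt_append, nodeAt_modifyAt hq]

theorem rightSpine_modifyAt_append {B : Node T S} {b q : Addr} (hq : IsAddr B q)
    (f : Node T S → Node T S) :
    rightSpine (modifyAt B (b ++ q) f) q = rightSpine B q := by
  induction q generalizing b with
  | nil => rfl
  | cons i q ih =>
    have e : b ++ i :: q = (b ++ [i]) ++ q := by simp
    simp only [rightSpine, arity]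
    rw [e, ih hq.1, nodeAt_modifyAt_append hq.1, modifyAt_entries _ (by simp)]

theorem rightSpine_modifyAt {B : Node T S} {q : Addr} (hq : IsAddr B q)
    (f : Node T S → Node T S) : rightSpine (modifyAt B q f) q = rightSpine B q :=
  rightSpine_modifyAt_append (b := []) hq f

@[simp] theorem leftSpine_nil : leftSpine [] = true := rfl

@[simp] theorem leftSpine_cons (i : ℕ) (q : Addr) :
    leftSpine (i :: q) = (i == 0 && leftSpine q) := by simp [leftSpine]

@[simp] theorem rightSpine_nil (B : Node T S) : rightSpine B [] = true := rfl

theorem rightSpine_cons (B : Node T S) (i : ℕ) (q : Addr) :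
    rightSpine B (i :: q) = (i + 1 == (B.nodeAt q).arity && rightSpine B q) := rfl

/-- The part of the window that is left of the subtree at `p`. -/
def before (B : Node T S) : Addr → List (T × S)
  | [] => []
  | i :: q => before B q ++ weave ((nodeAt B q).children.take i) ((nodeAt B q).entries.take i)

/-- The part of the window that is right of the subtree at `p`. -/
def after (B : Node T S) : Addr → List (T × S)
  | [] => []
  | i :: q =>
    weave' ((nodeAt B q).entries.drop i) ((nodeAt B q).children.drop (i + 1)) ++ after B q

/-- `p` is an address, and every node on the way has an entry left of each child but the first. -/
def PathOK (B : Node T S) : Addr → Prop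
  | [] => True
  | i :: q => PathOK B q ∧ i < (nodeAt B q).children.length ∧ i ≤ (nodeAt B q).entries.length

/-- The window of a node, cut at the child number `i`. -/
theorem weave_split (y : List (Node T S)) (es : List (T × S)) {i : ℕ} (h : i < y.length)
    (h' : i ≤ es.length) (g : Node T S → Node T S) :
    weave (y.modify i g) es =
      weave (y.take i) (es.take i) ++ (g (y.getD i empty)).window ++
        weave' (es.drop i) (y.drop (i + 1)) := by
  obtain ⟨a, c, b, rfl, rfl⟩ := exists_eq_append_cons h
  obtain ⟨E, F, rfl, hE⟩ := exists_eq_append h'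
  rw [modify_append_cons, weave_append hE.symm]
  simp [← hE]
  simp [hE]

/-- The window of the tree is cut into the parts left of, below, and right of `p`; a change at `p`
concerns only the middle part. -/
theorem window_modifyAt {B : Node T S} {p : Addr} (hp : PathOK B p) (f : Node T S → Node T S) :
    (modifyAt B p f).window = before B p ++ (f (nodeAt B p)).window ++ after B p := by
  induction p generalizing f with
  | nil => simp [before, after, modifyAt, nodeAt]
  | cons i q ih =>
    rw [modifyAt, ih hp.1, window_eq_weave, weave_split _ _ hp.2.1 hp.2.2]
    simp [before, after, nodeAt]

theorem window_eq {B : Node T S} {p : Addr} (hp : PathOK B p) :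
    B.window = before B p ++ (nodeAt B p).window ++ after B p := by
  simpa [modifyAt_id] using window_modifyAt hp fun x => x

theorem window_modifyAt_eq {B : Node T S} {p : Addr} (hp : PathOK B p) {f : Node T S → Node T S}
    (h : (f (nodeAt B p)).window = (nodeAt B p).window) : (modifyAt B p f).window = B.window := by
  rw [window_modifyAt hp, window_eq hp, h]

end Addresses

/-! ### Invariants of a subtree and of its surroundings -/

section Invariants

variable {T S : Type*} [Monoid S]

/-- All invariants of the proper descendants of `x`, except for the aggregates stored on the spines:
all leaves are `h` levels below `x`, the arities are right, and every node that is on neither spine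
stores its up-aggregate.  The flags tell whether `x` is on the left and on the right spine. -/
def Kids (μ : ℕ) : ℕ → Bool → Bool → Node T S → Prop
  | 0, _, _, x => x.children = []
  | h + 1, l, r, x => x.children.length = x.arity ∧
      ForallPos (fun l r c => (μ ≤ c.arity ∧ c.arity ≤ 2 * μ) ∧
        (l = false → r = false → c.agg = c.piUp) ∧ Kids μ h l r c) l r x.children

/-- `Kids`, and `x` itself stores its up-aggregate if it is on neither spine. -/
def Good (μ h : ℕ) (l r : Bool) (x : Node T S) : Prop :=
  (l = false → r = false → x.agg = x.piUp) ∧ Kids μ h l r x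

/-- `Good`, and the arity of `x` is right for a node other than the root. -/
def Child (μ h : ℕ) (l r : Bool) (x : Node T S) : Prop :=
  (μ ≤ x.arity ∧ x.arity ≤ 2 * μ) ∧ Good μ h l r x

/-- The arity of the node `x` at `p` is at most `M`, and it is at least `m` unless `x` is the root,
for which the special rule applies. -/
def Sized (m M : ℕ) (p : Addr) (x : Node T S) : Prop :=
  (p ≠ [] → m ≤ x.arity) ∧ x.arity ≤ M ∧
    (p = [] → 2 ≤ x.arity ∨ x.entries = [] ∧ x.children = [])

/-- The children of `y` other than the `i`-th one satisfy the invariants. -/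
def Hole (μ h : ℕ) (l r : Bool) (y : Node T S) (i : ℕ) : Prop :=
  y.children.length = y.arity ∧ ∃ a c b, y.children = a ++ c :: b ∧ a.length = i ∧
    ForallPos (Child μ h) l false a ∧ ForallPos (Child μ h) false r b

/-- All invariants of the tree that concern neither the subtree of height `h` at `p` nor the
aggregates stored at the proper ancestors of `p` nor those stored on the spines. -/
def CtxOK (μ : ℕ) (B : Node T S) : Addr → ℕ → Prop
  | [], _ => True
  | i :: q, h => CtxOK μ B q (h + 1) ∧ Sized μ (2 * μ) q (nodeAt B q) ∧
      Hole μ h (leftSpine q) (rightSpine B q) (nodeAt B q) i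

variable {μ h : ℕ} {l r : Bool}

theorem kids_zero {x : Node T S} : Kids μ 0 l r x ↔ x.children = [] := Iff.rfl

theorem kids_succ {x : Node T S} : Kids μ (h + 1) l r x ↔
    x.children.length = x.arity ∧ ForallPos (Child μ h) l r x.children := Iff.rfl

theorem Kids.congr {x y : Node T S} (hx : Kids μ h l r x)
    (hc : y.children = x.children) (he : y.entries.length = x.entries.length) :
    Kids μ h l r y := by
  cases h with
  | zero => rw [kids_zero] at *; rw [hc, hx]
  | succ h => rw [kids_succ] at *; simpa only [arity, hc, he] using hx

/-- Filling the hole. -/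
theorem Hole.kids {y : Node T S} {i : ℕ} (hy : Hole μ h l r y i)
    (hc : Child μ h (i == 0 && l) (i + 1 == y.arity && r) (y.children.getD i empty)) :
    Kids μ (h + 1) l r y := by
  obtain ⟨h1, a, c, b, e, rfl, ha, hb⟩ := hy
  obtain ⟨f1, f2⟩ := flags_eq (l := l) (r := r) h1 e
  rw [← f1, ← f2] at hc
  rw [kids_succ]
  refine ⟨h1, ?_⟩
  rw [e, forallPos_append]
  simp [e] at hc
  simpa [ha, hb] using hc

/-- Making a hole. -/
theorem Kids.hole {y : Node T S} {i : ℕ} (hy : Kids μ (h + 1) l r y)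
    (hi : i < y.children.length) :
    Hole μ h l r y i ∧
      Child μ h (i == 0 && l) (i + 1 == y.arity && r) (y.children.getD i empty) := by
  rw [kids_succ] at hy
  obtain ⟨a, c, b, e, rfl⟩ := exists_eq_append_cons hi
  obtain ⟨f1, f2⟩ := flags_eq (l := l) (r := r) hy.1 e
  rw [← f1, ← f2]
  have h2 := hy.2
  rw [e, forallPos_append] at h2
  simp only [List.isEmpty_cons, Bool.and_false, forallPos_cons] at h2
  refine ⟨⟨hy.1, a, c, b, e, rfl, h2.1, h2.2.2⟩, ?_⟩
  simpa [e] using h2.2.1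

theorem CtxOK.isAddr {B : Node T S} {p : Addr} (hp : CtxOK μ B p h) : IsAddr B p := by
  induction p generalizing h with
  | nil => trivial
  | cons i q ih =>
    obtain ⟨h1, -, h2, a, c, b, e, rfl, -⟩ := hp
    exact ⟨ih h1, by simp [e]⟩

theorem CtxOK.pathOK {B : Node T S} {p : Addr} (hp : CtxOK μ B p h) : PathOK B p := by
  induction p generalizing h with
  | nil => trivial
  | cons i q ih =>
    obtain ⟨h1, -, h2, a, c, b, e, rfl, -⟩ := hp
    rw [e, arity] at h2
    simp at h2
    exact ⟨ih h1, by simp [e], by omega⟩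

/-- Going up: a right child together with its surroundings makes the parent right, apart from the
aggregate that the parent stores. -/
theorem CtxOK.plug {B : Node T S} {i : ℕ} {q : Addr} (hp : CtxOK μ B (i :: q) h)
    (hc : Child μ h (leftSpine (i :: q)) (rightSpine B (i :: q)) (nodeAt B (i :: q))) :
    CtxOK μ B q (h + 1) ∧ Kids μ (h + 1) (leftSpine q) (rightSpine B q) (nodeAt B q) ∧
      Sized μ (2 * μ) q (nodeAt B q) := by
  obtain ⟨h1, h2, h3⟩ := hp
  rw [leftSpine_cons, rightSpine_cons] at hc
  exact ⟨h1, h3.kids hc, h2⟩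

/-- Going down to the child number `i`. -/
theorem CtxOK.descend {B : Node T S} {i : ℕ} {q : Addr} (hp : CtxOK μ B q (h + 1))
    (hk : Kids μ (h + 1) (leftSpine q) (rightSpine B q) (nodeAt B q))
    (hs : Sized μ (2 * μ) q (nodeAt B q)) (hi : i < (nodeAt B q).children.length) :
    CtxOK μ B (i :: q) h ∧
      Child μ h (leftSpine (i :: q)) (rightSpine B (i :: q)) (nodeAt B (i :: q)) := by
  rw [leftSpine_cons, rightSpine_cons]
  exact ⟨⟨hp, hs, (hk.hole hi).1⟩, (hk.hole hi).2⟩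

theorem Child.sized {x : Node T S} (hx : Child μ h l r x) {i : ℕ} {q : Addr} :
    Sized μ (2 * μ) (i :: q) x := ⟨fun _ => hx.1.1, hx.1.2, by simp⟩

/-- The surroundings of `p` do not depend on the subtree at `p`. -/
theorem CtxOK.modifyAt_append {B : Node T S} {b p : Addr} (hp : CtxOK μ B p h)
    (f : Node T S → Node T S) : CtxOK μ (modifyAt B (b ++ p) f) p h := by
  induction p generalizing b h with
  | nil => trivial
  | cons i q ih =>
    have ha := hp.1.isAddr
    obtain ⟨h1, h2, h3, a, c, d, e, rfl, hC, hD⟩ := hp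
    have e1 : b ++ a.length :: q = (b ++ [a.length]) ++ q := by simp
    refine ⟨?_, ?_, ?_⟩
    · rw [e1]; exact ih h1
    · rw [e1, nodeAt_modifyAt_append ha, modifyAt_concat]
      refine ⟨h2.1, h2.2.1, fun hq => (h2.2.2 hq).imp id fun h => ?_⟩
      rw [e] at h
      simp at h
    · rw [e1, nodeAt_modifyAt_append ha, rightSpine_modifyAt_append ha, modifyAt_concat]
      exact ⟨by simpa [arity] using h3, a, c.modifyAt b f, d,
        by simp only [e, modify_append_cons], rfl, hC, hD⟩

theorem CtxOK.modifyAt {B : Node T S} {p : Addr} (hp : CtxOK μ B p h)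
    (f : Node T S → Node T S) : CtxOK μ (modifyAt B p f) p h :=
  hp.modifyAt_append (b := []) f

/-- From an ancestor `q` the invariants are inherited by the descendant at `b ++ q`. -/
theorem CtxOK.descend_append {B : Node T S} {b q : Addr} {k : ℕ} (hp : CtxOK μ B q k)
    (hk : Kids μ k (leftSpine q) (rightSpine B q) (nodeAt B q)) (hs : Sized μ (2 * μ) q (nodeAt B q))
    (hb : IsAddr B (b ++ q)) (hb' : b ≠ []) : ∃ h, h + b.length = k ∧ CtxOK μ B (b ++ q) h ∧
      Child μ h (leftSpine (b ++ q)) (rightSpine B (b ++ q)) (nodeAt B (b ++ q)) := by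
  induction b with
  | nil => exact absurd rfl hb'
  | cons i b ih =>
    obtain ⟨h1, h2⟩ : IsAddr B (b ++ q) ∧ i < (nodeAt B (b ++ q)).children.length := hb
    obtain ⟨h, hh, hc, hn, hz⟩ : ∃ h, h + b.length = k ∧ CtxOK μ B (b ++ q) h ∧
      Kids μ h (leftSpine (b ++ q)) (rightSpine B (b ++ q)) (nodeAt B (b ++ q)) ∧
      Sized μ (2 * μ) (b ++ q) (nodeAt B (b ++ q)) := by
      by_cases hb : b = []
      · subst hb; exact ⟨k, rfl, hp, hk, hs⟩
      · obtain ⟨h, hh, hc, hn⟩ := ih h1 hb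
        obtain ⟨j, b', rfl⟩ := List.exists_cons_of_ne_nil hb
        exact ⟨h, hh, hc, hn.2.2, hn.sized⟩
    cases h with
    | zero => rw [kids_zero] at hn; rw [hn] at h2; simp at h2
    | succ h =>
      refine ⟨h, ?_, hc.descend hn hz h2⟩
      simp only [List.length_cons]; omega

/-- Replace the stored aggregate by the up-aggregate computed from the children, unless a flag tells
that the node is on a spine. -/
def fixUp (l r : Bool) (x : Node T S) : Node T S :=
  if l || r then x else { x with agg := (alternate (x.children.map agg) x.values).prod }

@[simp] theorem fixUp_entries (x : Node T S) : (fixUp l r x).entries = x.entries := by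
  unfold fixUp; split <;> rfl

@[simp] theorem fixUp_children (x : Node T S) : (fixUp l r x).children = x.children := by
  unfold fixUp; split <;> rfl

@[simp] theorem fixUp_arity (x : Node T S) : (fixUp l r x).arity = x.arity := by simp [arity]

@[simp] theorem fixUp_window (x : Node T S) : (fixUp l r x).window = x.window := by
  simp [window_eq_weave]

theorem Child.agg_eq (c : Node T S) (hc : Child μ h false false c) : c.agg = c.piUp :=
  hc.2.1 rfl rfl

/-- With right children, recomputing the up-aggregate locally gives the true one: the children of a
node on neither spine are on neither spine, too, and store their up-aggregates. -/
theorem Kids.good_fixUp {x : Node T S} (hx : Kids μ h l r x) : Good μ h l r (fixUp l r x) := by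
  refine ⟨?_, hx.congr (by simp) (by simp)⟩
  rintro rfl rfl
  rw [piUp_eq]
  have : x.children.map agg = x.children.map piUp := by
    cases h with
    | zero => rw [kids_zero] at hx; rw [hx]; rfl
    | succ h => exact (kids_succ.1 hx).2.map_eq Child.agg_eq
  simp [fixUp, this, values]

theorem localRepairAggIfUp_eq (B : Node T S) (p : Addr) :
    B.localRepairAggIfUp p = modifyAt B p (fixUp (leftSpine p) (rightSpine B p)) := by
  unfold localRepairAggIfUp hasAggUp
  split
  · rename_i hp
    rw [Bool.and_eq_true, Bool.not_eq_true', Bool.not_eq_true'] at hp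
    unfold localRepairAgg
    apply modifyAt_congr
    cases p with
    | nil => simp at hp
    | cons i q => simp [fixUp, localAgg, hp.1, hp.2]
  · rename_i hp
    rw [Bool.and_eq_true, Bool.not_eq_true', Bool.not_eq_true', not_and_or] at hp
    have : (leftSpine p || rightSpine B p) = true := by
      simpa using hp
    conv_lhs => rw [← modifyAt_id B p]
    exact modifyAt_congr (by simp [fixUp, this])

/-- Up-repair of a node that has just been replaced. -/
theorem localRepairAggIfUp_self {B : Node T S} {q : Addr} (hq : IsAddr B q) (y : Node T S) :
    (modifyAt B q fun _ => y).localRepairAggIfUp q =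
      modifyAt B q fun _ => fixUp (leftSpine q) (rightSpine B q) y := by
  rw [localRepairAggIfUp_eq, modifyAt_modifyAt, rightSpine_modifyAt hq]

/-- Up-repair of the child after the siblings `a` of a node that has just been replaced. -/
theorem localRepairAggIfUp_child {B : Node T S} {q : Addr} (hq : IsAddr B q) {y : Node T S}
    {a b : List (Node T S)} {c : Node T S} (hc : y.children = a ++ c :: b)
    (hy : y.children.length = y.arity) :
    (modifyAt B q fun _ => y).localRepairAggIfUp (a.length :: q) =
      modifyAt B q fun _ => ⟨y.agg, y.entries,
        a ++ fixUp (leftSpine q && a.isEmpty) (rightSpine B q && b.isEmpty) c :: b⟩ := by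
  rw [localRepairAggIfUp_eq, modifyAt, modifyAt_modifyAt, leftSpine_cons, rightSpine_cons,
    rightSpine_modifyAt hq, nodeAt_modifyAt hq]
  obtain ⟨f1, f2⟩ := flags_eq (l := leftSpine q) (r := rightSpine B q) hy hc
  rw [f1, f2, hc, modify_append_cons]

/-- An up-repair establishes the invariants of a node whose children satisfy them. -/
theorem good_localRepairAggIfUp {B : Node T S} {p : Addr}
    (hk : Kids μ h (leftSpine p) (rightSpine B p) (nodeAt B p)) :
    ∃ y, B.localRepairAggIfUp p = modifyAt B p (fun _ => y) ∧
      Good μ h (leftSpine p) (rightSpine B p) y ∧ y.arity = (nodeAt B p).arity ∧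
      y.window = (nodeAt B p).window ∧ y.entries = (nodeAt B p).entries ∧
      y.children = (nodeAt B p).children := by
  refine ⟨fixUp (leftSpine p) (rightSpine B p) (nodeAt B p), ?_, hk.good_fixUp, by simp, by simp,
    by simp, by simp⟩
  rw [localRepairAggIfUp_eq]
  exact modifyAt_congr rfl

/-- The state of a loop of the update operations that has reached the node at `p`: all invariants
hold, except that only those parts of the tree that are not above `p` have been up-repaired, that the
aggregates stored on the spines are arbitrary, and that the arity of the node at `p` is only known to
be between `m` and `M`. -/
def StateOK (μ m M : ℕ) (B : Node T S) (p : Addr) (h : ℕ) : Prop :=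
  CtxOK μ B p h ∧ Good μ h (leftSpine p) (rightSpine B p) (nodeAt B p) ∧ Sized m M p (nodeAt B p)

theorem StateOK.replace {m M : ℕ} {B : Node T S} {p : Addr} (hp : CtxOK μ B p h) {y : Node T S}
    (hy : Good μ h (leftSpine p) (rightSpine B p) y) (hs : Sized m M p y) :
    StateOK μ m M (modifyAt B p fun _ => y) p h := by
  refine ⟨hp.modifyAt _, ?_⟩
  rw [nodeAt_modifyAt hp.isAddr, rightSpine_modifyAt hp.isAddr]
  exact ⟨hy, hs⟩

theorem StateOK.localRepairAggIfUp {m M : ℕ} {B : Node T S} {p : Addr}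
    (hp : StateOK μ m M B p h) : StateOK μ m M (B.localRepairAggIfUp p) p h := by
  obtain ⟨y, hy, hg, ha, -, he, hc⟩ := good_localRepairAggIfUp hp.2.1.2
  rw [hy]
  refine StateOK.replace hp.1 hg ?_
  rw [Sized, ha, he, hc]
  exact hp.2.2

theorem window_localRepairAggIfUp {B : Node T S} {p : Addr} (hp : PathOK B p) :
    (B.localRepairAggIfUp p).window = B.window := by
  rw [localRepairAggIfUp_eq]
  exact window_modifyAt_eq hp (by simp)

theorem within_localRepairAggIfUp (B : Node T S) (p : Addr) :
    Within B (B.localRepairAggIfUp p) p := by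
  rw [localRepairAggIfUp_eq]
  exact within_modifyAt _ _ _

end Invariants

/-! ### Splitting, merging and moving -/

section Structural

variable {T S : Type*} [Monoid S] {μ h : ℕ}

/-- Replacing a node and up-repairing its new child `m` and then the node itself. -/
theorem repair_one {B : Node T S} {q : Addr} (hq : IsAddr B q) {s : S} {es : List (T × S)}
    {a b : List (Node T S)} {m : Node T S} (hy : a.length + b.length = es.length)
    (ha : ForallPos (Child μ h) (leftSpine q) false a)
    (hb : ForallPos (Child μ h) false (rightSpine B q) b)
    (hm : μ ≤ m.arity ∧ m.arity ≤ 2 * μ)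
    (hk : Kids μ h (leftSpine q && a.isEmpty) (rightSpine B q && b.isEmpty) m) :
    ∃ y, ((modifyAt B q fun _ => ⟨s, es, a ++ m :: b⟩).localRepairAggIfUp
        (a.length :: q)).localRepairAggIfUp q = (modifyAt B q fun _ => y) ∧
      Good μ (h + 1) (leftSpine q) (rightSpine B q) y ∧ y.entries = es ∧
      y.window = window ⟨s, es, a ++ m :: b⟩ := by
  rw [localRepairAggIfUp_child hq rfl (by simp [arity]; omega), localRepairAggIfUp_self hq]
  refine ⟨_, rfl, Kids.good_fixUp ?_, by simp, ?_⟩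
  · refine kids_succ.2 ⟨by simp [arity]; omega, ?_⟩
    rw [forallPos_append]
    exact ⟨by simpa using ha, ⟨⟨by simpa using hm, hk.good_fixUp⟩, hb⟩⟩
  · rw [fixUp_window]
    exact window_replace (by simp) _

/-- Replacing a node and up-repairing two adjacent new children and then the node itself. -/
theorem repair_two {B : Node T S} {q : Addr} (hq : IsAddr B q) {s : S} {es : List (T × S)}
    {a b : List (Node T S)} {m n : Node T S} (hy : a.length + b.length + 1 = es.length)
    (ha : ForallPos (Child μ h) (leftSpine q) false a)
    (hb : ForallPos (Child μ h) false (rightSpine B q) b)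
    (hm : μ ≤ m.arity ∧ m.arity ≤ 2 * μ) (hn : μ ≤ n.arity ∧ n.arity ≤ 2 * μ)
    (hkm : Kids μ h (leftSpine q && a.isEmpty) false m)
    (hkn : Kids μ h false (rightSpine B q && b.isEmpty) n) :
    ∃ y, (((modifyAt B q fun _ => ⟨s, es, a ++ m :: n :: b⟩).localRepairAggIfUp
        (a.length :: q)).localRepairAggIfUp ((a.length + 1) :: q)).localRepairAggIfUp q =
          (modifyAt B q fun _ => y) ∧
      (((modifyAt B q fun _ => ⟨s, es, a ++ m :: n :: b⟩).localRepairAggIfUp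
        ((a.length + 1) :: q)).localRepairAggIfUp (a.length :: q)).localRepairAggIfUp q =
          (modifyAt B q fun _ => y) ∧
      Good μ (h + 1) (leftSpine q) (rightSpine B q) y ∧ y.entries = es ∧
      y.window = window ⟨s, es, a ++ m :: n :: b⟩ := by
  have hl : ∀ x : Node T S, (a ++ [x]).length = a.length + 1 := by simp
  have e1 : ∀ x y : Node T S, a ++ x :: y :: b = (a ++ [x]) ++ y :: b := by simp
  have hlen : ∀ x y : Node T S, (a ++ x :: y :: b).length = es.length + 1 := by simp; omega
  have hR : ∀ (u : S) (x y : Node T S),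
      (modifyAt B q fun _ => ⟨u, es, a ++ x :: y :: b⟩).localRepairAggIfUp ((a.length + 1) :: q) =
        modifyAt B q fun _ => ⟨u, es, a ++ x :: fixUp false (rightSpine B q && b.isEmpty) y :: b⟩ := by
    intro u x y
    rw [← hl x, localRepairAggIfUp_child hq (e1 x y) (hlen x y), isEmpty_eq_false (by simp)]
    simp
  have hL : ∀ (u : S) (x y : Node T S),
      (modifyAt B q fun _ => ⟨u, es, a ++ x :: y :: b⟩).localRepairAggIfUp (a.length :: q) =
        modifyAt B q fun _ => ⟨u, es, a ++ fixUp (leftSpine q && a.isEmpty) false x :: y :: b⟩ := by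
    intro u x y
    rw [localRepairAggIfUp_child hq rfl (hlen x y)]
    simp
  rw [hL, hR, hR, hL, localRepairAggIfUp_self hq]
  refine ⟨_, rfl, rfl, Kids.good_fixUp ?_, by simp, ?_⟩
  · refine kids_succ.2 ⟨hlen _ _, ?_⟩
    rw [forallPos_append]
    refine ⟨by simpa using ha, ⟨⟨by simpa using hm, ?_⟩, ⟨by simpa using hn, hkn.good_fixUp⟩, hb⟩⟩
    simpa using hkm.good_fixUp
  · rw [fixUp_window]
    exact window_replace (by simp) _

/-- Splitting the overfull child `i` of `q` replaces `q` by a node with one more entry and the same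
window. -/
theorem split_spec (hμ : 2 ≤ μ) {B : Node T S} {q : Addr} {i : ℕ} (hq : IsAddr B q)
    (hy : Hole μ h (leftSpine q) (rightSpine B q) (nodeAt B q) i)
    (hx : Kids μ h (leftSpine (i :: q)) (rightSpine B (i :: q)) (nodeAt B (i :: q)))
    (hx' : (nodeAt B (i :: q)).arity = 2 * μ + 1) :
    ∃ y, split μ B q i = (modifyAt B q fun _ => y) ∧
      Good μ (h + 1) (leftSpine q) (rightSpine B q) y ∧ y.arity = (nodeAt B q).arity + 1 ∧
      y.window = (nodeAt B q).window := by
  obtain ⟨hlen, a, c, b, e, rfl, ha, hb⟩ := hy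
  obtain ⟨f1, f2⟩ := flags_eq (l := leftSpine q) (r := rightSpine B q) hlen e
  rw [leftSpine_cons, rightSpine_cons, ← f1, ← f2, nodeAt_cons e] at hx
  rw [nodeAt_cons e] at hx'
  have hlen' : a.length + b.length = (nodeAt B q).entries.length := by
    rw [e] at hlen; simp [arity] at hlen; omega
  obtain ⟨E, F, hEF, hE⟩ := exists_eq_append (cs := (nodeAt B q).entries) (i := a.length) (by omega)
  obtain ⟨G, f, H, hG, hGl⟩ :=
    exists_eq_append_cons (cs := c.entries) (i := μ) (by rw [arity] at hx'; omega)
  have hH : H.length + 1 = μ := by rw [arity, hG] at hx'; simp at hx'; omega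
  -- the two halves of the children of the node that is split
  obtain ⟨D, D', hD, hk1, hk2, hj⟩ : ∃ D D', (c.children = D ++ D' ∧
      D = c.children.take (μ + 1) ∧ D' = c.children.drop (μ + 1)) ∧
      Kids μ h (leftSpine q && a.isEmpty) false ⟨c.agg, G, D⟩ ∧
      Kids μ h false (rightSpine B q && b.isEmpty) ⟨1, H, D'⟩ ∧
      (D.length = G.length + 1 ∨ D = [] ∧ D' = []) := by
    refine ⟨c.children.take (μ + 1), c.children.drop (μ + 1), ⟨by simp, rfl, rfl⟩, ?_⟩
    cases h with
    | zero =>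
      rw [kids_zero] at hx
      simp [kids_zero, hx]
    | succ h =>
      rw [kids_succ, hx'] at hx
      obtain ⟨h1, h2⟩ := hx
      obtain ⟨D, D', hD, hDl⟩ := exists_eq_append (cs := c.children) (i := μ + 1) (by omega)
      rw [← hDl, hD]
      simp only [List.take_left', List.drop_left']
      rw [hD] at h1 h2
      rw [forallPos_append] at h2
      rw [List.length_append] at h1
      have n1 : D.isEmpty = false := isEmpty_eq_false (by omega)
      have n2 : D'.isEmpty = false := isEmpty_eq_false (by omega)
      simp only [n1, n2, Bool.and_false] at h2
      refine ⟨kids_succ.2 ⟨by simp [arity]; omega, h2.1⟩, kids_succ.2 ⟨by simp [arity]; omega, h2.2⟩,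
        Or.inl (by omega)⟩
  obtain ⟨y, hy1, -, hy2, hy3, hy4⟩ := repair_two hq (s := (nodeAt B q).agg)
    (es := E ++ f :: F) (a := a) (b := b) (m := ⟨c.agg, G, D⟩) (n := ⟨1, H, D'⟩)
    (by rw [hEF] at hlen'; simp at hlen' ⊢; omega) ha hb (by simp [arity]; omega)
    (by simp [arity]; omega) hk1 hk2
  refine ⟨y, ?_, hy2, ?_, ?_⟩
  · rw [← hy1]
    simp only [split]
    congr 3
    apply modifyAt_congr
    have t1 : (E ++ F).take a.length = E := by rw [← hE]; simp
    have t2 : (E ++ F).drop a.length = F := by rw [← hE]; simp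
    have t3 : (G ++ f :: H).take μ = G := by rw [← hGl]; simp
    have t4 : (G ++ f :: H).drop (μ + 1) = H := by rw [← hGl]; simp
    have t5 : (G ++ f :: H)[μ]? = some f := by rw [← hGl]; simp
    rw [nodeAt_cons e, e, hEF, hG, t1, t2, t3, t4, t5, ← hD.2.1, ← hD.2.2]
    simp
  · rw [arity, arity, hy3, hEF]
    simp; omega
  · rw [hy4, window_eq_weave, window_eq_weave (nodeAt B q), e, hEF]
    simp only
    rw [weave_append hE.symm, weave_append hE.symm]
    simp only [weave_cons, weave'_cons]
    rw [window_eq_weave c, hG, hD.1, weave_join f hj]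
    simp [window_eq_weave]

/-- An underfull node and a sibling of minimum arity, in either order, are merged. -/
theorem merge_spec {B : Node T S} {q : Addr} {i j : ℕ} (hq : IsAddr B q)
    {a b : List (Node T S)} {c d : Node T S} (hij : min i j = a.length)
    (hlen : (nodeAt B q).children.length = (nodeAt B q).arity)
    (e : (nodeAt B q).children = a ++ c :: d :: b)
    (ha : ForallPos (Child μ h) (leftSpine q) false a)
    (hb : ForallPos (Child μ h) false (rightSpine B q) b)
    (hc : Kids μ h (leftSpine q && a.isEmpty) false c)
    (hd : Kids μ h false (rightSpine B q && b.isEmpty) d)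
    (hs : μ ≤ c.arity + d.arity ∧ c.arity + d.arity ≤ 2 * μ) :
    ∃ y, merge B q i j = (modifyAt B q fun _ => y) ∧
      Good μ (h + 1) (leftSpine q) (rightSpine B q) y ∧ y.arity + 1 = (nodeAt B q).arity ∧
      y.window = (nodeAt B q).window := by
  have e1 : a ++ c :: d :: b = (a ++ [c]) ++ d :: b := by simp
  have nc : nodeAt B (a.length :: q) = c := nodeAt_cons e
  have nd : nodeAt B ((a.length + 1) :: q) = d := by
    simpa using nodeAt_cons (e.trans e1)
  have hlen' : a.length + b.length + 1 = (nodeAt B q).entries.length := by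
    rw [e] at hlen; simp [arity] at hlen; omega
  obtain ⟨E, f, F, hEF, hE⟩ :=
    exists_eq_append_cons (cs := (nodeAt B q).entries) (i := a.length) (by omega)
  have hk : Kids μ h (leftSpine q && a.isEmpty) (rightSpine B q && b.isEmpty)
      ⟨c.agg, c.entries ++ f :: d.entries, c.children ++ d.children⟩ := by
    cases h with
    | zero => rw [kids_zero] at *; simp [hc, hd]
    | succ h =>
      rw [kids_succ] at *
      refine ⟨by simp [arity] at *; omega, ?_⟩
      have n1 : c.children.isEmpty = false := isEmpty_eq_false (by rw [hc.1]; simp [arity])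
      have n2 : d.children.isEmpty = false := isEmpty_eq_false (by rw [hd.1]; simp [arity])
      simp only [forallPos_append, n1, n2, Bool.and_false]
      exact ⟨hc.2, hd.2⟩
  have hj : c.children.length = c.entries.length + 1 ∨ c.children = [] ∧ d.children = [] := by
    cases h with
    | zero => exact Or.inr ⟨hc, hd⟩
    | succ h => exact Or.inl hc.1
  obtain ⟨y, hy1, hy2, hy3, hy4⟩ := repair_one hq (s := (nodeAt B q).agg)
    (es := E ++ F) (a := a) (b := b)
    (by rw [hEF] at hlen'; simp at hlen' ⊢; omega) ha hb (by simp [arity] at *; omega) hk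
  refine ⟨y, ?_, hy2, ?_, ?_⟩
  · rw [← hy1]
    simp only [merge, hij]
    congr 2
    apply modifyAt_congr
    rw [nc, nd, e, hEF, ← hE]
    simp [List.eraseIdx_append_of_length_le]
    simp [hE]
  · rw [arity, arity, hy3, hEF]
    simp; omega
  · rw [hy4, window_eq_weave, window_eq_weave (nodeAt B q), e, hEF]
    simp only
    rw [weave_append hE.symm, weave_append hE.symm]
    simp only [weave_cons, weave'_cons]
    rw [window_eq_weave]
    simp only
    rw [weave_join f hj]
    simp [window_eq_weave]

end Structural

section Move

variable {T S : Type*} [Monoid S] {μ h : ℕ}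

/-- The underfull node `c` takes an entry and a child from its right sibling `d`. -/
theorem move_from_right_spec {B : Node T S} {q : Addr} (hq : IsAddr B q)
    {a b : List (Node T S)} {c d : Node T S}
    (hlen : (nodeAt B q).children.length = (nodeAt B q).arity)
    (e : (nodeAt B q).children = a ++ c :: d :: b)
    (ha : ForallPos (Child μ h) (leftSpine q) false a)
    (hb : ForallPos (Child μ h) false (rightSpine B q) b)
    (hc : Kids μ h (leftSpine q && a.isEmpty) false c)
    (hd : Kids μ h false (rightSpine B q && b.isEmpty) d)
    (hcs : μ ≤ c.arity + 1 ∧ c.arity < 2 * μ) (hds : μ < d.arity ∧ d.arity ≤ 2 * μ) :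
    ∃ y, move B q a.length (a.length + 1) = (modifyAt B q fun _ => y) ∧
      Good μ (h + 1) (leftSpine q) (rightSpine B q) y ∧ y.arity = (nodeAt B q).arity ∧
      y.window = (nodeAt B q).window := by
  have e1 : a ++ c :: d :: b = (a ++ [c]) ++ d :: b := by simp
  have nc : nodeAt B (a.length :: q) = c := nodeAt_cons e
  have nd : nodeAt B ((a.length + 1) :: q) = d := by
    simpa using nodeAt_cons (e.trans e1)
  have hlen' : a.length + b.length + 1 = (nodeAt B q).entries.length := by
    rw [e] at hlen; simp [arity] at hlen; omega
  obtain ⟨E, f, F, hEF, hE⟩ :=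
    exists_eq_append_cons (cs := (nodeAt B q).entries) (i := a.length) (by omega)
  obtain ⟨g, G, hG⟩ : ∃ g G, d.entries = g :: G :=
    List.exists_cons_of_length_pos (by rw [arity] at hds; omega)
  obtain ⟨Y, Z, ⟨hYZ, hY, hZ⟩, hk1, hk2, hj, hj'⟩ : ∃ Y Z, (d.children = Y ++ Z ∧
      d.children.take 1 = Y ∧ d.children.drop 1 = Z) ∧
      Kids μ h (leftSpine q && a.isEmpty) false ⟨c.agg, c.entries ++ [f], c.children ++ Y⟩ ∧
      Kids μ h false (rightSpine B q && b.isEmpty) ⟨d.agg, G, Z⟩ ∧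
      (c.children.length = c.entries.length + 1 ∨ c.children = [] ∧ Y = []) ∧
      (Y.length = ([] : List (T × S)).length + 1 ∨ Y = [] ∧ Z = []) := by
    refine ⟨d.children.take 1, d.children.drop 1,
      ⟨(List.take_append_drop 1 _).symm, rfl, rfl⟩, ?_⟩
    cases h with
    | zero => rw [kids_zero] at *; simp [kids_zero, hc, hd]
    | succ h =>
      rw [kids_succ] at hc hd
      obtain ⟨z, Z, hZ⟩ : ∃ z Z, d.children = z :: Z :=
        List.exists_cons_of_length_pos (by rw [hd.1]; simp [arity])
      rw [hZ] at hd
      rw [hZ, kids_succ, kids_succ]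
      obtain ⟨h1, h2, h3⟩ := hd
      simp only [List.length_cons] at h1
      have n1 : Z.isEmpty = false := isEmpty_eq_false (by omega)
      have n2 : c.children.isEmpty = false := isEmpty_eq_false (by rw [hc.1]; simp [arity])
      rw [n1, Bool.and_false] at h2
      refine ⟨⟨by simp [hc.1, arity], ?_⟩, ⟨by simp [arity, hG] at *; omega, h3⟩,
        Or.inl hc.1, Or.inl rfl⟩
      rw [forallPos_append]
      simpa [n2] using ⟨hc.2, h2⟩
  obtain ⟨y, hy1, -, hy2, hy3, hy4⟩ := repair_two hq (s := (nodeAt B q).agg)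
    (es := E ++ g :: F) (a := a) (b := b) (m := ⟨c.agg, c.entries ++ [f], c.children ++ Y⟩)
    (n := ⟨d.agg, G, Z⟩) (by rw [hEF] at hlen'; simp at hlen' ⊢; omega) ha hb
    (by simp [arity] at *; omega) (by simp [arity, hG] at *; omega) hk1 hk2
  refine ⟨y, ?_, hy2, ?_, ?_⟩
  · rw [← hy1]
    simp only [move, lt_add_iff_pos_right, zero_lt_one, if_true]
    congr 3
    apply modifyAt_congr
    have t1 : (E ++ f :: F).take a.length = E := by rw [← hE]; simp
    have t2 : (E ++ f :: F).drop (a.length + 1) = F := by rw [← hE]; simp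
    have t3 : (E ++ f :: F)[a.length]? = some f := by rw [← hE]; simp
    rw [nc, nd, e, hEF, t1, t2, t3, hG, hY, hZ]
    simp
  · rw [arity, arity, hy3, hEF]
    simp
  · rw [hy4, window_eq_weave, window_eq_weave (nodeAt B q), e, hEF]
    simp only
    rw [weave_append hE.symm, weave_append hE.symm]
    simp only [weave_cons, weave'_cons]
    rw [window_eq_weave ⟨c.agg, _, _⟩, window_eq_weave d, hYZ, hG]
    simp only
    rw [weave_join f hj]
    have := weave_join g (F₂ := G) hj'
    simp only [List.nil_append] at this
    simp [this, window_eq_weave]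

/-- The underfull node `d` takes an entry and a child from its left sibling `c`. -/
theorem move_from_left_spec (hμ : 2 ≤ μ) {B : Node T S} {q : Addr} (hq : IsAddr B q)
    {a b : List (Node T S)} {c d : Node T S}
    (hlen : (nodeAt B q).children.length = (nodeAt B q).arity)
    (e : (nodeAt B q).children = a ++ c :: d :: b)
    (ha : ForallPos (Child μ h) (leftSpine q) false a)
    (hb : ForallPos (Child μ h) false (rightSpine B q) b)
    (hc : Kids μ h (leftSpine q && a.isEmpty) false c)
    (hd : Kids μ h false (rightSpine B q && b.isEmpty) d)
    (hcs : μ < c.arity ∧ c.arity ≤ 2 * μ) (hds : μ ≤ d.arity + 1 ∧ d.arity < 2 * μ) :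
    ∃ y, move B q (a.length + 1) a.length = (modifyAt B q fun _ => y) ∧
      Good μ (h + 1) (leftSpine q) (rightSpine B q) y ∧ y.arity = (nodeAt B q).arity ∧
      y.window = (nodeAt B q).window := by
  have e1 : a ++ c :: d :: b = (a ++ [c]) ++ d :: b := by simp
  have nc : nodeAt B (a.length :: q) = c := nodeAt_cons e
  have nd : nodeAt B ((a.length + 1) :: q) = d := by
    simpa using nodeAt_cons (e.trans e1)
  have hlen' : a.length + b.length + 1 = (nodeAt B q).entries.length := by
    rw [e] at hlen; simp [arity] at hlen; omega
  obtain ⟨E, f, F, hEF, hE⟩ :=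
    exists_eq_append_cons (cs := (nodeAt B q).entries) (i := a.length) (by omega)
  obtain ⟨G, g, hG⟩ : ∃ G g, c.entries = G ++ [g] := by
    rcases List.eq_nil_or_concat c.entries with h | ⟨G, g, h⟩
    · rw [arity, h] at hcs; simp at hcs; omega
    · exact ⟨G, g, by rw [h, List.concat_eq_append]⟩
  obtain ⟨Y, Z, ⟨hYZ, hY, hZ⟩, hk1, hk2, hj, hj'⟩ : ∃ Y Z, (c.children = Y ++ Z ∧
      c.children.dropLast = Y ∧ c.children.getLast?.toList = Z) ∧
      Kids μ h (leftSpine q && a.isEmpty) false ⟨c.agg, G, Y⟩ ∧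
      Kids μ h false (rightSpine B q && b.isEmpty) ⟨d.agg, f :: d.entries, Z ++ d.children⟩ ∧
      (Z.length = ([] : List (T × S)).length + 1 ∨ Z = [] ∧ d.children = []) ∧
      (Y.length = G.length + 1 ∨ Y = [] ∧ Z = []) := by
    cases h with
    | zero => rw [kids_zero] at *; exact ⟨[], [], by simp [kids_zero, hc, hd]⟩
    | succ h =>
      rw [kids_succ] at hc hd
      obtain ⟨Y, z, hZ⟩ : ∃ Y z, c.children = Y ++ [z] := by
        rcases List.eq_nil_or_concat c.children with h | ⟨G, g, h⟩
        · rw [h, arity] at hc; simp at hc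
        · exact ⟨G, g, by rw [h, List.concat_eq_append]⟩
      refine ⟨Y, [z], ⟨hZ, by simp [hZ], by simp [hZ]⟩, ?_⟩
      rw [hZ, forallPos_append] at hc
      rw [kids_succ, kids_succ]
      obtain ⟨h1, h2, h3⟩ := hc
      simp only [List.length_append, List.length_cons, List.length_nil] at h1
      have n1 : Y.isEmpty = false := isEmpty_eq_false (by omega)
      have n2 : d.children.isEmpty = false := isEmpty_eq_false (by rw [hd.1]; simp [arity])
      rw [n1, Bool.and_false] at h3
      refine ⟨⟨by simp [arity, hG] at *; omega, by simpa using h2⟩,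
        ⟨by simp [hd.1, arity], ?_⟩, Or.inl rfl, Or.inl (by simp [arity, hG] at *; omega)⟩
      rw [forallPos_append]
      simpa [n2] using ⟨h3.1, hd.2⟩
  obtain ⟨y, -, hy1, hy2, hy3, hy4⟩ := repair_two hq (s := (nodeAt B q).agg)
    (es := E ++ g :: F) (a := a) (b := b) (m := ⟨c.agg, G, Y⟩)
    (n := ⟨d.agg, f :: d.entries, Z ++ d.children⟩)
    (by rw [hEF] at hlen'; simp at hlen' ⊢; omega) ha hb
    (by simp [arity, hG] at *; omega) (by simp [arity] at *; omega) hk1 hk2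
  refine ⟨y, ?_, hy2, ?_, ?_⟩
  · rw [← hy1]
    have hlt : ¬ a.length + 1 < a.length := by omega
    simp only [move, hlt, if_false]
    congr 3
    apply modifyAt_congr
    have t1 : (E ++ f :: F).take a.length = E := by rw [← hE]; simp
    have t2 : (E ++ f :: F).drop (a.length + 1) = F := by rw [← hE]; simp
    have t3 : (E ++ f :: F)[a.length]? = some f := by rw [← hE]; simp
    rw [nc, nd, e, hEF, t1, t2, t3, hG, hY, hZ]
    simp
  · rw [arity, arity, hy3, hEF]
    simp
  · rw [hy4, window_eq_weave, window_eq_weave (nodeAt B q), e, hEF]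
    simp only
    rw [weave_append hE.symm, weave_append hE.symm]
    simp only [weave_cons, weave'_cons]
    rw [window_eq_weave c, window_eq_weave ⟨d.agg, _, _⟩, hYZ, hG]
    simp only
    rw [weave_join g hj']
    have := weave_join f (F₂ := d.entries) hj
    simp only [List.nil_append] at this
    simp [this, window_eq_weave]

end Move

/-! ### Rebalancing -/

section Loops

variable {T S : Type*} [Monoid S] {μ h : ℕ}

/-- The loop may start with a node that is overfull by one, and it stops at a node whose arity is
right.  Nothing is said about the flags: the final repair consults them only at the root, which is on
both spines anyway. -/
theorem insertLoop_spec (hμ : 2 ≤ μ) {p : Addr} {B : Node T S} (L R : Bool)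
    (hB : StateOK μ μ (2 * μ + 1) B p h) :
    ∃ B' top L' R' h', insertLoop μ B p L R = (B', top, L', R') ∧ top <:+ p ∧
      Within B B' top ∧ StateOK μ μ (2 * μ) B' top h' ∧ B'.window = B.window := by
  induction p generalizing B L R h with
  | nil =>
    obtain ⟨h1, h2, h3⟩ := hB
    by_cases ha : 2 * μ < B.arity
    · -- the new root has arity 1, but a split requires nothing of the arity of the parent
      have hole : Hole μ h (leftSpine []) (rightSpine B.heightIncrease [])
          (nodeAt B.heightIncrease []) 0 :=
        ⟨rfl, [], B, [], rfl, rfl, trivial, trivial⟩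
      obtain ⟨y, hy, hg, har, hw⟩ := split_spec hμ (B := B.heightIncrease) (q := []) (i := 0)
        trivial hole h2.2 (le_antisymm h3.2.1 ha)
      have har' : y.arity = 2 := har
      refine ⟨split μ B.heightIncrease [] 0, [], true, true, h + 1, ?_, List.nil_suffix,
        within_nil _ _, ?_, ?_⟩
      · rw [insertLoop, if_pos ha]
      · rw [hy]
        exact StateOK.replace (p := []) (μ := μ) trivial hg
          ⟨by simp, by omega, fun _ => Or.inl (by omega)⟩
      · rw [hy]
        exact hw.trans (by simp [nodeAt, heightIncrease, window_eq_weave ⟨1, [], [B]⟩])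
    · refine ⟨B, [], L, R, h, ?_, List.suffix_rfl, Within.refl _ _, ⟨h1, h2, h3.1, ?_, h3.2.2⟩, rfl⟩
      · rw [insertLoop, if_neg ha]
      · exact not_lt.1 ha
  | cons i q ih =>
    obtain ⟨h1, h2, h3⟩ := hB
    by_cases ha : 2 * μ < (nodeAt B (i :: q)).arity
    · obtain ⟨y, hy, hg, har, hw⟩ := split_spec hμ h1.1.isAddr h1.2.2 h2.2
        (le_antisymm h3.2.1 ha)
      obtain ⟨c1, c2, c3⟩ := h1
      have hne : (nodeAt B q).children ≠ [] := by
        obtain ⟨-, a, c, b, e, -⟩ := c3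
        simp [e]
      have hst : StateOK μ μ (2 * μ + 1) (split μ B q i) q (h + 1) := by
        rw [hy]
        refine StateOK.replace c1 hg ⟨fun hq => ?_, ?_, fun hq => Or.inl ?_⟩
        · have := c2.1 hq; omega
        · have := c2.2.1; omega
        · have := c2.2.2 hq
          simp only [hne, and_false, or_false] at this
          omega
      obtain ⟨B', top, L', R', h', e, w0, w1, w2, w3⟩ := ih (L || leftSpine q)
        (R || rightSpine (split μ B q i) q) hst
      have hsuf : Within B (split μ B q i) q := by rw [hy]; exact within_modifyAt _ _ _
      have hwin : (split μ B q i).window = B.window := by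
        rw [hy]; exact window_modifyAt_eq c1.pathOK hw
      refine ⟨B', top, L', R', h', ?_, w0.trans (List.suffix_cons i q),
        (hsuf.mono w0).trans w1, w2, w3.trans hwin⟩
      rw [insertLoop, if_pos ha]; exact e
    · refine ⟨B, i :: q, L, R, h, ?_, List.suffix_rfl, Within.refl _ _,
        ⟨h1, h2, h3.1, not_lt.1 ha, by simp⟩, rfl⟩
      rw [insertLoop, if_neg ha]

theorem pickEvictionSibling_spec (pick : Node T S → Addr → Bool) (B : Node T S) (q : Addr) {i : ℕ}
    (h : i < (nodeAt B q).arity) (h' : 2 ≤ (nodeAt B q).arity) :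
    (pickEvictionSibling pick B q i = i + 1 ∧ i + 1 < (nodeAt B q).arity) ∨
      pickEvictionSibling pick B q i + 1 = i := by
  unfold pickEvictionSibling
  split_ifs <;> omega

/-- One rebalancing step: the underfull node at `i :: q` is merged with its sibling `j`, or takes an
entry from it. -/
theorem merge_or_move_spec (hμ : 2 ≤ μ) {B : Node T S} {i j : ℕ} {q : Addr}
    (hB : StateOK μ (μ - 1) (2 * μ) B (i :: q) h) (hi : (nodeAt B (i :: q)).arity < μ)
    (hj : (j = i + 1 ∧ j < (nodeAt B q).arity) ∨ j + 1 = i) :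
    ∃ y, (if (nodeAt B (j :: q)).arity ≤ μ then B.merge q i j else B.move q i j) =
        (modifyAt B q fun _ => y) ∧
      Good μ (h + 1) (leftSpine q) (rightSpine B q) y ∧ y.arity ≤ (nodeAt B q).arity ∧
      (nodeAt B q).arity ≤ y.arity + 1 ∧ y.window = (nodeAt B q).window ∧
      ((nodeAt B (j :: q)).arity ≤ μ ∨ y.arity = (nodeAt B q).arity) := by
  obtain ⟨⟨c1, c2, c3⟩, ⟨-, hk⟩, h3⟩ := hB
  obtain ⟨hlen, a, c, b, e, rfl, ha, hb⟩ := c3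
  obtain ⟨f1, f2⟩ := flags_eq (l := leftSpine q) (r := rightSpine B q) hlen e
  rw [leftSpine_cons, rightSpine_cons, ← f1, ← f2, nodeAt_cons e] at hk
  rw [nodeAt_cons e] at h3 hi
  have hca := h3.1 (by simp)
  rcases hj with ⟨rfl, hj⟩ | hj
  · obtain ⟨d, b, rfl⟩ : ∃ d b', b = d :: b' :=
      List.exists_cons_of_length_pos (by rw [← hlen, e] at hj; simp at hj; omega)
    have e1 : a ++ c :: d :: b = (a ++ [c]) ++ d :: b := by simp
    have nd : nodeAt B ((a.length + 1) :: q) = d := by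
      simpa using nodeAt_cons (e.trans e1)
    rw [nd]
    simp only [List.isEmpty_cons, Bool.and_false] at hk
    obtain ⟨⟨hd, hd'⟩, hb⟩ := hb
    by_cases hda : d.arity ≤ μ
    · rw [if_pos hda]
      obtain ⟨y, p1, p2, p3, p4⟩ := merge_spec (i := a.length) (j := a.length + 1) c1.isAddr
        (by omega) hlen e ha hb hk hd'.2 (by omega)
      exact ⟨y, p1, p2, by omega, by omega, p4, Or.inl hda⟩
    · rw [if_neg hda]
      obtain ⟨y, p1, p2, p3, p4⟩ := move_from_right_spec c1.isAddr hlen e ha hb hk hd'.2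
        (by omega) (by omega)
      exact ⟨y, p1, p2, by omega, by omega, p4, Or.inr p3⟩
  · obtain ⟨a, d, rfl⟩ : ∃ a' d, a = a' ++ [d] := by
      rcases List.eq_nil_or_concat a with rfl | ⟨G, g, h⟩
      · simp at hj
      · exact ⟨G, g, by rw [h, List.concat_eq_append]⟩
    have hj : j = a.length := by simpa using hj
    subst hj
    have e1 : (nodeAt B q).children = a ++ d :: c :: b := by simp [e]
    rw [nodeAt_cons e1]
    rw [forallPos_append] at ha
    obtain ⟨ha, ⟨hd, hd'⟩, -⟩ := ha
    simp only [Bool.false_and] at ha hd'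
    rw [isEmpty_eq_false (by simp), Bool.and_false] at hk
    simp only [List.length_append, List.length_cons, List.length_nil, Nat.zero_add]
    by_cases hda : d.arity ≤ μ
    · rw [if_pos hda]
      obtain ⟨y, p1, p2, p3, p4⟩ := merge_spec (i := a.length + 1) (j := a.length) c1.isAddr
        (by omega) hlen e1 ha hb hd'.2 hk (by omega)
      exact ⟨y, p1, p2, by omega, by omega, p4, Or.inl hda⟩
    · rw [if_neg hda]
      obtain ⟨y, p1, p2, p3, p4⟩ := move_from_left_spec hμ c1.isAddr hlen e1 ha hb hd'.2 hk
        (by omega) (by omega)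
      exact ⟨y, p1, p2, by omega, by omega, p4, Or.inr p3⟩

/-- One rebalancing step together with the deletion of a root that has only one child left. -/
theorem evictLoop_step (hμ : 2 ≤ μ) {B : Node T S} {i j : ℕ} {q : Addr}
    (hB : StateOK μ (μ - 1) (2 * μ) B (i :: q) h) (hi : (nodeAt B (i :: q)).arity < μ)
    (hj : (j = i + 1 ∧ j < (nodeAt B q).arity) ∨ j + 1 = i) :
    ∃ B₁ h', (if (nodeAt B (j :: q)).arity ≤ μ then
        (if q = [] ∧ (B.merge q i j).arity = 1 then (B.merge q i j).heightDecrease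
          else B.merge q i j)
        else B.move q i j) = B₁ ∧
      Within B B₁ q ∧ StateOK μ (μ - 1) (2 * μ) B₁ q h' ∧ B₁.window = B.window := by
  obtain ⟨y, hy, hg, a1, a2, hw, hm⟩ := merge_or_move_spec hμ hB hi hj
  obtain ⟨c1, c2, c3⟩ := hB.1
  have hne : (nodeAt B q).children ≠ [] := by
    obtain ⟨-, a, c, b, e, -⟩ := c3
    simp [e]
  have hroot : q = [] → 2 ≤ (nodeAt B q).arity := by
    intro hq
    have := c2.2.2 hq
    simpa only [hne, and_false, or_false] using this
  have hwin : (modifyAt B q fun _ => y).window = B.window := window_modifyAt_eq c1.pathOK hw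
  by_cases hdec : q = [] ∧ y.arity = 1
  · obtain ⟨rfl, hy1⟩ := hdec
    have h2 := hroot rfl
    -- a move keeps the arity of the root, so this was a merge
    have hm' := hm.resolve_right (by omega)
    rw [if_pos hm'] at hy ⊢
    -- the root has only the merged node left, which becomes the root
    have e : B.merge [] i j = y := hy
    rw [e, if_pos ⟨rfl, hy1⟩]
    obtain ⟨hlen, hk⟩ := kids_succ.1 hg.2
    rw [hy1] at hlen
    obtain ⟨m, hm⟩ := List.length_eq_one_iff.1 hlen
    rw [hm] at hk
    obtain ⟨⟨⟨k1, k2⟩, k3⟩, -⟩ := hk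
    have hdm : y.heightDecrease = m := by simp [heightDecrease, nodeAt, hm]
    refine ⟨_, h, rfl, within_nil _ _, ?_, ?_⟩
    · rw [hdm]
      refine StateOK.replace (B := B) (p := []) (μ := μ) trivial k3 ⟨by simp, k2, fun _ => ?_⟩
      exact Or.inl (hμ.trans k1)
    · rw [hdm, ← hwin]
      change m.window = y.window
      have hes : y.entries = [] := by simpa [arity] using hy1
      simp [window_eq_weave y, hm, hes]
  · refine ⟨modifyAt B q fun _ => y, h + 1, ?_, within_modifyAt _ _ _, ?_, hwin⟩
    · rw [← hy]
      split_ifs with h1 h2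
      · refine absurd ⟨h2.1, ?_⟩ hdec
        rw [if_pos h1] at hy
        obtain ⟨rfl, h2⟩ := h2
        rw [hy] at h2
        exact h2
      · rfl
      · rfl
    · refine StateOK.replace c1 hg ⟨fun hq => ?_, ?_, fun hq => Or.inl ?_⟩
      · have := c2.1 hq; omega
      · have := c2.2.1; omega
      · have := hroot hq
        have : y.arity ≠ 1 := fun h1 => hdec ⟨hq, h1⟩
        omega

/-- The loop may start with a node that is underfull by one, and it stops at a node whose arity is
right.  An additional up-repair on the way (`toRepair`) does no harm. -/
theorem evictLoop_spec (hμ : 2 ≤ μ) (pick : Node T S → Addr → Bool) (toRepair : Option Addr)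
    {p : Addr} {B : Node T S} (L R : Bool) (hB : StateOK μ (μ - 1) (2 * μ) B p h) :
    ∃ B' top L' R' h', evictLoop μ pick toRepair B p L R = (B', top, L', R') ∧ top <:+ p ∧
      Within B B' top ∧ StateOK μ μ (2 * μ) B' top h' ∧ B'.window = B.window := by
  induction p generalizing B L R h with
  | nil =>
    obtain ⟨h1, h2, h3⟩ := hB
    exact ⟨B, [], L, R, h, rfl, List.suffix_rfl, Within.refl _ _,
      ⟨h1, h2, by simp, h3.2.1, h3.2.2⟩, rfl⟩
  | cons i q ih =>
    by_cases ha : (nodeAt B (i :: q)).arity < μ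
    · have hb : i < (nodeAt B q).arity ∧ 2 ≤ (nodeAt B q).arity := by
        obtain ⟨c1, c2, c3⟩ := hB.1
        obtain ⟨hl, a, c, b, e, rfl, -⟩ := c3
        constructor
        · rw [← hl, e]; simp
        · by_cases hq : q = []
          · simpa [e] using c2.2.2 hq
          · exact hμ.trans (c2.1 hq)
      obtain ⟨B₁, h₁, e1, w1, s1, v1⟩ := evictLoop_step hμ hB ha
        ((pickEvictionSibling_spec pick B q hb.1 hb.2).imp (fun h => ⟨h.1, h.1 ▸ h.2⟩) id)
      obtain ⟨B₂, e2, w2, s2, v2⟩ : ∃ B₂,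
          (if toRepair = some q then B₁.localRepairAggIfUp q else B₁) = B₂ ∧
          Within B B₂ q ∧ StateOK μ (μ - 1) (2 * μ) B₂ q h₁ ∧ B₂.window = B.window := by
        split_ifs
        · exact ⟨_, rfl, w1.trans (within_localRepairAggIfUp _ _), s1.localRepairAggIfUp,
            (window_localRepairAggIfUp s1.1.pathOK).trans v1⟩
        · exact ⟨_, rfl, w1, s1, v1⟩
      obtain ⟨B', top, L', R', h', e, z0, z1, z2, z3⟩ := ih (L || leftSpine q)
        (R || rightSpine B (pickEvictionSibling pick B q i :: q) || rightSpine B₂ q) s2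
      refine ⟨B', top, L', R', h', ?_, z0.trans (List.suffix_cons i q), (w2.mono z0).trans z1, z2,
        z3.trans v2⟩
      rw [evictLoop, if_pos ha]
      simp only
      rw [e1, e2]
      exact e
    · obtain ⟨h1, h2, h3⟩ := hB
      refine ⟨B, i :: q, L, R, h, ?_, List.suffix_rfl, Within.refl _ _,
        ⟨h1, h2, fun _ => not_lt.1 ha, h3.2.1, by simp⟩, rfl⟩
      rw [evictLoop, if_neg ha]

/-- Walking up to `node` keeps the invariant; the arities are right from the start. -/
theorem evictInnerLoop_spec {node : Addr} {p : Addr} {B : Node T S} (L R : Bool)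
    (hp : node <:+ p) (hB : StateOK μ μ (2 * μ) B p h) :
    ∃ B' L' R' h', evictInnerLoop node B p L R = (B', node, L', R') ∧
      Within B B' node ∧ StateOK μ μ (2 * μ) B' node h' ∧ B'.window = B.window := by
  induction p generalizing B L R h with
  | nil =>
    obtain rfl := List.suffix_nil.1 hp
    exact ⟨B, L, R, h, rfl, Within.refl _ _, hB, rfl⟩
  | cons i q ih =>
    by_cases hn : i :: q = node
    · subst hn
      exact ⟨B, L, R, h, by rw [evictInnerLoop, if_pos rfl], Within.refl _ _, hB, rfl⟩
    · have hq : node <:+ q := (List.suffix_cons_iff.1 hp).resolve_left fun h => hn h.symm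
      obtain ⟨c1, c2, c3⟩ := hB.1.plug ⟨⟨hB.2.2.1 (by simp), hB.2.2.2.1⟩, hB.2.1⟩
      obtain ⟨y, hy, hg, ha, hw, he, hc⟩ := good_localRepairAggIfUp c2
      have hs : StateOK μ μ (2 * μ) (B.localRepairAggIfUp q) q (h + 1) := by
        rw [hy]
        refine StateOK.replace c1 hg ?_
        rw [Sized, ha, he, hc]
        exact c3
      obtain ⟨B', L', R', h', e, z1, z2, z3⟩ := ih (L || leftSpine q)
        (R || rightSpine B q) hq hs
      refine ⟨B', L', R', h', ?_, ((within_localRepairAggIfUp B q).mono hq).trans z1, z2,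
        z3.trans (window_localRepairAggIfUp c1.pathOK)⟩
      rw [evictInnerLoop, if_neg hn]
      exact e

end Loops

end Node

/-! ### Sorted windows -/

section Windows

variable {T S : Type*} [LinearOrder T]

/-- The times are strictly increasing. -/
abbrev Sorted (w : List (T × S)) : Prop := w.Pairwise fun e e' => e.1 < e'.1

theorem evictEntry_sorted {t : T} {w : List (T × S)} (h : Sorted w) : Sorted (evictEntry t w) :=
  h.filter _

theorem evictEntry_eq_self {t : T} {w : List (T × S)} (h : ∀ e ∈ w, e.1 ≠ t) :
    evictEntry t w = w := by
  simpa [evictEntry] using h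

theorem evictEntry_append (t : T) (P Q : List (T × S)) :
    evictEntry t (P ++ Q) = evictEntry t P ++ evictEntry t Q := by
  simp [evictEntry]

theorem evictEntry_append_cons {P Q : List (T × S)} {e : T × S} (h : Sorted (P ++ e :: Q)) :
    evictEntry e.1 (P ++ e :: Q) = P ++ Q := by
  obtain ⟨-, h2, h3⟩ := List.pairwise_append.1 h
  rw [evictEntry_append, evictEntry_eq_self fun a ha => (h3 a ha e (by simp)).ne]
  have : evictEntry e.1 (e :: Q) = evictEntry e.1 Q := by simp [evictEntry]
  rw [this, evictEntry_eq_self fun a ha => ((List.pairwise_cons.1 h2).1 a ha).ne']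

variable [Monoid S]

theorem insertEntry_append_left {t : T} {v : S} {P : List (T × S)} (h : ∀ e ∈ P, e.1 < t)
    (Q : List (T × S)) : insertEntry t v (P ++ Q) = P ++ insertEntry t v Q := by
  induction P with
  | nil => rfl
  | cons e P ih =>
    have h1 : e.1 < t := h e (by simp)
    rw [List.cons_append, insertEntry, if_neg h1.not_gt, if_neg h1.ne',
      ih fun a ha => h a (by simp [ha])]
    rfl

theorem insertEntry_append_right {t : T} {v : S} {Q : List (T × S)} (h : ∀ e ∈ Q, t < e.1)
    (P : List (T × S)) : insertEntry t v (P ++ Q) = insertEntry t v P ++ Q := by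
  induction P with
  | nil => cases Q with
    | nil => rfl
    | cons e Q => simp [insertEntry, h e (by simp)]
  | cons e P ih =>
    simp only [List.cons_append, insertEntry, ih]
    split_ifs <;> rfl

theorem insertEntry_append_cons {t : T} {v w : S} {P Q : List (T × S)}
    (h : Sorted (P ++ (t, w) :: Q)) :
    insertEntry t v (P ++ (t, w) :: Q) = P ++ (t, w * v) :: Q := by
  obtain ⟨-, h2, h3⟩ := List.pairwise_append.1 h
  rw [insertEntry_append_left fun a ha => h3 a ha (t, w) (by simp)]
  simp [insertEntry]

theorem length_le_length_insertEntry (t : T) (v : S) (w : List (T × S)) :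
    w.length ≤ (insertEntry t v w).length ∧ (insertEntry t v w).length ≤ w.length + 1 ∧
      1 ≤ (insertEntry t v w).length := by
  induction w with
  | nil => simp [insertEntry]
  | cons e w ih => simp only [insertEntry]; split_ifs <;> (simp; try omega)

theorem lt_of_mem_insertEntry {t s : T} {v : S} {w : List (T × S)} (hs : s < t)
    (h : ∀ e ∈ w, s < e.1) : ∀ e ∈ insertEntry t v w, s < e.1 := by
  induction w with
  | nil => simpa [insertEntry] using hs
  | cons e w ih =>
    have h1 := h e (by simp)
    have h2 := fun a ha => h a (List.mem_cons_of_mem e ha)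
    simp only [insertEntry]
    split_ifs
    · simpa [hs, h1] using fun a b hab => h2 (a, b) hab
    · simpa [h1] using fun a b hab => h2 (a, b) hab
    · simpa [h1] using fun a b hab => ih h2 (a, b) hab

theorem insertEntry_sorted {t : T} {v : S} {w : List (T × S)} (h : Sorted w) :
    Sorted (insertEntry t v w) := by
  induction w with
  | nil => simp [insertEntry, Sorted]
  | cons e w ih =>
    obtain ⟨h1, h2⟩ := List.pairwise_cons.1 h
    simp only [insertEntry]
    split_ifs with ht ht'
    · exact List.pairwise_cons.2 ⟨fun a ha => by
        rcases List.mem_cons.1 ha with rfl | ha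
        · exact ht
        · exact ht.trans (h1 a ha), h⟩
    · exact List.pairwise_cons.2 ⟨h1, h2⟩
    · exact List.pairwise_cons.2 ⟨lt_of_mem_insertEntry
        (lt_of_le_of_ne (not_lt.1 ht) (Ne.symm ht')) h1, ih h2⟩

end Windows

namespace Node

/-! ### Addresses in a finger B-tree -/

section Tree

variable {T S : Type*}

theorem height_lt {x c : Node T S} (h : c ∈ x.children) : c.height + 1 ≤ x.height := by
  rw [height_eq x]
  generalize x.children = cs at h
  induction cs with
  | nil => simp at h
  | cons d cs ih =>
    rcases List.mem_cons.1 h with rfl | h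
    · exact le_max_left _ _
    · exact (ih h).trans (le_max_right _ _)

theorem isLeaf_iff {x : Node T S} : x.isLeaf = true ↔ x.children = [] := by
  simp [isLeaf]

theorem not_isLeaf_iff {x : Node T S} : x.isLeaf = false ↔ x.children ≠ [] := by
  simp [isLeaf]

variable [Monoid S] {μ h : ℕ} {l r : Bool}

theorem Kids.height_eq {x : Node T S} (hx : Kids μ h l r x) : x.height = h := by
  induction h generalizing x l r with
  | zero => rw [Node.height_eq, kids_zero.1 hx]; rfl
  | succ h ih =>
    obtain ⟨h1, h2⟩ := kids_succ.1 hx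
    have h3 := h2.forall_mem (p := fun c => c.height = h) fun l r c hc => ih hc.2.2
    have hne : x.children ≠ [] := by rintro e; rw [e] at h1; simp [arity] at h1
    rw [Node.height_eq]
    generalize x.children = cs at h3 hne
    clear h1 h2 hx
    induction cs with
    | nil => exact absurd rfl hne
    | cons c cs ih' =>
      rw [heights, h3 c (by simp)]
      by_cases hc : cs = []
      · subst hc; simp [heights]
      · rw [ih' (fun d hd => h3 d (by simp [hd])) hc]; simp

theorem Kids.eq_zero_iff {x : Node T S} (hx : Kids μ h l r x) : h = 0 ↔ x.isLeaf = true := by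
  rw [isLeaf_iff]
  cases h with
  | zero => simpa [kids_zero] using hx
  | succ h =>
    obtain ⟨h1, -⟩ := kids_succ.1 hx
    simp only [Nat.add_eq_zero_iff, one_ne_zero, and_false, false_iff]
    intro e
    rw [e] at h1
    simp [arity] at h1

/-- In a tree with these invariants every node has a well-behaved context. -/
theorem loc_of_isAddr {B : Node T S} (hk : Kids μ h true true B) (hs : Sized μ (2 * μ) [] B)
    {p : Addr} (hp : IsAddr B p) : ∃ k, k + p.length = h ∧ CtxOK μ B p k ∧
      Good μ k (leftSpine p) (rightSpine B p) (nodeAt B p) ∧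
      Sized μ (2 * μ) p (nodeAt B p) := by
  cases p with
  | nil => exact ⟨h, rfl, trivial, ⟨by simp, hk⟩, hs⟩
  | cons i q =>
    obtain ⟨k, h1, h2, h3⟩ := CtxOK.descend_append (μ := μ) (B := B) (b := i :: q) (q := []) (k := h)
      trivial hk hs (by simpa using hp) (by simp)
    simp only [List.append_nil] at h2 h3
    exact ⟨k, h1, h2, h3.2, h3.sized⟩

theorem exists_leaf_below (x : Node T S) : ∃ b, IsAddr x b ∧ (nodeAt x b).isLeaf = true := by
  induction hn : x.height using Nat.strong_induction_on generalizing x with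
  | _ n ih =>
    by_cases hx : x.children = []
    · exact ⟨[], trivial, isLeaf_iff.2 hx⟩
    · obtain ⟨c, cs, e⟩ := List.exists_cons_of_ne_nil hx
      obtain ⟨b, h1, h2⟩ := ih c.height
        (by have := height_lt (x := x) (c := c) (by simp [e]); omega) c rfl
      have hc : nodeAt x [0] = c := by simp [nodeAt, e]
      refine ⟨b ++ [0], isAddr_append.2 ⟨⟨trivial, by simp [nodeAt, e]⟩, by rwa [hc]⟩, ?_⟩
      rwa [nodeAt_append, hc]

/-- The invariants in terms of addresses imply the recursive ones. -/
theorem kids_of_invariants {B : Node T S} (hs : SizeInv μ B)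
    (hup : ∀ p, IsAddr B p → leftSpine p = false → rightSpine B p = false →
      (nodeAt B p).agg = piUp (nodeAt B p)) {H : ℕ}
    (hH : ∀ p, IsAddr B p → (nodeAt B p).isLeaf = true → p.length = H) (h : ℕ) {p : Addr}
    (hp : IsAddr B p) (hl : p.length + h = H) :
    Kids μ h (leftSpine p) (rightSpine B p) (nodeAt B p) := by
  induction h generalizing p with
  | zero =>
    rw [kids_zero]
    by_contra hne
    obtain ⟨b, h1, h2⟩ := exists_leaf_below (nodeAt B (0 :: p))
    have := hH (b ++ 0 :: p)
      (isAddr_append.2 ⟨⟨hp, List.length_pos_iff.2 hne⟩, h1⟩) (by rwa [nodeAt_append])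
    simp at this
    omega
  | succ h ih =>
    have hleaf : (nodeAt B p).isLeaf = false := by
      by_contra hc
      have := hH p hp (by simpa using hc)
      omega
    have hlen := hs.children_length p hp hleaf
    refine kids_succ.2 ⟨hlen, forallPos_of_get fun a c b e => ?_⟩
    obtain ⟨f1, f2⟩ := flags_eq (l := leftSpine p) (r := rightSpine B p) hlen e
    have ha : IsAddr B (a.length :: p) := ⟨hp, by simp [e]⟩
    rw [f1, f2, ← leftSpine_cons, ← rightSpine_cons, ← nodeAt_cons e]
    exact ⟨⟨hs.min_arity _ ha (by simp), hs.max_arity _ ha⟩, hup _ ha,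
      ih ha (by simp; omega)⟩

theorem IsFingerBTree.exists_kids [LinearOrder T] {B : Node T S} (hB : IsFingerBTree μ B) :
    (∃ h, Kids μ h true true B) ∧ Sized μ (2 * μ) [] B := by
  obtain ⟨H, hH⟩ := hB.balanced
  exact ⟨⟨H, kids_of_invariants hB.size hB.aggs.up hH H (p := []) trivial (by simp)⟩,
    by simp, hB.size.max_arity [] trivial, fun _ => hB.size.root_arity⟩

/-- The recursive invariants imply those in terms of addresses. -/
theorem invariants_of_kids {B : Node T S} (hk : Kids μ h true true B)
    (hs : Sized μ (2 * μ) [] B) : SizeInv μ B ∧ Balanced B ∧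
      ∀ p, IsAddr B p → leftSpine p = false → rightSpine B p = false →
      (nodeAt B p).agg = piUp (nodeAt B p) := by
  refine ⟨⟨fun p hp hne => ?_, fun p hp => ?_, hs.2.2 rfl, fun p hp hl => ?_⟩, ⟨h, fun p hp hl => ?_⟩,
    fun p hp h1 h2 => ?_⟩ <;> obtain ⟨k, k1, k2, k3, k4⟩ := loc_of_isAddr hk hs hp
  · exact k4.1 hne
  · exact k4.2.1
  · cases k with
    | zero => rw [k3.2.eq_zero_iff.1 rfl] at hl; simp at hl
    | succ k => exact (kids_succ.1 k3.2).1
  · have := k3.2.eq_zero_iff.2 hl; omega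
  · exact k3.1 h1 h2

end Tree

/-! ### Fingers and search -/

section Weave

variable {T S : Type*}

theorem sublist_weave (C : List (Node T S)) (E : List (T × S)) : E.Sublist (weave C E) := by
  induction E generalizing C with
  | nil => simp
  | cons e E ih => cases C with
    | nil => simp
    | cons c C =>
      simp only [weave_cons, weave'_cons]
      exact ((ih C).cons_cons e).trans (List.sublist_append_right _ _)

variable [LinearOrder T]

/-- In a sorted alternation that ends with an entry, the last entry bounds everything. -/
theorem weave_lt {C : List (Node T S)} {E : List (T × S)} {t : T} (hl : C.length = E.length)
    (hs : Sorted (weave C E)) (hE : ∀ e ∈ E, e.1 < t) : ∀ e ∈ weave C E, e.1 < t := by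
  rcases List.eq_nil_or_concat E with rfl | ⟨E, f, rfl⟩
  · obtain rfl := List.length_eq_zero_iff.1 hl
    simp
  · rcases List.eq_nil_or_concat C with rfl | ⟨C, c, rfl⟩
    · simp at hl
    · rw [List.concat_eq_append, List.concat_eq_append, weave_append (by simpa using hl)] at *
      simp only [weave_cons, weave'_cons, weave_nil_left, ← List.append_assoc] at hs ⊢
      have hf : f.1 < t := hE f (by simp)
      intro e he
      rcases List.mem_append.1 he with he | he
      · exact ((List.pairwise_append.1 hs).2.2 e he f (by simp)).trans hf
      · obtain rfl : e = f := by simpa using he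
        exact hf

/-- In a sorted alternation that starts with an entry, the first entry bounds everything. -/
theorem lt_weave' {C : List (Node T S)} {E : List (T × S)} {t : T} (hl : C.length = E.length)
    (hs : Sorted (weave' E C)) (hE : ∀ e ∈ E.head?, t < e.1) : ∀ e ∈ weave' E C, t < e.1 := by
  cases E with
  | nil =>
    obtain rfl := List.length_eq_zero_iff.1 hl
    simp
  | cons f E =>
    have hf : t < f.1 := hE f (by simp)
    rw [weave'_cons] at hs ⊢
    intro e he
    rcases List.mem_cons.1 he with rfl | he
    · exact hf
    · exact hf.trans ((List.pairwise_cons.1 hs).1 e he)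

theorem sorted_entries {x : Node T S} (hx : Sorted x.window) : Sorted x.entries := by
  rw [window_eq_weave] at hx
  exact hx.sublist (sublist_weave _ _)

end Weave

section Search

variable {T S : Type*} [Monoid S] {μ h : ℕ} {B : Node T S}

theorem leftSpine_append (b a : Addr) : leftSpine (b ++ a) = (leftSpine b && leftSpine a) := by
  simp [leftSpine]

theorem rightSpine_append (B : Node T S) (b a : Addr) :
    rightSpine B (b ++ a) = (rightSpine (nodeAt B a) b && rightSpine B a) := by
  induction b with
  | nil => simp
  | cons i b ih => simp [rightSpine_cons, nodeAt_append, ih, Bool.and_assoc]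

/-- The children of an inner node are as many as its arity. -/
theorem children_length_eq (hk : Kids μ h true true B) (hs : Sized μ (2 * μ) [] B) {p : Addr}
    (hp : IsAddr B p) (hl : (nodeAt B p).isLeaf = false) :
    (nodeAt B p).children.length = (nodeAt B p).arity ∧ p.length < h := by
  obtain ⟨k, k1, -, k3, -⟩ := loc_of_isAddr hk hs hp
  cases k with
  | zero => rw [k3.2.eq_zero_iff.1 rfl] at hl; simp at hl
  | succ k => exact ⟨(kids_succ.1 k3.2).1, by omega⟩

theorem isLeaf_of_length (hk : Kids μ h true true B) (hs : Sized μ (2 * μ) [] B) {p : Addr}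
    (hp : IsAddr B p) (hl : h ≤ p.length) : (nodeAt B p).isLeaf = true := by
  by_contra hc
  have := (children_length_eq hk hs hp (by simpa using hc)).2
  omega

theorem leftmostLeaf_go_spec (hk : Kids μ h true true B) (hs : Sized μ (2 * μ) [] B) (n : ℕ)
    {p : Addr} (hp : IsAddr B p) (hn : h ≤ n + p.length) :
    ∃ b, leftmostLeaf.go B n p = b ++ p ∧ leftSpine b = true ∧ IsAddr B (b ++ p) ∧
      (nodeAt B (b ++ p)).isLeaf = true := by
  induction n generalizing p with
  | zero =>
    have hl := isLeaf_of_length hk hs hp (by omega)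
    exact ⟨[], rfl, rfl, hp, hl⟩
  | succ n ih =>
    rw [leftmostLeaf.go]
    split
    · rename_i hl
      exact ⟨[], rfl, rfl, hp, hl⟩
    · rename_i hl
      have hl' := (children_length_eq hk hs hp (by simpa using hl)).1
      obtain ⟨b, h1, h2, h3⟩ := ih (p := 0 :: p) ⟨hp, by rw [hl']; simp [arity]⟩
        (by simp; omega)
      refine ⟨b ++ [0], by simpa using h1, ?_, by simpa using h3⟩
      rw [leftSpine_append, h2]; rfl

theorem rightmostLeaf_go_spec (hk : Kids μ h true true B) (hs : Sized μ (2 * μ) [] B) (n : ℕ)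
    {p : Addr} (hp : IsAddr B p) (hn : h ≤ n + p.length) :
    ∃ b, rightmostLeaf.go B n p = b ++ p ∧ rightSpine (nodeAt B p) b = true ∧
      IsAddr B (b ++ p) ∧ (nodeAt B (b ++ p)).isLeaf = true := by
  induction n generalizing p with
  | zero =>
    have hl := isLeaf_of_length hk hs hp (by omega)
    exact ⟨[], rfl, rfl, hp, hl⟩
  | succ n ih =>
    rw [rightmostLeaf.go]
    split
    · rename_i hl
      exact ⟨[], rfl, rfl, hp, hl⟩
    · rename_i hl
      have hl' := (children_length_eq hk hs hp (by simpa using hl)).1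
      obtain ⟨b, h1, h2, h3⟩ := ih (p := ((nodeAt B p).arity - 1) :: p)
        ⟨hp, by rw [hl']; simp [arity]⟩ (by simp; omega)
      refine ⟨b ++ [(nodeAt B p).arity - 1], by simpa using h1, ?_, by simpa using h3⟩
      rw [rightSpine_append]
      simp only [nodeAt] at h2 ⊢
      rw [h2]
      simp [rightSpine_cons, nodeAt, arity]

theorem leftmostLeaf_spec (hk : Kids μ h true true B) (hs : Sized μ (2 * μ) [] B)
    {p : Addr} (hp : IsAddr B p) :
    ∃ b, leftmostLeaf B p = b ++ p ∧ leftSpine b = true ∧ IsAddr B (b ++ p) ∧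
      (nodeAt B (b ++ p)).isLeaf = true :=
  leftmostLeaf_go_spec hk hs _ hp (by rw [hk.height_eq]; omega)

theorem rightmostLeaf_spec (hk : Kids μ h true true B) (hs : Sized μ (2 * μ) [] B)
    {p : Addr} (hp : IsAddr B p) :
    ∃ b, rightmostLeaf B p = b ++ p ∧ rightSpine (nodeAt B p) b = true ∧ IsAddr B (b ++ p) ∧
      (nodeAt B (b ++ p)).isLeaf = true :=
  rightmostLeaf_go_spec hk hs _ hp (by rw [hk.height_eq]; omega)

theorem before_eq_nil {p : Addr} (hp : leftSpine p = true) : before B p = [] := by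
  induction p with
  | nil => rfl
  | cons i q ih =>
    rw [leftSpine_cons, Bool.and_eq_true] at hp
    have : i = 0 := by simpa using hp.1
    simp [before, ih hp.2, this]

theorem after_eq_nil {p : Addr} (hp : PathOK B p) (hl : ∀ q, q <:+ p → q ≠ p →
    (nodeAt B q).children.length = (nodeAt B q).arity) (hr : rightSpine B p = true) :
    after B p = [] := by
  induction p with
  | nil => rfl
  | cons i q ih =>
    rw [rightSpine_cons, Bool.and_eq_true, beq_iff_eq] at hr
    have hlen := hl q (List.suffix_cons i q) (by simp)
    have hq : after B q = [] := by
      refine ih hp.1 (fun r hr hne => hl r (hr.trans (List.suffix_cons i q)) ?_) hr.2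
      rintro rfl
      have := hr.length_le
      simp at this
    have h1 : (nodeAt B q).entries.drop i = [] := by
      rw [List.drop_eq_nil_iff, ← Nat.succ_le_succ_iff]; exact hr.1.ge
    have h2 : (nodeAt B q).children.drop (i + 1) = [] := by
      rw [List.drop_eq_nil_iff, hlen, hr.1]
    simp [after, hq, h1, h2, weave']

variable [LinearOrder T]

/-- All entries left of the node at `p` are before `t`, all entries right of it are after `t`. -/
def Fits (B : Node T S) (t : T) (p : Addr) : Prop :=
  (∀ e ∈ before B p, e.1 < t) ∧ ∀ e ∈ after B p, t < e.1

/-- Going down to the child after all entries that are before `t`. -/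
theorem Fits.cons {t : T} {p : Addr} (hB : Sorted B.window) (hp : PathOK B p) (hf : Fits B t p)
    (hl : (nodeAt B p).children.length = (nodeAt B p).arity) (ht : (nodeAt B p).hasTime t = false) :
    Fits B t (((nodeAt B p).entries.takeWhile fun e => decide (e.1 < t)).length :: p) := by
  set i := ((nodeAt B p).entries.takeWhile fun e => decide (e.1 < t)).length with hi
  have hile : i ≤ (nodeAt B p).entries.length := (List.takeWhile_prefix _).length_le
  have htake : (nodeAt B p).entries.take i =
      (nodeAt B p).entries.takeWhile fun e => decide (e.1 < t) := by
    conv_lhs => rw [← List.takeWhile_append_dropWhile (p := fun e => decide (e.1 < t))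
      (l := (nodeAt B p).entries)]
    exact List.take_left
  have hdrop : (nodeAt B p).entries.drop i =
      (nodeAt B p).entries.dropWhile fun e => decide (e.1 < t) := by
    conv_lhs => rw [← List.takeWhile_append_dropWhile (p := fun e => decide (e.1 < t))
      (l := (nodeAt B p).entries)]
    exact List.drop_left
  have hi' : i < (nodeAt B p).children.length := by rw [hl, arity]; omega
  have hw := weave_split (nodeAt B p).children (nodeAt B p).entries hi' hile id
  have hsub : Sorted (nodeAt B p).window := by
    rw [window_eq hp] at hB
    exact (List.pairwise_append.1 (List.pairwise_append.1 hB).1).2.1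
  rw [window_eq_weave] at hsub
  rw [List.modify_id, id] at hw
  rw [hw] at hsub
  obtain ⟨hs1, hs2, -⟩ := List.pairwise_append.1 hsub
  obtain ⟨hs1, -, -⟩ := List.pairwise_append.1 hs1
  constructor
  · intro e he
    rcases List.mem_append.1 he with he | he
    · exact hf.1 e he
    · refine weave_lt ?_ hs1 ?_ e he
      · simp; omega
      · rw [htake]
        intro e he
        simpa using List.mem_takeWhile_imp he
  · intro e he
    rcases List.mem_append.1 he with he | he
    · refine lt_weave' ?_ hs2 ?_ e he
      · rw [arity] at hl; simp; omega
      · rw [hdrop]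
        intro e he
        have h1 := List.head?_dropWhile_not (fun e => decide (e.1 < t)) (nodeAt B p).entries
        rw [he] at h1
        have h2 : e ∈ (nodeAt B p).entries :=
          (List.dropWhile_suffix _).subset (List.mem_of_mem_head? he)
        have h3 : e.1 ≠ t := by
          rintro rfl
          rw [hasTime, List.any_eq_false] at ht
          exact ht e h2 (by simp)
        exact lt_of_le_of_ne (by simpa using h1) h3.symm
    · exact hf.2 e he

theorem searchDown_go_spec (hk : Kids μ h true true B) (hs : Sized μ (2 * μ) [] B)
    (hB : Sorted B.window) {t : T} (n : ℕ) {p : Addr} (hp : IsAddr B p) (hf : Fits B t p)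
    (hn : h ≤ n + p.length) :
    ∃ q, searchDown.go B t n p = q ∧ IsAddr B q ∧ Fits B t q ∧
      ((nodeAt B q).isLeaf = true ∨ (nodeAt B q).hasTime t = true) := by
  induction n generalizing p with
  | zero => exact ⟨p, rfl, hp, hf, Or.inl (isLeaf_of_length hk hs hp (by omega))⟩
  | succ n ih =>
    rw [searchDown.go]
    by_cases hc : ((nodeAt B p).isLeaf || (nodeAt B p).hasTime t) = true
    · simp only [hc, if_true]
      exact ⟨p, rfl, hp, hf, by simpa using hc⟩
    · simp only [hc]
      rw [Bool.not_eq_true, Bool.or_eq_false_iff] at hc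
      obtain ⟨k, -, k2, -⟩ := loc_of_isAddr hk hs hp
      have hl := (children_length_eq hk hs hp hc.1).1
      refine ih ⟨hp, ?_⟩ (hf.cons hB k2.pathOK hl hc.2) (by simp; omega)
      rw [hl, arity]
      have := (List.takeWhile_prefix (fun e => decide (e.1 < t)) (l := (nodeAt B p).entries)).length_le
      omega

theorem searchDown_spec (hk : Kids μ h true true B) (hs : Sized μ (2 * μ) [] B)
    (hB : Sorted B.window) {t : T} {p : Addr} (hp : IsAddr B p) (hf : Fits B t p) :
    ∃ q, searchDown B t p = q ∧ IsAddr B q ∧ Fits B t q ∧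
      ((nodeAt B q).isLeaf = true ∨ (nodeAt B q).hasTime t = true) :=
  searchDown_go_spec hk hs hB _ hp hf (by rw [hk.height_eq]; omega)

/-- Below the left spine, the times before the first time of the parent belong. -/
theorem fits_of_leftSpine {t : T} {i : ℕ} {p : Addr} (hB : Sorted B.window)
    (hp : PathOK B (i :: p)) (hl : leftSpine (i :: p) = true) {f : T × S}
    (hf : (nodeAt B p).entries.head? = some f) (ht : t < f.1) : Fits B t (i :: p) := by
  rw [Fits, before_eq_nil hl]
  refine ⟨by simp, ?_⟩
  rw [window_eq hp] at hB
  have h2 := (List.pairwise_append.1 hB).2.1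
  rw [leftSpine_cons, Bool.and_eq_true, beq_iff_eq] at hl
  obtain ⟨rfl, -⟩ := hl
  obtain ⟨F, hF⟩ : ∃ F, (nodeAt B p).entries = f :: F := List.head?_eq_some_iff.1 hf
  simp only [after, hF, List.drop_zero, weave'_cons, List.cons_append] at h2 ⊢
  intro e he
  rcases List.mem_cons.1 he with rfl | he
  · exact ht
  · exact ht.trans ((List.pairwise_cons.1 h2).1 e he)

/-- Below the right spine, the times after the last time of the parent belong. -/
theorem fits_of_rightSpine {t : T} {i : ℕ} {p : Addr} (hB : Sorted B.window)
    (hp : PathOK B (i :: p)) (hl : ∀ q, q <:+ i :: p → q ≠ i :: p →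
      (nodeAt B q).children.length = (nodeAt B q).arity) (hr : rightSpine B (i :: p) = true)
    {f : T × S} (hf : (nodeAt B p).entries.getLast? = some f) (ht : f.1 < t) :
    Fits B t (i :: p) := by
  rw [Fits, after_eq_nil hp hl hr]
  refine ⟨?_, by simp⟩
  rw [window_eq hp] at hB
  have h2 := (List.pairwise_append.1 (List.pairwise_append.1 hB).1).1
  rw [rightSpine_cons, Bool.and_eq_true, beq_iff_eq] at hr
  obtain ⟨F, hF⟩ : ∃ F, (nodeAt B p).entries = F ++ [f] := List.getLast?_eq_some_iff.1 hf
  have hi : i = (nodeAt B p).entries.length := by have := hr.1; rw [arity] at this; omega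
  have hlen := hl p (List.suffix_cons i p) (by simp)
  obtain ⟨C, c, b, e, hC⟩ := exists_eq_append_cons (cs := (nodeAt B p).children) (i := F.length)
    (by rw [hlen, arity, hF]; simp)
  have hi' : i = (C ++ [c]).length := by rw [hi, hF]; simp [hC]
  have hb : before B (i :: p) = before B p ++ (weave C F ++ c.window) ++ [f] := by
    rw [before, hi, List.take_length, ← hi, hF, e, hi', show C ++ c :: b = (C ++ [c]) ++ b by simp,
      List.take_left, weave_append hC]
    simp
  rw [hb] at h2 ⊢
  intro e he
  rcases List.mem_append.1 he with he | he
  · exact ((List.pairwise_append.1 h2).2.2 e he f (by simp)).trans ht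
  · obtain rfl : e = f := by simpa using he
    exact ht

theorem searchUp_spec (hk : Kids μ h true true B) (hs : Sized μ (2 * μ) [] B)
    (hB : Sorted B.window) {t : T} (p q : Addr) (hp : IsAddr B p) (hq : IsAddr B q)
    (hl : leftSpine p = true) (hr : rightSpine B q = true) :
    ∃ r, searchUp B t p q = r ∧ IsAddr B r ∧ Fits B t r ∧
      ((nodeAt B r).isLeaf = true ∨ (nodeAt B r).hasTime t = true) := by
  have hroot : ∃ r, searchDown B t [] = r ∧ IsAddr B r ∧ Fits B t r ∧
      ((nodeAt B r).isLeaf = true ∨ (nodeAt B r).hasTime t = true) :=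
    searchDown_spec hk hs hB trivial ⟨by simp [before], by simp [after]⟩
  have hpath : ∀ {p}, IsAddr B p → PathOK B p := fun hp => by
    obtain ⟨k, -, k2, -⟩ := loc_of_isAddr hk hs hp
    exact k2.pathOK
  induction p generalizing q with
  | nil => unfold searchUp; exact hroot
  | cons i p ih => cases q with
    | nil => unfold searchUp; exact hroot
    | cons j q =>
      rw [searchUp]
      split_ifs with h1 h2
      · refine searchDown_spec hk hs hB hp ?_
        rw [Option.any_eq_true_iff_get] at h1
        obtain ⟨hsome, h1⟩ := h1
        exact fits_of_leftSpine hB (hpath hp) hl (Option.some_get hsome).symm (by simpa using h1)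
      · refine searchDown_spec hk hs hB hq ?_
        rw [Option.any_eq_true_iff_get] at h2
        obtain ⟨hsome, h2⟩ := h2
        refine fits_of_rightSpine hB (hpath hq) (fun r hr hne => ?_) hr
          (Option.some_get hsome).symm (by simpa using h2)
        refine (children_length_eq hk hs (hq.suffix hr) ?_).1
        rw [not_isLeaf_iff]
        obtain ⟨b, hb⟩ := hr
        rcases List.eq_nil_or_concat b with rfl | ⟨b, m, rfl⟩
        · exact absurd hb hne
        · rw [List.concat_eq_append, List.append_assoc] at hb
          rw [← hb, isAddr_append] at hq
          intro he
          have := hq.1.2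
          simp only [List.append_eq, List.nil_append] at this
          rw [he] at this
          simp at this
      · rw [leftSpine_cons, Bool.and_eq_true] at hl
        rw [rightSpine_cons, Bool.and_eq_true] at hr
        exact ih q hp.1 hq.1 hl.2 hr.2

/-- The search ends at a node whose surroundings belong to other times than `t`, and which is a leaf
or contains `t`. -/
theorem searchNode_spec (hk : Kids μ h true true B) (hs : Sized μ (2 * μ) [] B)
    (hB : Sorted B.window) (t : T) :
    ∃ r, searchNode B t = r ∧ IsAddr B r ∧ Fits B t r ∧
      ((nodeAt B r).isLeaf = true ∨ (nodeAt B r).hasTime t = true) := by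
  obtain ⟨b, h1, h2, h3, -⟩ := leftmostLeaf_spec hk hs (p := []) trivial
  obtain ⟨c, h4, h5, h6, -⟩ := rightmostLeaf_spec hk hs (p := []) trivial
  rw [List.append_nil] at *
  unfold searchNode leftFinger rightFinger
  rw [h1, h4]
  exact searchUp_spec hk hs hB _ _ h3 h6 h2 h5

end Search

/-! ### Changes of stored aggregates -/

section Strip

variable {T S : Type*}

mutual
/-- Forget the stored aggregates. -/
def strip [Monoid S] : Node T S → Node T S
  | ⟨_, es, cs⟩ => ⟨1, es, strips cs⟩
/-- Auxiliary to `strip`. -/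
def strips [Monoid S] : List (Node T S) → List (Node T S)
  | [] => []
  | c :: cs => strip c :: strips cs
end

variable [Monoid S]

theorem strips_eq_map (cs : List (Node T S)) : strips cs = cs.map strip := by
  induction cs with
  | nil => rfl
  | cons c cs ih => simp [strips, ih]

theorem strip_eq (x : Node T S) : x.strip = ⟨1, x.entries, x.children.map strip⟩ := by
  cases x; simp [strip, strips_eq_map]

theorem nodeAt_strip (B : Node T S) (p : Addr) : nodeAt B.strip p = (nodeAt B p).strip := by
  induction p with
  | nil => rfl
  | cons i q ih =>
    have he : (empty : Node T S).strip = empty := by simp [strip_eq, empty]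
    simp only [nodeAt, ih]
    rw [strip_eq (nodeAt B q)]
    conv_lhs => rw [← he]
    simp only [List.getD_eq_getElem?_getD, List.getElem?_map]
    cases (nodeAt B q).children[i]? <;> rfl

mutual
theorem piUp_strip : ∀ x : Node T S, x.strip.piUp = x.piUp
  | ⟨_, es, cs⟩ => by simp only [strip, piUp, piUps_strips cs]
theorem piUps_strips : ∀ cs : List (Node T S), piUps (strips cs) = piUps cs
  | [] => rfl
  | c :: cs => by simp only [strips, piUps, piUp_strip c, piUps_strips cs]
end

mutual
theorem window_strip : ∀ x : Node T S, x.strip.window = x.window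
  | ⟨_, es, cs⟩ => by simp only [strip, window, windows_strips cs]
theorem windows_strips : ∀ cs : List (Node T S), windows (strips cs) = windows cs
  | [] => rfl
  | c :: cs => by simp only [strips, windows, window_strip c, windows_strips cs]
end

theorem strip_modifyAt {f : Node T S → Node T S} (hf : ∀ x, (f x).strip = x.strip)
    (B : Node T S) (p : Addr) : (modifyAt B p f).strip = B.strip := by
  induction p generalizing f with
  | nil => exact hf B
  | cons i q ih =>
    refine ih fun x => ?_
    rw [strip_eq, strip_eq x]
    congr 1
    by_cases hi : i < x.children.length
    · obtain ⟨a, c, b, e, rfl⟩ := exists_eq_append_cons hi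
      simp [e, modify_append_cons, hf]
    · have hi : x.children.length ≤ i := by omega
      simp [List.modify_eq_self, hi]

theorem strip_localRepairAgg (B : Node T S) (p : Addr) : (B.localRepairAgg p).strip = B.strip :=
  strip_modifyAt (fun x => by rw [strip_eq, strip_eq x]) B p

variable {B B' : Node T S}

theorem strip_nodeAt (h : B'.strip = B.strip) (p : Addr) :
    (nodeAt B' p).strip = (nodeAt B p).strip := by
  rw [← nodeAt_strip, h, nodeAt_strip]

theorem window_of_strip (h : B'.strip = B.strip) : B'.window = B.window := by
  rw [← window_strip, h, window_strip]

theorem entries_of_strip (h : B'.strip = B.strip) (p : Addr) :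
    (nodeAt B' p).entries = (nodeAt B p).entries := by
  have h1 := congrArg (fun x => x.entries) (strip_nodeAt h p)
  simpa only [strip_eq] using h1

theorem arity_of_strip (h : B'.strip = B.strip) (p : Addr) :
    (nodeAt B' p).arity = (nodeAt B p).arity := by
  simp only [arity, entries_of_strip h]

theorem values_of_strip (h : B'.strip = B.strip) (p : Addr) :
    (nodeAt B' p).values = (nodeAt B p).values := by
  simp only [values, entries_of_strip h]

theorem length_of_strip (h : B'.strip = B.strip) (p : Addr) :
    (nodeAt B' p).children.length = (nodeAt B p).children.length := by
  have h1 := congrArg (fun x => x.children.length) (strip_nodeAt h p)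
  simpa only [strip_eq, List.length_map] using h1

theorem isLeaf_of_strip (h : B'.strip = B.strip) (p : Addr) :
    (nodeAt B' p).isLeaf = (nodeAt B p).isLeaf := by
  rw [Bool.eq_iff_iff, isLeaf_iff, isLeaf_iff, ← List.length_eq_zero_iff,
    ← List.length_eq_zero_iff, length_of_strip h]

theorem isAddr_of_strip (h : B'.strip = B.strip) (p : Addr) : IsAddr B' p ↔ IsAddr B p := by
  induction p with
  | nil => exact Iff.rfl
  | cons i q ih => rw [IsAddr, IsAddr, ih, length_of_strip h]

theorem rightSpine_of_strip (h : B'.strip = B.strip) (p : Addr) :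
    rightSpine B' p = rightSpine B p := by
  induction p with
  | nil => rfl
  | cons i q ih => rw [rightSpine, rightSpine, ih, arity_of_strip h]

theorem piUp_of_strip (h : B'.strip = B.strip) (p : Addr) :
    (nodeAt B' p).piUp = (nodeAt B p).piUp := by
  rw [← piUp_strip, strip_nodeAt h, piUp_strip]

theorem piUps_of_strip (h : B'.strip = B.strip) (p : Addr) :
    piUps (nodeAt B' p).children = piUps (nodeAt B p).children := by
  have h1 := congrArg (fun x => piUps x.children) (strip_nodeAt h p)
  simpa only [strip_eq, ← strips_eq_map, piUps_strips] using h1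

theorem piInner_of_strip (h : B'.strip = B.strip) : piInner B' = piInner B := by
  have h1 := values_of_strip h []
  have h2 := piUps_of_strip h []
  simp only [nodeAt] at h1 h2
  rw [piInner, piInner, h1, h2]

theorem piLeft_of_strip (h : B'.strip = B.strip) (p : Addr) : piLeft B' p = piLeft B p := by
  induction p with
  | nil => rfl
  | cons i q ih => rw [piLeft, piLeft, ih, values_of_strip h, piUps_of_strip h]

theorem piRight_of_strip (h : B'.strip = B.strip) (p : Addr) : piRight B' p = piRight B p := by
  induction p with
  | nil => rfl
  | cons i q ih => rw [piRight, piRight, ih, values_of_strip h, piUps_of_strip h]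

/-- If `f` changes a stored aggregate at most at `d`, then `modifyAt B p f` differs from `B` in stored
aggregates at most at `d ++ p`. -/
theorem agg_modifyAt_of_ne (B : Node T S) {p d : Addr} {f : Node T S → Node T S}
    (hf : ∀ x b, b ≠ d → (nodeAt (f x) b).agg = (nodeAt x b).agg) {a : Addr} (ha : a ≠ d ++ p) :
    (nodeAt (modifyAt B p f) a).agg = (nodeAt B a).agg := by
  induction p generalizing d f with
  | nil => exact hf B a (by simpa using ha)
  | cons i q ih =>
    refine ih (d := d ++ [i]) (fun x b hb => ?_) (by simpa using ha)
    rcases List.eq_nil_or_concat b with rfl | ⟨b, j, rfl⟩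
    · rfl
    · rw [List.concat_eq_append] at hb ⊢
      rw [nodeAt_append, nodeAt_append]
      simp only [nodeAt]
      by_cases hij : i = j
      · subst hij
        have hb' : b ≠ d := by rintro rfl; exact hb rfl
        by_cases hi : i < x.children.length
        · obtain ⟨a, c, b, e, rfl⟩ := exists_eq_append_cons hi
          simp [e, modify_append_cons, hf _ _ hb']
        · have hi : x.children.length ≤ i := by omega
          simp [List.modify_eq_self, hi]
      · simp [hij]

theorem agg_localRepairAgg_of_ne (B : Node T S) {p a : Addr} (h : a ≠ p) :
    (nodeAt (B.localRepairAgg p) a).agg = (nodeAt B a).agg := by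
  refine agg_modifyAt_of_ne B (d := []) (fun x b hb => ?_) h
  obtain ⟨b, i, rfl⟩ := List.eq_nil_or_concat b |>.resolve_left hb
  rw [List.concat_eq_append, nodeAt_append, nodeAt_append]
  rfl

theorem agg_localRepairAgg {p : Addr} (hp : IsAddr B p) :
    (nodeAt (B.localRepairAgg p) p).agg = B.localAgg p := by
  rw [localRepairAgg, nodeAt_modifyAt hp]

variable {μ h : ℕ}

/-- The recursive invariants do not depend on the aggregates stored on the spines. -/
theorem Kids.of_strip (hk : Kids μ h true true B) (hs : Sized μ (2 * μ) [] B)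
    (e : B'.strip = B.strip) (hu : ∀ a, IsAddr B a → leftSpine a = false → rightSpine B a = false →
      (nodeAt B' a).agg = (nodeAt B a).agg) :
    Kids μ h true true B' ∧ Sized μ (2 * μ) [] B' := by
  obtain ⟨i1, -, i3⟩ := invariants_of_kids hk hs
  have hH : ∀ p, IsAddr B' p → (nodeAt B' p).isLeaf = true → p.length = h := by
    intro p hp hl
    rw [isAddr_of_strip e] at hp
    rw [isLeaf_of_strip e] at hl
    obtain ⟨k, k1, -, k3, -⟩ := loc_of_isAddr hk hs hp
    have := k3.2.eq_zero_iff.2 hl; omega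
  have hS : SizeInv μ B' := by
    refine ⟨fun p hp => ?_, fun p hp => ?_, ?_, fun p hp => ?_⟩
    · rw [arity_of_strip e]; exact i1.min_arity p ((isAddr_of_strip e p).1 hp)
    · rw [arity_of_strip e]; exact i1.max_arity p ((isAddr_of_strip e p).1 hp)
    · have h1 := arity_of_strip e []
      have h2 := entries_of_strip e []
      have h3 := length_of_strip e []
      simp only [nodeAt] at h1 h2 h3
      rw [h1, h2, ← List.length_eq_zero_iff (l := B'.children), h3, List.length_eq_zero_iff]
      exact i1.root_arity
    · rw [isLeaf_of_strip e, length_of_strip e, arity_of_strip e]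
      exact i1.children_length p ((isAddr_of_strip e p).1 hp)
  refine ⟨kids_of_invariants hS (fun p hp h1 h2 => ?_) hH h (p := []) trivial (by simp),
    by simp, hS.max_arity [] trivial, fun _ => hS.root_arity⟩
  rw [rightSpine_of_strip e] at h2
  have hp := (isAddr_of_strip e p).1 hp
  rw [hu p hp h1 h2, piUp_of_strip e]
  exact i3 p hp h1 h2

theorem Kids.localRepairAgg (hk : Kids μ h true true B) (hs : Sized μ (2 * μ) [] B) {p : Addr}
    (hp : leftSpine p = true ∨ rightSpine B p = true) :
    Kids μ h true true (B.localRepairAgg p) ∧ Sized μ (2 * μ) [] (B.localRepairAgg p) := by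
  refine hk.of_strip hs (strip_localRepairAgg B p) fun a _ h1 h2 => agg_localRepairAgg_of_ne B ?_
  rintro rfl
  rw [h1, h2] at hp
  simp at hp

/-! ### Local repair of spine nodes -/

/-- The spines meet only in the root, because a root with children has at least two of them. -/
theorem spine_disjoint (hs : Sized μ (2 * μ) [] B) {p : Addr} (hp : IsAddr B p) (hne : p ≠ [])
    (hl : leftSpine p = true) : rightSpine B p = false := by
  obtain ⟨b, i, rfl⟩ := List.eq_nil_or_concat p |>.resolve_left hne
  rw [List.concat_eq_append] at *
  rw [leftSpine_append, Bool.and_eq_true] at hl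
  rw [isAddr_append] at hp
  rw [rightSpine_append]
  have hi : i = 0 := by simpa using hl.2
  have h2 : 0 < B.children.length := by have := hp.1.2; simp only [nodeAt] at this; omega
  have h3 : 2 ≤ B.arity := (hs.2.2 rfl).resolve_right fun h => by simp [h.2] at h2
  have : rightSpine B [i] = false := by
    simp only [rightSpine, nodeAt, Bool.and_true, beq_eq_false_iff_ne]
    omega
  rw [this, Bool.and_false]

theorem forallPos_children {l r : Bool} {x : Node T S} (hk : Kids μ h l r x) :
    ∃ k, ForallPos (Child μ k) l r x.children := by
  cases h with
  | zero => rw [kids_zero.1 hk]; exact ⟨0, trivial⟩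
  | succ k => exact ⟨k, (kids_succ.1 hk).2⟩

theorem localAgg_root (hk : Kids μ h true true B) : B.localAgg [] = piInner B := by
  obtain ⟨k, hk⟩ := forallPos_children hk
  simp only [localAgg, piInner, piUps_eq_map, nodeAt]
  rw [hk.map_tail_dropLast_eq Child.agg_eq]

theorem localAgg_left (hk : Kids μ h true true B) (hs : Sized μ (2 * μ) [] B) {i : ℕ} {q : Addr}
    (hp : IsAddr B (i :: q)) (hl : leftSpine (i :: q) = true)
    (hq : q ≠ [] → (nodeAt B q).agg = piLeft B q) : B.localAgg (i :: q) = piLeft B (i :: q) := by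
  obtain ⟨m, -, -, ⟨-, k3⟩, -⟩ := loc_of_isAddr hk hs hp
  rw [spine_disjoint hs hp (by simp) hl] at k3
  obtain ⟨k, hk⟩ := forallPos_children k3
  have hpar : (if q = [] then 1 else (nodeAt B q).agg) = piLeft B q := by
    split_ifs with h
    · subst h; rfl
    · exact hq h
  simp only [localAgg, hl, if_true, hpar, piLeft, piUps_eq_map]
  rw [hk.map_tail_eq Child.agg_eq]

theorem localAgg_right (hk : Kids μ h true true B) (hs : Sized μ (2 * μ) [] B) {i : ℕ} {q : Addr}
    (hp : IsAddr B (i :: q)) (hr : rightSpine B (i :: q) = true)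
    (hq : q ≠ [] → (nodeAt B q).agg = piRight B q) :
    B.localAgg (i :: q) = piRight B (i :: q) := by
  have hl : leftSpine (i :: q) = false := by
    by_contra hc
    rw [spine_disjoint hs hp (by simp) (by simpa using hc)] at hr
    simp at hr
  obtain ⟨m, -, -, ⟨-, k3⟩, -⟩ := loc_of_isAddr hk hs hp
  rw [hl] at k3
  obtain ⟨k, hk⟩ := forallPos_children k3
  have hpar : (if q = [] then 1 else (nodeAt B q).agg) = piRight B q := by
    split_ifs with h
    · subst h; rfl
    · exact hq h
  simp only [localAgg, hl, hr, if_true, hpar, piRight, piUps_eq_map]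
  rw [hk.map_dropLast_eq Child.agg_eq]
  simp

theorem leftSpine_ext {a b : Addr} (ha : leftSpine a = true) (hb : leftSpine b = true)
    (h : a.length = b.length) : a = b := by
  induction a generalizing b with
  | nil => exact (List.length_eq_zero_iff.1 h.symm).symm
  | cons i a ih => cases b with
    | nil => simp at h
    | cons j b =>
      rw [leftSpine_cons, Bool.and_eq_true, beq_iff_eq] at ha hb
      rw [ha.1, hb.1, ih ha.2 hb.2 (by simpa using h)]

theorem rightSpine_ext {a b : Addr} (ha : rightSpine B a = true) (hb : rightSpine B b = true)
    (h : a.length = b.length) : a = b := by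
  induction a generalizing b with
  | nil => exact (List.length_eq_zero_iff.1 h.symm).symm
  | cons i a ih => cases b with
    | nil => simp at h
    | cons j b =>
      rw [rightSpine_cons, Bool.and_eq_true, beq_iff_eq] at ha hb
      obtain rfl := ih ha.2 hb.2 (by simpa using h)
      have : i = j := by omega
      rw [this]

theorem length_le_of_isLeaf (hk : Kids μ h true true B) (hs : Sized μ (2 * μ) [] B) {p a : Addr}
    (hp : IsAddr B p) (hl : (nodeAt B p).isLeaf = true) (ha : IsAddr B a) :
    a.length ≤ p.length := by
  obtain ⟨k, k1, -, k3, -⟩ := loc_of_isAddr hk hs hp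
  obtain ⟨m, m1, -⟩ := loc_of_isAddr hk hs ha
  have := k3.2.eq_zero_iff.2 hl
  omega

/-- Walking down the left spine from `p` repairs exactly the nodes of the left spine below `p`. -/
theorem repairLeft_go_spec (n : ℕ) (hk : Kids μ h true true B) (hs : Sized μ (2 * μ) [] B)
    {p : Addr} (hp : IsAddr B p) (hl : leftSpine p = true)
    (hpa : p ≠ [] → (nodeAt B p).agg = piLeft B p) (hn : h ≤ n + p.length) :
    ∃ B', repairLeft.go n B p = B' ∧ B'.strip = B.strip ∧
      (∀ a, leftSpine a = false ∨ a.length ≤ p.length →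
        (nodeAt B' a).agg = (nodeAt B a).agg) ∧
      ∀ a, IsAddr B a → leftSpine a = true → p.length < a.length →
        (nodeAt B' a).agg = piLeft B a := by
  have hleaf : (nodeAt B p).isLeaf = true → ∃ B', B = B' ∧ B'.strip = B.strip ∧
      (∀ a, leftSpine a = false ∨ a.length ≤ p.length →
        (nodeAt B' a).agg = (nodeAt B a).agg) ∧
      ∀ a, IsAddr B a → leftSpine a = true → p.length < a.length →
        (nodeAt B' a).agg = piLeft B a := fun hl =>
    ⟨B, rfl, rfl, fun _ _ => rfl, fun a ha _ hlt =>
      absurd (length_le_of_isLeaf hk hs hp hl ha) (by omega)⟩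
  induction n generalizing B p with
  | zero => exact hleaf (isLeaf_of_length hk hs hp (by omega))
  | succ n ih =>
    rw [repairLeft.go]
    split
    · rename_i hc
      exact hleaf hc
    · rename_i hc
      have hlen := (children_length_eq hk hs hp (by simpa using hc)).1
      have hp' : IsAddr B (0 :: p) := ⟨hp, by rw [hlen]; simp [arity]⟩
      have hl' : leftSpine (0 :: p) = true := by simp [hl]
      have e := strip_localRepairAgg B (0 :: p)
      obtain ⟨k1, k2⟩ := hk.localRepairAgg hs (Or.inl hl')
      have hagg : (nodeAt (B.localRepairAgg (0 :: p)) (0 :: p)).agg = piLeft B (0 :: p) := by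
        rw [agg_localRepairAgg hp', localAgg_left hk hs hp' hl' hpa]
      have hp'' : IsAddr (B.localRepairAgg (0 :: p)) (0 :: p) := (isAddr_of_strip e _).2 hp'
      obtain ⟨B', h1, h2, h3, h4⟩ := ih k1 k2 hp'' hl'
        (fun _ => by rw [hagg, piLeft_of_strip e]) (by simp; omega)
        (fun hl => ⟨_, rfl, rfl, fun _ _ => rfl, fun a ha _ hlt =>
          absurd (length_le_of_isLeaf k1 k2 hp'' hl ha) (by omega)⟩)
      refine ⟨B', h1, h2.trans e, fun a ha => ?_, fun a ha hla hlt => ?_⟩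
      · rw [h3 a (ha.imp id fun h => by simp; omega), agg_localRepairAgg_of_ne]
        rintro rfl
        simp [hl] at ha
      · by_cases hlt' : a.length ≤ p.length + 1
        · obtain rfl := leftSpine_ext hla hl' (by simp; omega)
          rw [h3 _ (Or.inr le_rfl), hagg]
        · rw [h4 a ((isAddr_of_strip e a).2 ha) hla (by simp; omega), piLeft_of_strip e]

/-- Walking down the right spine from `p` repairs exactly the nodes of the right spine below `p`. -/
theorem repairRight_go_spec (n : ℕ) (hk : Kids μ h true true B) (hs : Sized μ (2 * μ) [] B)
    {p : Addr} (hp : IsAddr B p) (hl : rightSpine B p = true)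
    (hpa : p ≠ [] → (nodeAt B p).agg = piRight B p) (hn : h ≤ n + p.length) :
    ∃ B', repairRight.go n B p = B' ∧ B'.strip = B.strip ∧
      (∀ a, rightSpine B a = false ∨ a.length ≤ p.length →
        (nodeAt B' a).agg = (nodeAt B a).agg) ∧
      ∀ a, IsAddr B a → rightSpine B a = true → p.length < a.length →
        (nodeAt B' a).agg = piRight B a := by
  have hleaf : (nodeAt B p).isLeaf = true → ∃ B', B = B' ∧ B'.strip = B.strip ∧
      (∀ a, rightSpine B a = false ∨ a.length ≤ p.length →
        (nodeAt B' a).agg = (nodeAt B a).agg) ∧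
      ∀ a, IsAddr B a → rightSpine B a = true → p.length < a.length →
        (nodeAt B' a).agg = piRight B a := fun hl =>
    ⟨B, rfl, rfl, fun _ _ => rfl, fun a ha _ hlt =>
      absurd (length_le_of_isLeaf hk hs hp hl ha) (by omega)⟩
  induction n generalizing B p with
  | zero => exact hleaf (isLeaf_of_length hk hs hp (by omega))
  | succ n ih =>
    rw [repairRight.go]
    split
    · rename_i hc
      exact hleaf hc
    · rename_i hc
      have hlen := (children_length_eq hk hs hp (by simpa using hc)).1
      set i := (nodeAt B p).arity - 1 with hi
      have hi' : i + 1 = (nodeAt B p).arity := by rw [hi, arity]; omega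
      have hp' : IsAddr B (i :: p) := ⟨hp, by omega⟩
      have hl' : rightSpine B (i :: p) = true := by simp [rightSpine_cons, hl, hi']
      have e := strip_localRepairAgg B (i :: p)
      obtain ⟨k1, k2⟩ := hk.localRepairAgg hs (Or.inr hl')
      have hagg : (nodeAt (B.localRepairAgg (i :: p)) (i :: p)).agg = piRight B (i :: p) := by
        rw [agg_localRepairAgg hp', localAgg_right hk hs hp' hl' hpa]
      have hp'' : IsAddr (B.localRepairAgg (i :: p)) (i :: p) := (isAddr_of_strip e _).2 hp'
      obtain ⟨B', h1, h2, h3, h4⟩ := ih k1 k2 hp'' (by rw [rightSpine_of_strip e]; exact hl')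
        (fun _ => by rw [hagg, piRight_of_strip e]) (by simp; omega)
        (fun hl => ⟨_, rfl, rfl, fun _ _ => rfl, fun a ha _ hlt =>
          absurd (length_le_of_isLeaf k1 k2 hp'' hl ha) (by omega)⟩)
      simp only [rightSpine_of_strip e] at h3 h4
      refine ⟨B', h1, h2.trans e, fun a ha => ?_, fun a ha hla hlt => ?_⟩
      · rw [h3 a (ha.imp id fun h => by simp; omega), agg_localRepairAgg_of_ne]
        rintro rfl
        simp [hl'] at ha
      · by_cases hlt' : a.length ≤ p.length + 1
        · obtain rfl := rightSpine_ext hla hl' (by simp; omega)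
          rw [h3 _ (Or.inr le_rfl), hagg]
        · rw [h4 a ((isAddr_of_strip e a).2 ha) hla (by simp; omega), piRight_of_strip e]

end Strip

/-! ### The final repair -/

section FinalRepair

variable {T S : Type*} [Monoid S] {μ h : ℕ} {B : Node T S}

/-- Once a spine has been reached, all nodes that are on neither spine are right. -/
theorem CtxOK.exists_kids {p : Addr} (hc : CtxOK μ B p h)
    (hk : Kids μ h (leftSpine p) (rightSpine B p) (nodeAt B p))
    (hs : Sized μ (2 * μ) p (nodeAt B p)) (hp : leftSpine p = true ∨ rightSpine B p = true) :
    ∃ H, Kids μ H true true B ∧ Sized μ (2 * μ) [] B := by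
  induction p generalizing h with
  | nil => exact ⟨h, hk, hs⟩
  | cons i q ih =>
    obtain ⟨c1, c2, c3⟩ := hc.plug ⟨⟨hs.1 (by simp), hs.2.1⟩, fun h1 h2 => by
      rw [h1, h2] at hp; simp at hp, hk⟩
    refine ih c1 c2 c3 (hp.imp (fun h => ?_) fun h => ?_)
    · rw [leftSpine_cons, Bool.and_eq_true] at h; exact h.2
    · rw [rightSpine_cons, Bool.and_eq_true] at h; exact h.2

theorem localRepairAgg_eq_of_hasAggUp {p : Addr} (h : B.hasAggUp p = true) :
    B.localRepairAgg p = B.localRepairAggIfUp p := by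
  rw [localRepairAggIfUp, if_pos h]

theorem hasAggUp_eq_false_iff {p : Addr} :
    B.hasAggUp p = false ↔ leftSpine p = true ∨ rightSpine B p = true := by
  rw [hasAggUp, Bool.and_eq_false_iff, Bool.not_eq_false', Bool.not_eq_false']

theorem hasAggUp_localRepairAgg (p : Addr) : (B.localRepairAgg p).hasAggUp p = B.hasAggUp p := by
  rw [hasAggUp, hasAggUp, rightSpine_of_strip (strip_localRepairAgg B p)]

/-- Going up to a spine: the last node that is reached is the only one whose repair is not an
up-repair. -/
theorem repairUp_spec {p : Addr} (hB : StateOK μ μ (2 * μ) B p h)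
    (hp : B.hasAggUp p = true) :
    ∃ B' q h', B.repairUp p = (B'.localRepairAgg q, q) ∧ q <:+ p ∧ Within B B' q ∧
      (leftSpine q = true ∨ rightSpine B' q = true) ∧ CtxOK μ B' q h' ∧
      Kids μ h' (leftSpine q) (rightSpine B' q) (nodeAt B' q) ∧
      Sized μ (2 * μ) q (nodeAt B' q) ∧ B'.window = B.window := by
  induction p generalizing B h with
  | nil => simp [hasAggUp] at hp
  | cons i q ih =>
    obtain ⟨c1, c2, c3⟩ := hB.1.plug ⟨⟨hB.2.2.1 (by simp), hB.2.2.2.1⟩, hB.2.1⟩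
    rw [repairUp, if_pos hp]
    by_cases hq : B.hasAggUp q = true
    · obtain ⟨y, hy, hg, ha, hw, he, hc⟩ := good_localRepairAggIfUp c2
      have hst : StateOK μ μ (2 * μ) (B.localRepairAgg q) q (h + 1) := by
        rw [localRepairAgg_eq_of_hasAggUp hq, hy]
        refine StateOK.replace c1 hg ?_
        rw [Sized, ha, he, hc]
        exact c3
      obtain ⟨B', r, h', h1, h2, h3, h4, h5, h6, h7, h8⟩ :=
        ih hst ((hasAggUp_localRepairAgg q).trans hq)
      refine ⟨B', r, h', h1, h2.trans (List.suffix_cons i q), ?_, h4, h5, h6, h7,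
        h8.trans (window_of_strip (strip_localRepairAgg B q))⟩
      exact ((within_modifyAt B q _).mono h2).trans h3
    · refine ⟨B, q, h + 1, ?_, List.suffix_cons i q, Within.refl _ _,
        hasAggUp_eq_false_iff.1 (by simpa using hq), c1, c2, c3, rfl⟩
      have hq' : (B.localRepairAgg q).hasAggUp q = false := by
        rw [hasAggUp_localRepairAgg]; simpa using hq
      cases q with
      | nil => rfl
      | cons j q => rw [repairUp, if_neg (by simp [hq'])]

/-! ### Spine nodes that a change does not affect -/

variable {B₀ : Node T S}

theorem nodeAt_concat_eq {j : ℕ} (h : nodeAt B [j] = nodeAt B₀ [j]) (b : Addr) :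
    nodeAt B (b ++ [j]) = nodeAt B₀ (b ++ [j]) := by
  rw [nodeAt_append, nodeAt_append, h]

theorem piLeft_concat_eq {j : ℕ} (h : nodeAt B [j] = nodeAt B₀ [j]) (b : Addr) :
    piLeft B (b ++ [j]) = piLeft B₀ (b ++ [j]) := by
  induction b with
  | nil =>
    rw [List.nil_append, piLeft, piLeft, h]
    rfl
  | cons i b ih =>
    have := nodeAt_concat_eq h (i :: b)
    rw [List.cons_append] at this ⊢
    rw [piLeft, piLeft, ih, this]

theorem piRight_concat_eq {j : ℕ} (h : nodeAt B [j] = nodeAt B₀ [j]) (b : Addr) :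
    piRight B (b ++ [j]) = piRight B₀ (b ++ [j]) := by
  induction b with
  | nil =>
    rw [List.nil_append, piRight, piRight, h]
    rfl
  | cons i b ih =>
    have := nodeAt_concat_eq h (i :: b)
    rw [List.cons_append] at this ⊢
    rw [piRight, piRight, ih, this]

theorem tail_modify_zero {α : Type*} (cs : List α) (f : α → α) : (cs.modify 0 f).tail = cs.tail := by
  cases cs <;> rfl

theorem dropLast_modify_last {α : Type*} {cs : List α} {i : ℕ} (hi : i + 1 = cs.length)
    (f : α → α) : (cs.modify i f).dropLast = cs.dropLast := by
  obtain ⟨a, c, b, rfl, rfl⟩ := exists_eq_append_cons (cs := cs) (i := i) (by omega)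
  obtain rfl : b = [] := by simpa using hi
  rw [modify_append_cons]
  simp

theorem tail_dropLast_comm {α : Type*} (cs : List α) : cs.tail.dropLast = cs.dropLast.tail := by
  rcases cs with _ | ⟨c, _ | ⟨d, cs⟩⟩ <;> rfl

theorem piInner_eq (x : Node T S) :
    piInner x = (alternate x.values (x.children.tail.dropLast.map piUp)).prod := by
  rw [piInner, piUps_eq_map, List.map_dropLast, List.map_tail]

theorem piLeft_cons (B : Node T S) (i : ℕ) (q : Addr) : piLeft B (i :: q) =
    (alternate (nodeAt B (i :: q)).values ((nodeAt B (i :: q)).children.tail.map piUp)).prod *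
      piLeft B q := by
  rw [piLeft, piUps_eq_map, List.map_tail]

theorem piRight_cons (B : Node T S) (i : ℕ) (q : Addr) : piRight B (i :: q) = piRight B q *
    (alternate ((nodeAt B (i :: q)).children.dropLast.map piUp) (nodeAt B (i :: q)).values).prod := by
  rw [piRight, piUps_eq_map, List.map_dropLast]

theorem nodeAt_modifyAt_singleton {i j : ℕ} (hij : j ≠ i) (b : Addr) (f : Node T S → Node T S) :
    nodeAt (modifyAt B₀ (b ++ [j]) f) [i] = nodeAt B₀ [i] := by
  rw [modifyAt_concat]
  simp [nodeAt, hij]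

/-- A change below the left child of the root does not concern the root, the right spine, and the
nodes of the left spine above the change. -/
theorem unaffected_left {m : Addr} (hm : leftSpine m = true) (hne : m ≠ []) (ha : IsAddr B₀ m)
    (hw : Within B₀ B m) (hs : Sized μ (2 * μ) [] B₀) (hA : AggInv B₀) :
    B.agg = piInner B ∧
    (∀ a, IsAddr B a → a ≠ [] → rightSpine B a = true → (nodeAt B a).agg = piRight B a) ∧
    ∀ a, a ≠ [] → leftSpine a = true → a.length < m.length →
      (nodeAt B a).agg = piLeft B a := by
  obtain ⟨f, rfl⟩ := hw
  obtain ⟨b, i, rfl⟩ := List.eq_nil_or_concat m |>.resolve_left hne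
  rw [List.concat_eq_append] at *
  have hi : i = 0 := by
    rw [leftSpine_append, Bool.and_eq_true] at hm
    simpa using hm.2
  subst hi
  refine ⟨?_, fun a haB hane har => ?_, fun a hane hal hlt => ?_⟩
  · rw [modifyAt_concat, piInner_eq]
    simp only [tail_modify_zero]
    exact hA.root.trans (piInner_eq B₀)
  · obtain ⟨a, j, rfl⟩ := List.eq_nil_or_concat a |>.resolve_left hane
    rw [List.concat_eq_append] at *
    have hch : (modifyAt B₀ (b ++ [0]) f).children.length = B₀.children.length := by
      rw [modifyAt_concat]; simp
    have har' : (modifyAt B₀ (b ++ [0]) f).arity = B₀.arity := by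
      rw [modifyAt_concat]; rfl
    rw [rightSpine_append, Bool.and_eq_true] at har
    have hj : j + 1 = B₀.arity := by
      have := har.2
      rw [rightSpine_cons] at this
      simpa [nodeAt, har'] using this
    rw [isAddr_append] at haB
    have hj' : j < B₀.children.length := by rw [← hch]; exact haB.1.2
    have h2 : 2 ≤ B₀.arity := (hs.2.2 rfl).resolve_right fun h => by simp [h.2] at hj'
    have e : nodeAt (modifyAt B₀ (b ++ [0]) f) [j] = nodeAt B₀ [j] :=
      nodeAt_modifyAt_singleton (by omega) b f
    rw [e] at har haB
    rw [nodeAt_concat_eq e, piRight_concat_eq e]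
    refine hA.right _ (isAddr_append.2 ⟨⟨trivial, hj'⟩, haB.2⟩) (by simp) ?_
    rw [rightSpine_append, har.1, rightSpine_cons]
    simp [nodeAt, hj]
  · -- the left aggregate of a proper ancestor of the change omits the child in which the change is
    have key : ∀ a d : Addr, d ≠ [] → d ++ a = b ++ [0] →
        (nodeAt (modifyAt B₀ (b ++ [0]) f) a).agg = (nodeAt B₀ a).agg ∧
        piLeft (modifyAt B₀ (b ++ [0]) f) a = piLeft B₀ a := by
      intro a
      induction a with
      | nil => exact fun d hd _ => ⟨modifyAt_agg _ (by simp) _, rfl⟩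
      | cons i q ih =>
        intro d hd hda
        obtain ⟨-, h2⟩ := ih (d ++ [i]) (by simp) (by simpa using hda)
        rw [← hda] at hm ha h2 ⊢
        have hn := nodeAt_modifyAt_append (isAddr_append.1 ha).1 d f
        rw [leftSpine_append, Bool.and_eq_true] at hm
        obtain ⟨d, j, rfl⟩ := List.eq_nil_or_concat d |>.resolve_left hd
        rw [List.concat_eq_append] at *
        rw [leftSpine_append, Bool.and_eq_true] at hm
        obtain rfl : j = 0 := by simpa using hm.1.2
        rw [modifyAt_concat] at hn
        rw [piLeft_cons, piLeft_cons, h2, hn]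
        simp [tail_modify_zero, values]
    obtain ⟨d, a', hda, hlen⟩ := exists_eq_append (cs := b ++ [0])
      (i := (b ++ [0]).length - a.length) (by omega)
    have hlen' : a'.length = a.length := by
      have : (b ++ [0]).length = d.length + a'.length := by rw [hda, List.length_append]
      omega
    have hm' := hm
    rw [hda, leftSpine_append, Bool.and_eq_true] at hm'
    obtain rfl := leftSpine_ext hm'.2 hal hlen'
    obtain ⟨k1, k2⟩ := key a' d (by rintro rfl; simp at hlen; simp at hlt; omega) hda.symm
    rw [k1, k2]
    rw [hda] at ha
    exact hA.left _ (isAddr_append.1 ha).1 hane hal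

/-- A change below the right child of the root does not concern the root, the left spine, and the
nodes of the right spine above the change. -/
theorem unaffected_right {m : Addr} (hk : Kids μ h true true B₀) (hm : rightSpine B₀ m = true)
    (hne : m ≠ []) (ha : IsAddr B₀ m)
    (hw : Within B₀ B m) (hs : Sized μ (2 * μ) [] B₀) (hA : AggInv B₀) :
    B.agg = piInner B ∧
    (∀ a, IsAddr B a → a ≠ [] → leftSpine a = true → (nodeAt B a).agg = piLeft B a) ∧
    ∀ a, a ≠ [] → rightSpine B a = true → a.length < m.length →
      (nodeAt B a).agg = piRight B a := by
  obtain ⟨f, rfl⟩ := hw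
  have hfull : ∀ j q, IsAddr B₀ (j :: q) → (nodeAt B₀ q).children.length = (nodeAt B₀ q).arity := by
    intro j q hq
    refine (children_length_eq hk hs hq.1 ?_).1
    rw [not_isLeaf_iff]
    intro he
    have := hq.2
    rw [he] at this
    simp at this
  -- the right aggregate of a proper ancestor of the change omits the child in which the change is
  have key : ∀ a d : Addr, d ≠ [] → d ++ a = m →
      (nodeAt (modifyAt B₀ m f) a).agg = (nodeAt B₀ a).agg ∧
      piRight (modifyAt B₀ m f) a = piRight B₀ a := by
    intro a
    induction a with
    | nil => exact fun d hd _ => ⟨modifyAt_agg _ hne _, rfl⟩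
    | cons i q ih =>
      intro d hd hda
      obtain ⟨-, h2⟩ := ih (d ++ [i]) (by simp) (by simpa using hda)
      rw [← hda] at hm ha h2 ⊢
      have hn := nodeAt_modifyAt_append (isAddr_append.1 ha).1 d f
      rw [rightSpine_append, Bool.and_eq_true] at hm
      obtain ⟨d, j, rfl⟩ := List.eq_nil_or_concat d |>.resolve_left hd
      rw [List.concat_eq_append] at *
      rw [rightSpine_append, Bool.and_eq_true] at hm
      have hj : j + 1 = (nodeAt B₀ (i :: q)).arity := by
        have := hm.1.2
        rw [rightSpine_cons] at this
        simpa [nodeAt] using this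
      rw [List.append_assoc, isAddr_append] at ha
      rw [← hfull j (i :: q) ha.1] at hj
      rw [modifyAt_concat] at hn
      rw [piRight_cons, piRight_cons, h2, hn]
      simp [dropLast_modify_last hj, values]
  refine ⟨?_, fun a haB hane hal => ?_, fun a hane har hlt => ?_⟩
  · obtain ⟨b, i, rfl⟩ := List.eq_nil_or_concat m |>.resolve_left hne
    rw [List.concat_eq_append] at *
    rw [isAddr_append] at ha
    rw [rightSpine_append, Bool.and_eq_true] at hm
    have hi : i + 1 = B₀.children.length := by
      have := hm.2
      rw [rightSpine_cons, ← hfull _ _ ha.1] at this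
      simpa [nodeAt] using this
    rw [modifyAt_concat, piInner_eq]
    simp only [tail_dropLast_comm, dropLast_modify_last hi]
    rw [← tail_dropLast_comm]
    exact hA.root.trans (piInner_eq B₀)
  · obtain ⟨b, i, rfl⟩ := List.eq_nil_or_concat m |>.resolve_left hne
    obtain ⟨a, j, rfl⟩ := List.eq_nil_or_concat a |>.resolve_left hane
    rw [List.concat_eq_append, List.concat_eq_append] at *
    rw [isAddr_append] at ha haB
    have hch : (modifyAt B₀ (b ++ [i]) f).children.length = B₀.children.length := by
      rw [modifyAt_concat]; simp
    rw [rightSpine_append, Bool.and_eq_true] at hm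
    have hi : i + 1 = B₀.arity := by
      have := hm.2
      rw [rightSpine_cons] at this
      simpa [nodeAt] using this
    have hj : j = 0 := by
      rw [leftSpine_append, Bool.and_eq_true] at hal
      simpa using hal.2
    have hj' : j < B₀.children.length := by rw [← hch]; exact haB.1.2
    have h2 : 2 ≤ B₀.arity := (hs.2.2 rfl).resolve_right fun h => by simp [h.2] at hj'
    have e : nodeAt (modifyAt B₀ (b ++ [i]) f) [j] = nodeAt B₀ [j] :=
      nodeAt_modifyAt_singleton (by omega) b f
    rw [e] at haB
    rw [nodeAt_concat_eq e, piLeft_concat_eq e]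
    exact hA.left _ (isAddr_append.2 ⟨⟨trivial, hj'⟩, haB.2⟩) (by simp) hal
  · obtain ⟨d, a', hda, hlen⟩ := exists_eq_append (cs := m) (i := m.length - a.length) (by omega)
    have hlen' : a'.length = a.length := by
      have := congrArg List.length hda
      rw [List.length_append] at this
      omega
    have hd : d ≠ [] := by rintro rfl; simp at hlen; omega
    have ha' : IsAddr B₀ a' := by rw [hda] at ha; exact (isAddr_append.1 ha).1
    have har' : rightSpine B₀ a' = true := by
      rw [hda, rightSpine_append, Bool.and_eq_true] at hm; exact hm.2
    obtain ⟨k1, k2⟩ := key a' d hd hda.symm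
    have e : rightSpine (modifyAt B₀ m f) a' = true := by
      rw [hda, rightSpine_modifyAt_append ha', har']
    obtain rfl := rightSpine_ext e har hlen'
    rw [k1, k2]
    exact hA.right _ ha' hane har'

/-- The final repair makes a finger B-tree out of the tree left by the previous phase, if that phase
only changed the subtree at `top`. -/
theorem repairAggs_spec [LinearOrder T] (hB₀ : IsFingerBTree μ B₀) {top : Addr}
    (ha : IsAddr B₀ top) (hw : Within B₀ B top) (hB : StateOK μ μ (2 * μ) B top h) (L R : Bool) :
    (SizeInv μ (repairAggs (B, top, L, R)) ∧ Balanced (repairAggs (B, top, L, R)) ∧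
      AggInv (repairAggs (B, top, L, R))) ∧ (repairAggs (B, top, L, R)).window = B.window := by
  -- `m` is the node from which the repair walks down the spines
  obtain ⟨B₁, m, h₁, e, hm, w₁, hsp, c₁, c₂, c₃, v₁⟩ : ∃ B₁ m h₁,
      (if B.hasAggUp top then B.repairUp top else (B.localRepairAgg top, top)) =
        (B₁.localRepairAgg m, m) ∧ m <:+ top ∧ Within B₀ B₁ m ∧
      (leftSpine m = true ∨ rightSpine B₁ m = true) ∧ CtxOK μ B₁ m h₁ ∧
      Kids μ h₁ (leftSpine m) (rightSpine B₁ m) (nodeAt B₁ m) ∧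
      Sized μ (2 * μ) m (nodeAt B₁ m) ∧ B₁.window = B.window := by
    split_ifs with hup
    · obtain ⟨B', q, h', h1, h2, h3, h4⟩ := repairUp_spec hB hup
      exact ⟨B', q, h', h1, h2, (hw.mono h2).trans h3, h4⟩
    · exact ⟨B, top, h, rfl, List.suffix_rfl, hw, hasAggUp_eq_false_iff.1 (by simpa using hup),
        hB.1, hB.2.1.2, hB.2.2, rfl⟩
  obtain ⟨H, k₁, s₁⟩ := c₁.exists_kids c₂ c₃ hsp
  obtain ⟨⟨H₀, k₀⟩, s₀⟩ := hB₀.exists_kids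
  have ham : IsAddr B₀ m := ha.suffix hm
  have ham₁ : IsAddr B₁ m := c₁.isAddr
  have hup₁ := (invariants_of_kids k₁ s₁).2.2
  obtain ⟨k₂, s₂⟩ := k₁.localRepairAgg s₁ hsp
  have e₂ : (B₁.localRepairAgg m).strip = B₁.strip := strip_localRepairAgg B₁ m
  have hn₂ : ∀ a, a ≠ m → (nodeAt (B₁.localRepairAgg m) a).agg = (nodeAt B₁ a).agg :=
    fun a ha => agg_localRepairAgg_of_ne B₁ ha
  have hm₂ : (nodeAt (B₁.localRepairAgg m) m).agg = B₁.localAgg m := agg_localRepairAgg ham₁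
  -- it remains to repair the spines
  obtain ⟨B₃, eB₃, e₃, hA⟩ : ∃ B₃, repairAggs (B, top, L, R) = B₃ ∧ B₃.strip = B₁.strip ∧
      AggInv B₃ := by
    simp only [repairAggs, e]
    generalize B₁.localRepairAgg m = B₂ at k₂ s₂ e₂ hn₂ hm₂
    have hr₂ := rightSpine_of_strip e₂
    have ham₂ : IsAddr B₂ m := (isAddr_of_strip e₂ m).2 ham₁
    by_cases hm0 : m = []
    · subst hm0
      obtain ⟨B₃, g1, g2, g3, g4⟩ := repairLeft_go_spec H k₂ s₂ (p := []) trivial rfl (by simp)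
        (by omega)
      obtain ⟨k₃, s₃⟩ := k₂.of_strip s₂ g2 fun a _ h1 _ => g3 a (Or.inl h1)
      obtain ⟨B₄, f1, f2, f3, f4⟩ := repairRight_go_spec H k₃ s₃ (p := []) trivial rfl (by simp)
        (by omega)
      have hr₃ := rightSpine_of_strip g2
      refine ⟨B₄, ?_, f2.trans (g2.trans e₂), ?_⟩
      · simp only [leftSpine_nil, Bool.true_or, if_true, rightSpine_nil]
        rw [repairLeft, k₂.height_eq, g1, repairRight, k₃.height_eq, f1]
      · have e41 := f2.trans (g2.trans e₂)
        refine ⟨?_, fun a ha hne hl => ?_, fun a ha hne hr => ?_, fun a ha h1 h2 => ?_⟩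
        · have q1 := f3 [] (Or.inr le_rfl)
          have q2 := g3 [] (Or.inr le_rfl)
          simp only [nodeAt] at q1 q2 hm₂
          rw [q1, q2, hm₂, localAgg_root k₁, piInner_of_strip e41]
        · have ha₁ := (isAddr_of_strip e41 a).1 ha
          have hr := spine_disjoint s₁ ha₁ hne hl
          rw [f3 a (Or.inl (by rw [hr₃, hr₂, hr])),
            g4 a ((isAddr_of_strip e₂ a).2 ha₁) hl (List.length_pos_iff.2 hne),
            piLeft_of_strip e41, piLeft_of_strip e₂]
        · rw [rightSpine_of_strip f2] at hr
          rw [f4 a ((isAddr_of_strip f2 a).1 ha) hr (List.length_pos_iff.2 hne),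
            piRight_of_strip f2]
        · have ha₁ := (isAddr_of_strip e41 a).1 ha
          rw [rightSpine_of_strip e41] at h2
          rw [f3 a (Or.inl (by rw [hr₃, hr₂, h2])), g3 a (Or.inl h1),
            hn₂ a (by rintro rfl; simp at h1), piUp_of_strip e41]
          exact hup₁ a ha₁ h1 h2
    · obtain ⟨i, q, rfl⟩ := List.exists_cons_of_ne_nil hm0
      by_cases hml : leftSpine (i :: q) = true
      · obtain ⟨u1, u2, u3⟩ := unaffected_left hml hm0 ham w₁ s₀ hB₀.aggs
        have hmr := spine_disjoint s₁ ham₁ hm0 hml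
        have hmq : leftSpine q = true := by
          rw [leftSpine_cons, Bool.and_eq_true] at hml; exact hml.2
        have hloc : B₁.localAgg (i :: q) = piLeft B₁ (i :: q) :=
          localAgg_left k₁ s₁ ham₁ hml fun hq => u3 q hq hmq (by simp)
        obtain ⟨B₃, g1, g2, g3, g4⟩ := repairLeft_go_spec H k₂ s₂ ham₂ hml
          (fun _ => by rw [hm₂, hloc, piLeft_of_strip e₂]) (by omega)
        have e31 := g2.trans e₂
        refine ⟨B₃, ?_, e31, ?_⟩
        · simp only [hml, Bool.true_or, if_true]
          rw [repairLeft, k₂.height_eq, g1, rightSpine_of_strip e31, hmr]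
          simp
        · refine ⟨?_, fun a ha hne hl => ?_, fun a ha hne hr => ?_, fun a ha h1 h2 => ?_⟩
          · have q1 := g3 [] (Or.inr (by simp))
            have q2 := hn₂ [] (by simp)
            simp only [nodeAt] at q1 q2
            rw [q1, q2, u1, piInner_of_strip e31]
          · have ha₁ := (isAddr_of_strip e31 a).1 ha
            rw [piLeft_of_strip e31]
            rcases lt_trichotomy a.length (i :: q).length with hlt | heq | hgt
            · rw [g3 a (Or.inr hlt.le), hn₂ a (by rintro rfl; omega), u3 a hne hl hlt]
            · obtain rfl := leftSpine_ext hl hml heq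
              rw [g3 _ (Or.inr le_rfl), hm₂, hloc]
            · rw [g4 a ((isAddr_of_strip e₂ a).2 ha₁) hl hgt, piLeft_of_strip e₂]
          · have ha₁ := (isAddr_of_strip e31 a).1 ha
            rw [rightSpine_of_strip e31] at hr
            have hl : leftSpine a = false := by
              by_contra hc
              rw [spine_disjoint s₁ ha₁ hne (by simpa using hc)] at hr
              simp at hr
            rw [g3 a (Or.inl hl), hn₂ a (by rintro rfl; simp [hml] at hl), u2 a ha₁ hne hr,
              piRight_of_strip e31]
          · have ha₁ := (isAddr_of_strip e31 a).1 ha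
            rw [rightSpine_of_strip e31] at h2
            rw [g3 a (Or.inl h1), hn₂ a (by rintro rfl; simp [hml] at h1), piUp_of_strip e31]
            exact hup₁ a ha₁ h1 h2
      · have hmr : rightSpine B₁ (i :: q) = true := hsp.resolve_left hml
        rw [Bool.not_eq_true] at hml
        have hmr₀ : rightSpine B₀ (i :: q) = true := by
          obtain ⟨f, rfl⟩ := w₁
          rwa [rightSpine_modifyAt ham] at hmr
        obtain ⟨u1, u2, u3⟩ := unaffected_right k₀ hmr₀ hm0 ham w₁ s₀ hB₀.aggs
        have hmq : rightSpine B₁ q = true := by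
          rw [rightSpine_cons, Bool.and_eq_true] at hmr; exact hmr.2
        have hloc : B₁.localAgg (i :: q) = piRight B₁ (i :: q) :=
          localAgg_right k₁ s₁ ham₁ hmr fun hq => u3 q hq hmq (by simp)
        obtain ⟨B₃, g1, g2, g3, g4⟩ := repairRight_go_spec H k₂ s₂ ham₂ (by rw [hr₂, hmr])
          (fun _ => by rw [hm₂, hloc, piRight_of_strip e₂]) (by omega)
        have e31 := g2.trans e₂
        refine ⟨B₃, ?_, e31, ?_⟩
        · simpa [hml, hr₂, hmr, repairRight, k₂.height_eq] using g1
        · refine ⟨?_, fun a ha hne hl => ?_, fun a ha hne hr => ?_, fun a ha h1 h2 => ?_⟩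
          · have q1 := g3 [] (Or.inr (by simp))
            have q2 := hn₂ [] (by simp)
            simp only [nodeAt] at q1 q2
            rw [q1, q2, u1, piInner_of_strip e31]
          · have ha₁ := (isAddr_of_strip e31 a).1 ha
            have hr := spine_disjoint s₁ ha₁ hne hl
            rw [g3 a (Or.inl (by rw [hr₂, hr])), hn₂ a (by rintro rfl; simp [hl] at hml),
              u2 a ha₁ hne hl, piLeft_of_strip e31]
          · have ha₁ := (isAddr_of_strip e31 a).1 ha
            rw [rightSpine_of_strip e31] at hr
            rw [piRight_of_strip e31]
            rcases lt_trichotomy a.length (i :: q).length with hlt | heq | hgt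
            · rw [g3 a (Or.inr hlt.le), hn₂ a (by rintro rfl; omega), u3 a hne hr hlt]
            · obtain rfl := rightSpine_ext hr hmr heq
              rw [g3 _ (Or.inr le_rfl), hm₂, hloc]
            · rw [g4 a ((isAddr_of_strip e₂ a).2 ha₁) (by rw [hr₂, hr]) hgt,
                piRight_of_strip e₂]
          · have ha₁ := (isAddr_of_strip e31 a).1 ha
            rw [rightSpine_of_strip e31] at h2
            rw [g3 a (Or.inl (by rw [hr₂, h2])), hn₂ a (by rintro rfl; simp [hmr] at h2),
              piUp_of_strip e31]
            exact hup₁ a ha₁ h1 h2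
  rw [eB₃]
  obtain ⟨k₃, s₃⟩ := k₁.of_strip s₁ e₃ fun a ha h1 h2 => by
    rw [hA.up a ((isAddr_of_strip e₃ a).2 ha) h1 (by rwa [rightSpine_of_strip e₃]),
      hup₁ a ha h1 h2, piUp_of_strip e₃]
  obtain ⟨i1, i2, -⟩ := invariants_of_kids k₃ s₃
  exact ⟨⟨i1, i2, hA⟩, (window_of_strip e₃).trans v₁⟩

end FinalRepair

/-! ### Query -/

section Query

variable {T S : Type*} [Monoid S] {μ h : ℕ} {B : Node T S}

theorem prod_map_aggregate (ws : List (List (T × S))) :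
    (ws.map aggregate).prod = aggregate ws.flatten := by
  induction ws with
  | nil => rfl
  | cons w ws ih => simp_all [aggregate]

mutual
theorem piUp_eq_aggregate : ∀ x : Node T S, x.piUp = aggregate x.window
  | ⟨_, es, cs⟩ => by
    have h : es.map Prod.snd = (es.map fun e => [e]).map aggregate := by simp [aggregate]
    rw [piUp, window, piUps_eq_aggregate cs, h, ← map_alternate, prod_map_aggregate]
theorem piUps_eq_aggregate : ∀ cs : List (Node T S), piUps cs = (windows cs).map aggregate
  | [] => rfl
  | c :: cs => by rw [piUps, windows, piUp_eq_aggregate c, piUps_eq_aggregate cs]; rfl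
end

theorem piUp_eq_head (x : Node T S) : x.piUp = (x.children.head?.map piUp).getD 1 *
    (alternate x.values (x.children.tail.map piUp)).prod := by
  rw [piUp_eq]
  cases x.children with
  | nil => simp
  | cons c cs => simp [alternate_cons]

theorem piUp_eq_last {x : Node T S} (hx : x.children = [] ∨ x.children.length = x.arity) :
    x.piUp = (alternate (x.children.dropLast.map piUp) x.values).prod *
      (x.children.getLast?.map piUp).getD 1 := by
  rw [piUp_eq]
  rcases List.eq_nil_or_concat x.children with e | ⟨C, c, e⟩
  · simp [e]
  · rw [List.concat_eq_append] at e
    rw [e] at hx ⊢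
    have hl : (C.map piUp).length = x.values.length := by
      rcases hx with hx | hx
      · simp at hx
      · simpa [arity, values] using hx
    have := alternate_append hl [c.piUp] []
    rw [List.append_nil] at this
    rw [List.map_append, List.map_singleton, this]
    simp

/-- Going down the left spine, the left aggregate lacks only what is below the first child. -/
theorem piUp_left (b : Addr) (hb : leftSpine b = true) (hp : IsAddr B (b ++ [0])) :
    (nodeAt B [0]).piUp = ((nodeAt B (b ++ [0])).children.head?.map piUp).getD 1 *
      piLeft B (b ++ [0]) := by
  induction b with
  | nil =>
    rw [List.nil_append, piLeft_cons, piUp_eq_head]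
    simp [piLeft]
  | cons i q ih =>
    rw [leftSpine_cons, Bool.and_eq_true, beq_iff_eq] at hb
    obtain ⟨rfl, hb⟩ := hb
    obtain ⟨hp1, hp2⟩ : IsAddr B (q ++ [0]) ∧ 0 < (nodeAt B (q ++ [0])).children.length := by
      rw [List.cons_append, IsAddr] at hp; exact hp
    have hn : nodeAt B (0 :: q ++ [0]) = (nodeAt B (q ++ [0])).children.getD 0 empty := rfl
    rw [ih hb hp1, List.cons_append, piLeft_cons, ← mul_assoc, ← piUp_eq_head,
      ← List.cons_append, hn]
    obtain ⟨c, cs, e⟩ := List.exists_cons_of_length_pos hp2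
    simp [e]

/-- Going down the right spine, the right aggregate lacks only what is below the last child. -/
theorem piUp_right (hfull : ∀ p, IsAddr B p → (nodeAt B p).children = [] ∨
      (nodeAt B p).children.length = (nodeAt B p).arity) {j : ℕ} (b : Addr)
    (hb : rightSpine (nodeAt B [j]) b = true) (hp : IsAddr B (b ++ [j])) :
    (nodeAt B [j]).piUp = piRight B (b ++ [j]) *
      ((nodeAt B (b ++ [j])).children.getLast?.map piUp).getD 1 := by
  induction b with
  | nil =>
    rw [List.nil_append] at hp ⊢
    rw [piRight_cons, piUp_eq_last (hfull _ hp)]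
    simp [piRight]
  | cons i q ih =>
    rw [rightSpine_cons, Bool.and_eq_true, beq_iff_eq, ← nodeAt_append] at hb
    obtain ⟨hi, hb⟩ := hb
    have hp' := hp
    rw [List.cons_append, IsAddr] at hp'
    obtain ⟨hp1, hp2⟩ := hp'
    have hn : nodeAt B (i :: (q ++ [j])) = (nodeAt B (q ++ [j])).children.getD i empty := rfl
    rw [List.cons_append] at hp ⊢
    rw [ih hb hp1, piRight_cons, mul_assoc, ← piUp_eq_last (hfull _ hp), hn]
    have hl := (hfull _ hp1).resolve_left (by intro e; rw [e] at hp2; simp at hp2)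
    rw [List.getLast?_eq_getElem?]
    have : (nodeAt B (q ++ [j])).children.length - 1 = i := by omega
    rw [this, List.getD_eq_getElem?_getD, List.getElem?_eq_getElem hp2]
    rfl

theorem query_eq [LinearOrder T] (hB : IsFingerBTree μ B) : B.query = aggregate B.window := by
  obtain ⟨⟨h, hk⟩, hs⟩ := hB.exists_kids
  rw [query, ← piUp_eq_aggregate]
  split
  · rename_i hl
    rw [isLeaf_iff] at hl
    rw [hB.aggs.root, piInner, piUp_eq, hl]
    simp [piUps]
  · rename_i hl
    have hfull : ∀ p, IsAddr B p → (nodeAt B p).children = [] ∨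
        (nodeAt B p).children.length = (nodeAt B p).arity := by
      intro p hp
      by_cases hl : (nodeAt B p).isLeaf = true
      · exact Or.inl (isLeaf_iff.1 hl)
      · exact Or.inr (children_length_eq hk hs hp (by simpa using hl)).1
    have hne : B.children ≠ [] := by rw [← not_isLeaf_iff]; simpa using hl
    have hlen : B.children.length = B.arity := (hfull [] trivial).resolve_left hne
    have h2 : 2 ≤ B.arity := (hs.2.2 rfl).resolve_right fun h => hne h.2
    obtain ⟨b, b1, b2, b3, b4⟩ := leftmostLeaf_spec hk hs (p := []) trivial
    obtain ⟨c, c1, c2, c3, c4⟩ := rightmostLeaf_spec hk hs (p := []) trivial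
    rw [List.append_nil] at *
    have hb : b ≠ [] := by rintro rfl; exact hl b4
    have hc : c ≠ [] := by rintro rfl; exact hl c4
    rw [leftFinger, rightFinger, b1, c1, hB.aggs.left b b3 hb b2, hB.aggs.right c c3 hc c2,
      hB.aggs.root]
    obtain ⟨b, i, rfl⟩ := List.eq_nil_or_concat b |>.resolve_left hb
    obtain ⟨c, j, rfl⟩ := List.eq_nil_or_concat c |>.resolve_left hc
    simp only [List.concat_eq_append] at *
    rw [isLeaf_iff] at b4 c4
    rw [leftSpine_append, Bool.and_eq_true] at b2
    rw [rightSpine_append, Bool.and_eq_true] at c2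
    obtain rfl : i = 0 := by simpa using b2.2
    have hj : j + 1 = B.arity := by
      have := c2.2
      rw [rightSpine_cons] at this
      simpa [nodeAt] using this
    have hL := piUp_left b b2.1 b3
    have hR := piUp_right hfull c c2.1 c3
    rw [b4] at hL
    rw [c4] at hR
    simp only [List.head?_nil, List.getLast?_nil, Option.map_none, Option.getD_none, one_mul,
      mul_one] at hL hR
    rw [← hL, ← hR]
    obtain ⟨z, zs, e⟩ := List.exists_cons_of_ne_nil hne
    obtain ⟨C, d, e'⟩ : ∃ C d, zs = C ++ [d] := by
      rcases List.eq_nil_or_concat zs with rfl | ⟨C, d, h⟩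
      · rw [e] at hlen; simp at hlen; omega
      · exact ⟨C, d, by rw [h, List.concat_eq_append]⟩
    subst e'
    have hj' : j = C.length + 1 := by rw [e] at hlen; simp at hlen; omega
    have hvl : B.values.length = (C.map piUp).length + 1 := by
      rw [e, arity] at hlen; simp [values] at hlen ⊢; omega
    have n0 : nodeAt B [0] = z := by simp [nodeAt, e]
    have nj : nodeAt B [j] = d := by simp [nodeAt, e, hj']
    rw [n0, nj, piUp_eq B, piInner_eq, e, List.map_cons, alternate_cons]
    obtain ⟨v, vs, ev⟩ := List.exists_cons_of_length_pos (l := B.values) (by omega)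
    rw [ev] at hvl ⊢
    have := alternate_append (xs := C.map piUp) (ys := vs) (by simpa using hvl.symm) [d.piUp] []
    rw [List.append_nil] at this
    simp only [List.tail_cons, List.dropLast_concat, List.map_append, List.map_singleton,
      alternate_cons, this]
    simp [mul_assoc]

end Query

/-! ### Insert and evict -/

section Updates

variable {T S : Type*} [Monoid S] {μ h : ℕ} {B : Node T S}

/-- Replacing the node at `p` and up-repairing it. -/
theorem StateOK.of_replace {m M : ℕ} {p : Addr} (hc : CtxOK μ B p h) {y : Node T S}
    (hk : Kids μ h (leftSpine p) (rightSpine B p) y) (hs : Sized m M p y) :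
    StateOK μ m M ((modifyAt B p fun _ => y).localRepairAggIfUp p) p h ∧
      Within B ((modifyAt B p fun _ => y).localRepairAggIfUp p) p ∧
      ((modifyAt B p fun _ => y).localRepairAggIfUp p).window =
        before B p ++ y.window ++ after B p := by
  rw [localRepairAggIfUp_self hc.isAddr]
  refine ⟨StateOK.replace hc hk.good_fixUp ?_, within_modifyAt _ _ _, ?_⟩
  · rw [Sized, fixUp_arity, fixUp_entries, fixUp_children]
    exact hs
  · rw [window_modifyAt hc.pathOK, fixUp_window]

theorem rebalanceForEvict_spec (hμ : 2 ≤ μ) (pick : Node T S → Addr → Bool)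
    (toRepair : Option Addr) {p : Addr} (hB : StateOK μ (μ - 1) (2 * μ) B p h) :
    ∃ B' top L' R' h', rebalanceForEvict μ pick B p toRepair = (B', top, L', R') ∧ top <:+ p ∧
      Within B B' top ∧ StateOK μ μ (2 * μ) B' top h' ∧ B'.window = B.window := by
  unfold rebalanceForEvict
  by_cases hr : toRepair = some p
  · obtain ⟨B', top, L', R', h', e, e0, e1, e2, e3⟩ := evictLoop_spec hμ pick toRepair
      (leftSpine p) (rightSpine B p) hB.localRepairAggIfUp
    refine ⟨B', top, L', R', h', ?_, e0, ((within_localRepairAggIfUp B p).mono e0).trans e1, e2,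
      e3.trans (window_localRepairAggIfUp hB.1.pathOK)⟩
    simp only [hr, if_true]
    rw [hr] at e
    exact e
  · obtain ⟨B', top, L', R', h', e⟩ := evictLoop_spec hμ pick toRepair
      (leftSpine p) (rightSpine B p) hB
    refine ⟨B', top, L', R', h', ?_⟩
    simp only [hr, if_false]
    exact e

theorem pathOK_append {b a : Addr} :
    PathOK B (b ++ a) ↔ PathOK B a ∧ PathOK (nodeAt B a) b := by
  induction b with
  | nil => simp [PathOK]
  | cons i b ih => simp [PathOK, ih, nodeAt_append, and_assoc]

variable [LinearOrder T]

theorem sorted_window_of_pathOK {p : Addr} (hB : Sorted B.window) (hp : PathOK B p) :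
    Sorted (nodeAt B p).window := by
  rw [window_eq hp] at hB
  exact (List.pairwise_append.1 (List.pairwise_append.1 hB).1).2.1

/-- Inserting into the entries of the node found by the search amounts to inserting into its window;
an inner node does not become larger, since it contains `t` already. -/
theorem window_insertEntry {x : Node T S} {t : T} (v : S) (hx : Sorted x.window)
    (ht : x.isLeaf = true ∨ x.hasTime t = true) :
    window ⟨x.agg, insertEntry t v x.entries, x.children⟩ = insertEntry t v x.window ∧
      (x.isLeaf = false → (insertEntry t v x.entries).length = x.entries.length) := by
  by_cases hl : x.isLeaf = true
  · rw [isLeaf_iff] at hl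
    simp [window_eq_weave, hl, isLeaf]
  · obtain ⟨⟨s, w⟩, he, hs⟩ := List.any_eq_true.1 (ht.resolve_left hl)
    obtain rfl : s = t := by simpa using hs
    obtain ⟨E, F, hEF⟩ := List.append_of_mem he
    have h1 := sorted_entries hx
    obtain ⟨P, Q, hPQ⟩ := exists_weave_entry x.children E F
    rw [window_eq_weave, hEF, hPQ] at hx
    rw [hEF] at h1
    rw [window_eq_weave, window_eq_weave x, hEF, hPQ, insertEntry_append_cons hx,
      insertEntry_append_cons h1]
    exact ⟨hPQ _, fun _ => by simp⟩

theorem insert_spec (hμ : 2 ≤ μ) (hB : IsFingerBTree μ B) (t : T) (v : S) :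
    IsFingerBTree μ (B.insert μ t v) ∧ (B.insert μ t v).window = insertEntry t v B.window := by
  obtain ⟨⟨H, hk⟩, hs⟩ := hB.exists_kids
  have hsort : Sorted B.window := hB.ordered
  obtain ⟨p, hp, ha, hf, ht⟩ := searchNode_spec hk hs hsort t
  obtain ⟨k, -, c1, c2, c3⟩ := loc_of_isAddr hk hs ha
  have hxs := sorted_window_of_pathOK hsort c1.pathOK
  obtain ⟨w1, w2⟩ := window_insertEntry v hxs ht
  obtain ⟨l1, l2, l3⟩ := length_le_length_insertEntry t v (nodeAt B p).entries
  have e : B.localInsertTimeAndValue p t v = (modifyAt B p fun _ =>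
      ⟨(nodeAt B p).agg, insertEntry t v (nodeAt B p).entries,
        (nodeAt B p).children⟩).localRepairAggIfUp p := by
    rw [localInsertTimeAndValue]
    congr 1
    exact modifyAt_congr rfl
  obtain ⟨s1, s2, s3⟩ := StateOK.of_replace (m := μ) (M := 2 * μ + 1) c1
    (y := ⟨(nodeAt B p).agg, insertEntry t v (nodeAt B p).entries, (nodeAt B p).children⟩)
    (by
      cases k with
      | zero => exact c2.2
      | succ k =>
        refine c2.2.congr rfl (w2 ?_)
        by_contra hc
        have := c2.2.eq_zero_iff.2 (by simpa using hc)
        omega)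
    (by
      refine ⟨fun hne => ?_, ?_, fun _ => Or.inl ?_⟩
      · have := c3.1 hne; rw [arity] at this ⊢; simp only; omega
      · have := c3.2.1; rw [arity] at this ⊢; simp only; omega
      · rw [arity]; simp only; omega)
  rw [← e] at s1 s2 s3
  obtain ⟨B', top, L', R', h', q1, q2, q3, q4, q5⟩ := insertLoop_spec hμ (leftSpine p)
    (rightSpine (B.localInsertTimeAndValue p t v) p) s1
  obtain ⟨⟨r1, r2, r3⟩, r4⟩ := repairAggs_spec hB (ha.suffix q2) ((s2.mono q2).trans q3) q4 L' R'
  have hins : B.insert μ t v = repairAggs (B', top, L', R') := by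
    rw [insert, hp, rebalanceForInsert, q1]
  have hw : (B.insert μ t v).window = insertEntry t v B.window := by
    rw [hins, r4, q5, s3, window_eq c1.pathOK, w1, List.append_assoc, List.append_assoc,
      insertEntry_append_left hf.1, insertEntry_append_right hf.2]
  refine ⟨⟨?_, ?_, ?_, ?_⟩, hw⟩
  · rw [hins]; exact r1
  · rw [hins]; exact r2
  · rw [Ordered, hw]; exact insertEntry_sorted hsort
  · rw [hins]; exact r3

/-- In `evictInner`, the leaf at `d ++ p` loses the substitute `e`, which is written into the slot
`idx` of its ancestor at `p`. -/
theorem evictInner_prepare (hμ : 2 ≤ μ) {p d : Addr} {k idx : ℕ} {e : T × S} (hd : d ≠ [])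
    (c1 : CtxOK μ B p k) (c2 : Kids μ k (leftSpine p) (rightSpine B p) (nodeAt B p))
    (c3 : Sized μ (2 * μ) p (nodeAt B p)) (hne : (nodeAt B p).children ≠ [])
    (ha : IsAddr B (d ++ p)) (hl : (nodeAt B (d ++ p)).isLeaf = true)
    (he : (nodeAt B (d ++ p)).entries.length =
      (evictEntry e.1 (nodeAt B (d ++ p)).entries).length + 1) :
    ∃ B' g, (B.localEvictTimeAndValue (d ++ p) e.1).setTimeAndValue p idx e = B' ∧
      StateOK μ (μ - 1) (2 * μ) B' (d ++ p) 0 ∧ Within B B' p ∧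
      (∀ y, (g y).window = window ⟨y.agg, evictEntry e.1 y.entries, y.children⟩) ∧
      B'.window = before B p ++ (modifyAt ⟨(nodeAt B p).agg, (nodeAt B p).entries.set idx e,
        (nodeAt B p).children⟩ d g).window ++ after B p := by
  obtain ⟨d, i, rfl⟩ := List.eq_nil_or_concat d |>.resolve_left hd
  simp only [List.concat_eq_append] at *
  set f : Node T S → Node T S := fun x => { x with entries := evictEntry e.1 x.entries } with hf
  set s : Node T S → Node T S := fun x => { x with entries := x.entries.set idx e } with hs
  set g : Node T S → Node T S := fun x =>
    fixUp (leftSpine (d ++ [i] ++ p)) (rightSpine B (d ++ [i] ++ p)) (f x) with hg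
  have hap : IsAddr B p := c1.isAddr
  -- the two changes commute, because overwriting an entry does not affect the children
  have hcomm : ∀ x, s (modifyAt x (d ++ [i]) g) = modifyAt (s x) (d ++ [i]) g := by
    intro x
    rw [modifyAt_concat, modifyAt_concat]
  have e1 : (B.localEvictTimeAndValue (d ++ [i] ++ p) e.1).setTimeAndValue p idx e =
      modifyAt (modifyAt B p s) (d ++ [i] ++ p) g := by
    rw [localEvictTimeAndValue, setTimeAndValue, localRepairAggIfUp_eq, modifyAt_modifyAt,
      rightSpine_modifyAt ha]
    rw [modifyAt_append B, modifyAt_append (modifyAt B p s), modifyAt_modifyAt, modifyAt_modifyAt]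
    exact congrArg _ (funext hcomm)
  set B₁ := modifyAt B p s with hB₁
  have hn₁ : nodeAt B₁ p = s (nodeAt B p) := nodeAt_modifyAt hap s
  have hchild : nodeAt (s (nodeAt B p)) [i] = nodeAt (nodeAt B p) [i] := rfl
  have hleafn : nodeAt B₁ (d ++ [i] ++ p) = nodeAt B (d ++ [i] ++ p) := by
    rw [nodeAt_append, hn₁, nodeAt_append, hchild, nodeAt_append B, nodeAt_append]
  have hleafa : IsAddr B₁ (d ++ [i] ++ p) := by
    rw [isAddr_append, isAddr_append, hn₁, hchild]
    rw [isAddr_append, isAddr_append] at ha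
    exact ⟨hap.modifyAt s, ha.2⟩
  have hr₁ : rightSpine B₁ p = rightSpine B p := rightSpine_modifyAt hap s
  have hleafr : rightSpine B₁ (d ++ [i] ++ p) = rightSpine B (d ++ [i] ++ p) := by
    rw [rightSpine_append, hn₁, rightSpine_append, hchild, rightSpine_append B, hr₁,
      rightSpine_append (nodeAt B p)]
    simp only [rightSpine_cons, rightSpine_nil, nodeAt, hs, arity, List.length_set]
  have k1 : Kids μ k (leftSpine p) (rightSpine B₁ p) (nodeAt B₁ p) := by
    rw [hn₁, hr₁]
    exact c2.congr rfl (by simp [hs])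
  have k2 : Sized μ (2 * μ) p (nodeAt B₁ p) := by
    rw [hn₁]
    refine ⟨fun h => ?_, ?_, fun h => Or.inl ?_⟩
    · simpa [hs, arity] using c3.1 h
    · simpa [hs, arity] using c3.2.1
    · simpa [hs, arity, hne] using c3.2.2 h
  obtain ⟨m, -, m1, m2⟩ := CtxOK.descend_append (c1.modifyAt s) k1 k2 hleafa (by simp)
  obtain rfl := m2.2.2.eq_zero_iff.2 (by rw [hleafn]; exact hl)
  obtain ⟨s1, s2, s3⟩ := StateOK.of_replace (m := μ - 1) (M := 2 * μ) m1
    (y := f (nodeAt B (d ++ [i] ++ p)))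
    (isLeaf_iff.1 hl) (by
      have h1 := m2.1
      rw [hleafn] at h1
      simp only [arity] at h1
      refine ⟨fun _ => ?_, ?_, by simp⟩ <;> simp only [hf, arity] <;> omega)
  have e2 : modifyAt B₁ (d ++ [i] ++ p) g =
      (modifyAt B₁ (d ++ [i] ++ p) fun _ => f (nodeAt B (d ++ [i] ++ p))).localRepairAggIfUp
        (d ++ [i] ++ p) := by
    rw [localRepairAggIfUp_self hleafa, hleafr]
    apply modifyAt_congr
    rw [hleafn]
  refine ⟨_, g, e1, ?_, ?_, fun y => ?_, ?_⟩
  · rw [e2]; exact s1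
  · exact (within_modifyAt B p s).trans ((within_modifyAt _ _ _).mono (List.suffix_append _ _))
  · simp only [hg, fixUp_window, hf]
  · rw [modifyAt_append, modifyAt_modifyAt, window_modifyAt c1.pathOK]

/-- Evicting an entry of an inner node, up to the final repair. -/
theorem evictInner_spec (hμ : 2 ≤ μ) (pick : Node T S → Addr → Bool) {H : ℕ}
    (hk : Kids μ H true true B) (hs : Sized μ (2 * μ) [] B) (hsort : Sorted B.window) {p : Addr}
    (ha : IsAddr B p) (hl : (nodeAt B p).isLeaf = false) {E F : List (T × S)} {e₀ : T × S}
    (hEF : (nodeAt B p).entries = E ++ e₀ :: F) :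
    ∃ B' top L' R' h', B.evictInner μ pick p E.length = (B', top, L', R') ∧ top <:+ p ∧
      Within B B' top ∧ StateOK μ μ (2 * μ) B' top h' ∧
      B'.window = evictEntry e₀.1 B.window := by
  obtain ⟨k, -, c1, c2, c3⟩ := loc_of_isAddr hk hs ha
  have hlen := (children_length_eq hk hs ha hl).1
  have hne := not_isLeaf_iff.1 hl
  have hfull : ∀ j q, IsAddr B (j :: q) → (nodeAt B q).children.length = (nodeAt B q).arity := by
    intro j q hq
    refine (children_length_eq hk hs hq.1 ?_).1
    rw [not_isLeaf_iff]
    intro he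
    have := hq.2
    rw [he] at this
    simp at this
  obtain ⟨a, zl, b, hab, haE⟩ := exists_eq_append_cons (cs := (nodeAt B p).children)
    (i := E.length) (by rw [hlen, arity, hEF]; simp)
  obtain ⟨zr, b, rfl⟩ : ∃ zr b', b = zr :: b' :=
    List.exists_cons_of_length_pos (by
      rw [hab, arity, hEF] at hlen; simp at hlen; omega)
  have hab' : (nodeAt B p).children = (a ++ [zl]) ++ zr :: b := by simp [hab]
  have nl : nodeAt B (E.length :: p) = zl := by rw [← haE]; exact nodeAt_cons hab
  have nr : nodeAt B ((E.length + 1) :: p) = zr := by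
    simpa [haE] using nodeAt_cons hab'
  have al : IsAddr B (E.length :: p) := ⟨ha, by rw [hab]; simp; omega⟩
  have ar : IsAddr B ((E.length + 1) :: p) := ⟨ha, by rw [hab]; simp; omega⟩
  have hw0 : (nodeAt B p).window = (weave a E ++ zl.window) ++ e₀ :: (zr.window ++ weave' F b) := by
    rw [window_eq_weave, hab, hEF, weave_append haE]
    simp
  -- the leaf, the substitute `e`, and the window of `p` after the exchange
  obtain ⟨d, e, hd, hleaf, hsub, hda, hdl, hent, hwin⟩ : ∃ d e, d ≠ [] ∧
      (if μ < (nodeAt B ((E.length + 1) :: p)).arity then B.leftmostLeaf ((E.length + 1) :: p)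
        else B.rightmostLeaf (E.length :: p)) = d ++ p ∧
      (if μ < (nodeAt B ((E.length + 1) :: p)).arity then (nodeAt B (d ++ p)).entries.head?
        else (nodeAt B (d ++ p)).entries.getLast?) = some e ∧
      IsAddr B (d ++ p) ∧ (nodeAt B (d ++ p)).isLeaf = true ∧
      (nodeAt B (d ++ p)).entries.length =
        (evictEntry e.1 (nodeAt B (d ++ p)).entries).length + 1 ∧
      ∀ g : Node T S → Node T S,
        (∀ y, (g y).window = window ⟨y.agg, evictEntry e.1 y.entries, y.children⟩) →
        (modifyAt ⟨(nodeAt B p).agg, (nodeAt B p).entries.set E.length e,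
          (nodeAt B p).children⟩ d g).window =
        (weave a E ++ zl.window) ++ (zr.window ++ weave' F b) := by
    have hset : ∀ e, (nodeAt B p).entries.set E.length e = E ++ e :: F := by
      intro e; rw [hEF]; simp
    by_cases hμr : μ < (nodeAt B ((E.length + 1) :: p)).arity
    · obtain ⟨d, d1, d2, d3, d4⟩ := leftmostLeaf_spec hk hs ar
      have ed : d ++ (E.length + 1) :: p = (d ++ [E.length + 1]) ++ p := by simp
      obtain ⟨m, -, m1, m2, m3⟩ := loc_of_isAddr hk hs d3
      have hpath := pathOK_append.1 m1.pathOK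
      rw [nr] at hpath
      have hlw := sorted_window_of_pathOK hsort m1.pathOK
      have h2 : 2 ≤ (nodeAt B (d ++ (E.length + 1) :: p)).arity := hμ.trans (m3.1 (by simp))
      obtain ⟨e, G, hG⟩ := List.exists_cons_of_length_pos
        (l := (nodeAt B (d ++ (E.length + 1) :: p)).entries) (by rw [arity] at h2; omega)
      have hse := sorted_entries hlw
      have hevict : evictEntry e.1 (e :: G) = G := by
        rw [hG] at hse
        exact evictEntry_append_cons (P := []) hse
      have hwl : zr.window = e :: (G ++ after zr d) := by
        rw [window_eq hpath.2, before_eq_nil d2, ← nr, ← nodeAt_append, window_eq_weave, hG,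
          isLeaf_iff.1 d4]
        simp
      rw [ed] at d1 d3 d4 hG
      refine ⟨d ++ [E.length + 1], e, by simp, ?_, ?_, d3, d4, ?_, fun g hg => ?_⟩
      · rw [if_pos hμr, d1]
      · rw [if_pos hμr, hG]; rfl
      · rw [hG, hevict]; rfl
      · have hzr : (modifyAt zr d g).window = G ++ after zr d := by
          rw [window_modifyAt hpath.2, hg, before_eq_nil d2, ← nr, ← nodeAt_append, ed, hG, hevict,
            window_eq_weave, isLeaf_iff.1 d4]
          simp
        have hmod : (nodeAt B p).children.modify (E.length + 1) (fun c => modifyAt c d g) =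
            a ++ zl :: modifyAt zr d g :: b := by
          rw [hab, ← haE, modify_append_cons_cons]
        rw [hset, modifyAt_concat, window_eq_weave]
        simp only [hmod]
        rw [weave_append haE]
        simp [hzr, hwl]
    · obtain ⟨d, d1, d2, d3, d4⟩ := rightmostLeaf_spec hk hs al
      have ed : d ++ E.length :: p = (d ++ [E.length]) ++ p := by simp
      obtain ⟨m, -, m1, m2, m3⟩ := loc_of_isAddr hk hs d3
      have hpath := pathOK_append.1 m1.pathOK
      have d3' := (isAddr_append.1 d3).2
      rw [nl] at hpath d2 d3'
      have haft : after zl d = [] := by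
        refine after_eq_nil hpath.2 (fun q hq hqne => ?_) d2
        obtain ⟨b', rfl⟩ := hq
        obtain ⟨b', j, rfl⟩ := List.eq_nil_or_concat b' |>.resolve_left (by
          rintro rfl; exact hqne rfl)
        rw [List.concat_eq_append, List.append_assoc, List.append_assoc] at d3
        have := hfull j _ (isAddr_append.1 d3).1
        rwa [List.append_eq, List.nil_append, nodeAt_append, nl] at this
      have hlw := sorted_window_of_pathOK hsort m1.pathOK
      have h2 : 2 ≤ (nodeAt B (d ++ E.length :: p)).arity := hμ.trans (m3.1 (by simp))
      obtain ⟨G, e, hG⟩ : ∃ G e, (nodeAt B (d ++ E.length :: p)).entries = G ++ [e] := by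
        rcases List.eq_nil_or_concat (nodeAt B (d ++ E.length :: p)).entries with h | ⟨G, g, h⟩
        · rw [arity, h] at h2; simp at h2
        · exact ⟨G, g, by rw [h, List.concat_eq_append]⟩
      have hse := sorted_entries hlw
      have hevict : evictEntry e.1 (G ++ [e]) = G := by
        rw [hG] at hse
        simpa using evictEntry_append_cons hse
      have hwl : zl.window = before zl d ++ G ++ [e] := by
        rw [window_eq hpath.2, haft, ← nl, ← nodeAt_append, window_eq_weave, hG,
          isLeaf_iff.1 d4]
        simp
      rw [ed] at d1 d3 d4 hG
      refine ⟨d ++ [E.length], e, by simp, ?_, ?_, d3, d4, ?_, fun g hg => ?_⟩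
      · rw [if_neg hμr, d1]
      · rw [if_neg hμr, hG]; simp
      · rw [hG, hevict]; simp
      · have hzl : (modifyAt zl d g).window = before zl d ++ G := by
          rw [window_modifyAt hpath.2, hg, haft, ← nl, ← nodeAt_append, ed, hG, hevict,
            window_eq_weave, isLeaf_iff.1 d4]
          simp
        have hmod : (nodeAt B p).children.modify E.length (fun c => modifyAt c d g) =
            a ++ modifyAt zl d g :: zr :: b := by
          rw [hab, ← haE, modify_append_cons]
        rw [hset, modifyAt_concat, window_eq_weave]
        simp only [hmod]
        rw [weave_append haE]
        simp [hzl, hwl]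
  obtain ⟨B₁, g, eB₁, st, w₁, hg, v₁⟩ := evictInner_prepare (idx := E.length) hμ hd c1 c2.2 c3 hne
    hda hdl hent
  rw [hwin g hg] at v₁
  have hv₁ : B₁.window = evictEntry e₀.1 B.window := by
    have h1 := window_eq c1.pathOK
    rw [hw0] at h1
    have h2 : B.window = (before B p ++ (weave a E ++ zl.window)) ++
        e₀ :: ((zr.window ++ weave' F b) ++ after B p) := by rw [h1]; simp
    rw [h2] at hsort ⊢
    rw [evictEntry_append_cons hsort, v₁]
    simp
  obtain ⟨B₂, top, L₂, R₂, h₂, q1, q2, q3, q4, q5⟩ := rebalanceForEvict_spec hμ pick (some p) st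
  unfold evictInner
  simp only [hleaf, hsub, eB₁, q1]
  by_cases hpt : p <:+ top
  · rw [if_pos hpt]
    obtain ⟨B₃, L₃, R₃, h₃, r1, r2, r3, r4⟩ := evictInnerLoop_spec L₂ R₂ hpt q4
    exact ⟨B₃, p, L₃, R₃, h₃, r1, List.suffix_rfl, (w₁.trans (q3.mono hpt)).trans r2, r3,
      r4.trans (q5.trans hv₁)⟩
  · rw [if_neg hpt]
    have htp : top <:+ p :=
      (List.suffix_or_suffix_of_suffix q2 (List.suffix_append d p)).resolve_right hpt
    exact ⟨B₂, top, L₂, R₂, h₂, rfl, htp, (w₁.mono htp).trans q3, q4, q5.trans hv₁⟩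

theorem evict_spec (hμ : 2 ≤ μ) (pick : Node T S → Addr → Bool) (hB : IsFingerBTree μ B) (t : T) :
    IsFingerBTree μ (B.evict μ pick t) ∧ (B.evict μ pick t).window = evictEntry t B.window := by
  obtain ⟨⟨H, hk⟩, hs⟩ := hB.exists_kids
  have hsort : Sorted B.window := hB.ordered
  obtain ⟨p, hp, ha, hf, ht⟩ := searchNode_spec hk hs hsort t
  obtain ⟨k, -, c1, c2, c3⟩ := loc_of_isAddr hk hs ha
  have hxs := sorted_window_of_pathOK hsort c1.pathOK
  have hes := sorted_entries hxs
  unfold evict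
  simp only [hp]
  split
  · -- `t` does not occur in the window
    rename_i hnone
    refine ⟨hB, (evictEntry_eq_self ?_).symm⟩
    rw [List.findIdx?_eq_none_iff] at hnone
    have hno : ∀ e ∈ (nodeAt B p).entries, e.1 ≠ t := fun e he => by simpa using hnone e he
    have hl : (nodeAt B p).isLeaf = true := by
      refine ht.resolve_right fun hc => ?_
      obtain ⟨e, he, het⟩ := List.any_eq_true.1 hc
      exact hno e he (by simpa using het)
    rw [window_eq c1.pathOK, window_eq_weave, isLeaf_iff.1 hl, weave_nil_left]
    intro e he
    rcases List.mem_append.1 he with he | he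
    · rcases List.mem_append.1 he with he | he
      · exact (hf.1 e he).ne
      · exact hno e he
    · exact (hf.2 e he).ne'
  · rename_i idx hidx
    rw [List.findIdx?_eq_some_iff_getElem] at hidx
    obtain ⟨hlt, hget, -⟩ := hidx
    obtain ⟨E, e₀, F, hEF, rfl⟩ := exists_eq_append_cons hlt
    obtain rfl : e₀.1 = t := by simpa [hEF] using hget
    obtain ⟨B', top, L', R', h', q1, q2, q3, q4, q5⟩ : ∃ B' top L' R' h',
        (if (nodeAt B p).isLeaf = true then
          repairAggs ((B.localEvictTimeAndValue p e₀.1).rebalanceForEvict μ pick p none)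
        else repairAggs (B.evictInner μ pick p E.length)) = repairAggs (B', top, L', R') ∧
        top <:+ p ∧ Within B B' top ∧ StateOK μ μ (2 * μ) B' top h' ∧
        B'.window = evictEntry e₀.1 B.window := by
      by_cases hl : (nodeAt B p).isLeaf = true
      · have hev : evictEntry e₀.1 (nodeAt B p).entries = E ++ F := by
          rw [hEF] at hes ⊢
          exact evictEntry_append_cons hes
        have e : B.localEvictTimeAndValue p e₀.1 = (modifyAt B p fun _ =>
            ⟨(nodeAt B p).agg, E ++ F, (nodeAt B p).children⟩).localRepairAggIfUp p := by
          rw [localEvictTimeAndValue]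
          congr 1
          apply modifyAt_congr
          rw [← hev]
        obtain rfl := c2.2.eq_zero_iff.2 hl
        obtain ⟨s1, s2, s3⟩ := StateOK.of_replace (m := μ - 1) (M := 2 * μ) c1
          (y := ⟨(nodeAt B p).agg, E ++ F, (nodeAt B p).children⟩) c2.2 (by
            refine ⟨fun hne => ?_, ?_, fun hne => ?_⟩
            · have := c3.1 hne
              rw [arity, hEF] at this; simp [arity] at this ⊢; omega
            · have := c3.2.1
              rw [arity, hEF] at this; simp [arity] at this ⊢; omega
            · by_cases hEF0 : E ++ F = []
              · exact Or.inr ⟨hEF0, isLeaf_iff.1 hl⟩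
              · left
                have := List.length_pos_iff.2 hEF0
                simp only [arity]; omega)
        rw [← e] at s1 s2 s3
        obtain ⟨B', top, L', R', h', q1, q2, q3, q4, q5⟩ :=
          rebalanceForEvict_spec hμ pick none s1
        refine ⟨B', top, L', R', h', by rw [if_pos hl, q1], q2, (s2.mono q2).trans q3, q4, ?_⟩
        have hw : B.window = (before B p ++ E) ++ e₀ :: (F ++ after B p) := by
          rw [window_eq c1.pathOK, window_eq_weave, isLeaf_iff.1 hl, hEF]
          simp
        rw [q5, s3, window_eq_weave, isLeaf_iff.1 hl]
        rw [hw] at hsort ⊢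
        rw [evictEntry_append_cons hsort]
        simp
      · obtain ⟨B', top, L', R', h', q1, q⟩ := evictInner_spec hμ pick hk hs hsort ha
          (by simpa using hl) hEF
        exact ⟨B', top, L', R', h', by rw [if_neg hl, q1], q⟩
    obtain ⟨⟨r1, r2, r3⟩, r4⟩ := repairAggs_spec hB (ha.suffix q2) q3 q4 L' R'
    rw [q1]
    exact ⟨⟨r1, r2, by rw [Ordered, r4, q5]; exact evictEntry_sorted hsort, r3⟩, r4.trans q5⟩

theorem isFingerBTree_empty (hμ : 2 ≤ μ) : IsFingerBTree μ (empty : Node T S) := by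
  have hk : Kids μ 0 true true (empty : Node T S) := rfl
  have hs : Sized μ (2 * μ) [] (empty : Node T S) :=
    ⟨by simp, by simp [arity, empty]; omega, fun _ => Or.inr ⟨rfl, rfl⟩⟩
  obtain ⟨i1, i2, i3⟩ := invariants_of_kids hk hs
  have hnil : ∀ p : Addr, IsAddr (empty : Node T S) p → p = [] := by
    intro p hp
    obtain ⟨k, k1, -⟩ := loc_of_isAddr hk hs hp
    exact List.length_eq_zero_iff.1 (by omega)
  exact ⟨i1, i2, List.Pairwise.nil, ⟨rfl, fun p hp hne => absurd (hnil p hp) hne,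
    fun p hp hne => absurd (hnil p hp) hne, i3⟩⟩

theorem update_spec (hμ : 2 ≤ μ) (pick : Node T S → Addr → Bool) (hB : IsFingerBTree μ B)
    (o : Op T S) :
    IsFingerBTree μ (B.update μ pick o) ∧ (B.update μ pick o).window = Op.onWindow B.window o := by
  cases o with
  | insert t v => exact insert_spec hμ hB t v
  | evict t => exact evict_spec hμ pick hB t

theorem foldl_update_spec (hμ : 2 ≤ μ) (pick : Node T S → Addr → Bool) (hB : IsFingerBTree μ B)
    (ops : List (Op T S)) :
    IsFingerBTree μ (ops.foldl (update μ pick) B) ∧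
      (ops.foldl (update μ pick) B).window = ops.foldl Op.onWindow B.window := by
  induction ops generalizing B with
  | nil => exact ⟨hB, rfl⟩
  | cons o ops ih =>
    obtain ⟨h1, h2⟩ := update_spec hμ pick hB o
    rw [List.foldl_cons, List.foldl_cons, ← h2]
    exact ih h1

end Updates

end Node
end FiBA

theorem mainTheorem3 {T : Type*} {S : Type*} [LinearOrder T] [Monoid S]
    (μ : ℕ) (hμ : 2 ≤ μ) (pick : FiBA.Node T S → FiBA.Addr → Bool) :
    -- in every finger B-tree with aggregates, `query` aggregates the stored window
    (∀ (B : FiBA.Node T S) (w : List (T × S)), B.IsFingerBTree μ → B.window = w →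
      B.query = FiBA.aggregate w) ∧
    -- the empty tree is such a tree, and `insert` and `evict` preserve all invariants and
    -- change the stored window as they should
    ((FiBA.Node.empty : FiBA.Node T S).IsFingerBTree μ ∧
      (FiBA.Node.empty : FiBA.Node T S).window = []) ∧
    (∀ B : FiBA.Node T S, B.IsFingerBTree μ → ∀ (t : T) (v : S),
      (B.insert μ t v).IsFingerBTree μ ∧
      (B.insert μ t v).window = FiBA.insertEntry t v B.window) ∧
    (∀ B : FiBA.Node T S, B.IsFingerBTree μ → ∀ t : T,
      (B.evict μ pick t).IsFingerBTree μ ∧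
      (B.evict μ pick t).window = FiBA.evictEntry t B.window) ∧
    -- hence `query` is right after any sequence of operations on an initially empty tree
    (∀ ops : List (FiBA.Op T S),
      (ops.foldl (FiBA.Node.update μ pick) FiBA.Node.empty).query =
        FiBA.aggregate (ops.foldl FiBA.Op.onWindow [])) := by
  refine ⟨?_, ⟨FiBA.Node.isFingerBTree_empty hμ, rfl⟩, fun B hB => FiBA.Node.insert_spec hμ hB,
    fun B hB => FiBA.Node.evict_spec hμ pick hB, fun ops => ?_⟩
  · rintro B w hB rfl
    exact FiBA.Node.query_eq hB
  · obtain ⟨h1, h2⟩ :=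
      FiBA.Node.foldl_update_spec hμ pick (FiBA.Node.isFingerBTree_empty (T := T) (S := S) hμ) ops
    rw [FiBA.Node.query_eq h1, h2]
    rfl
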